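/- Graphs are finite and undirected; parallel edges and self-loops are allowed (a self-loop counts twice in the degree). For $S\subseteq V$ let $\mathrm{vol}(S)=\sum_{v\in S}\deg(v)$, and let $$\Phi_G(S)=\frac{|E(S,V\setminus S)|}{\min(\mathrm{vol}(S),\mathrm{vol}(V\setminus S))}.$$ For disjoint $A^l,A^r\subseteq V$ and an integer $c$, let $\Pi(G)$ be the flow problem in which each vertex of $A^l$ is a source of one unit, each vertex of $A^r$ is a sink of capacity one, and every edge has capacity $c$. A feasible flow assigns to each edge a signed amount of at most $c$ in absolute value, so that for every vertex $v$ the mass $f(v)$ ending at $v$ (the source mass of $v$ plus the net inflow) satisfies $0\le f(v)\le T(v)$, where $T(v)$ is the sink capacity of $v$; so every source ships out one unit. For $S\subseteq V$, $\Pi(G-S)$ is the same problem on the induced subgraph $G[V\setminus S]$ with sources $A^l\setminus S$ and sinks $A^r\setminus S$. **Theorem.** There is a deterministic algorithm with the following property. Let $0<a,b$ be constants. There is a constant $K>0$, depending only on $a$ and $b$, such that for every connected graph $G=(V,E)$ with $n$ vertices and $m\ge 2$ edges, all disjoint $A^l,A^r\subseteq V$ with $|A^r|\ge\frac{5}{24}m$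 and $|A^l|\le\frac18 m$, every real $0<\phi<\frac1{\log m}$ and every integer $c>1000$ with $\frac{a}{\phi\log m}\le c\le\frac{b}{\phi\log m}$ (that is, $c=\Theta(\frac1{\phi\log m})$), the algorithm, given the edge list of $G$, the indicator vectors of $A^l$ and $A^r$, and $c$, halts after at most $K\frac m\phi$ steps on a word RAM with words of $O(\log(m+c))$ bits and outputs one of the following: 1. a feasible flow for $\Pi(G)$; or 2. a nonempty set $S\subseteq V$ with $\Phi_G(S)\le\frac{50}{c}$, also $\Phi_G(S)\le K\phi\log m$, and $\mathrm{vol}(V\setminus S)\ge\frac1{26}m$, together with a feasible flow for $\Pi(G-S)$. Moreover, every vertex all of whose neighbours are in $S$ is in $S$, and every vertex all of whose neighbours are in $V\setminus S$ is in $V\setminus S$. -/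

import Mathlib

/-! ### Graphs

A graph with vertex set `Fin n` and `m` edges, given by the list of its edges. Parallel edges and
self-loops are allowed; a simple graph is the case in which no unordered pair is repeated and no
edge has equal ends. The order of the two ends of an edge carries no information: it only fixes the
sign convention for flows. -/

structure EdgeListGraph (n m : ℕ) where
  fst : Fin m → Fin n
  snd : Fin m → Fin n

namespace EdgeListGraph

variable {n m : ℕ}

/-- `u` and `v` are neighbours. -/
def Adj (G : EdgeListGraph n m) (u v : Fin n) : Prop :=
  ∃ e, (G.fst e = u ∧ G.snd e = v) ∨ (G.fst e = v ∧ G.snd e = u)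

def Connected (G : EdgeListGraph n m) : Prop :=
  (SimpleGraph.fromRel G.Adj).Connected

/-- The degree of a vertex (a self-loop counts twice, so that the degrees add up to `2 * m`). -/
def degree (G : EdgeListGraph n m) (v : Fin n) : ℕ :=
  (Finset.univ.filter fun e => G.fst e = v).card + (Finset.univ.filter fun e => G.snd e = v).card

def vol (G : EdgeListGraph n m) (S : Finset (Fin n)) : ℕ :=
  ∑ v ∈ S, G.degree v

/-- The number of edges between `S` and its complement. -/
def cutSize (G : EdgeListGraph n m) (S : Finset (Fin n)) : ℕ :=
  (Finset.univ.filter fun e => ¬ (G.fst e ∈ S ↔ G.snd e ∈ S)).card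

/-- The conductance of the cut `(S, Sᶜ)`. -/
noncomputable def conductance (G : EdgeListGraph n m) (S : Finset (Fin n)) : ℝ :=
  (G.cutSize S : ℝ) / (min (G.vol S) (G.vol Sᶜ) : ℕ)

/-- Every vertex all of whose neighbours are in `S` is in `S`, and every vertex all of whose
neighbours are outside `S` is outside `S`. -/
def CutRespectsNeighbours (G : EdgeListGraph n m) (S : Finset (Fin n)) : Prop :=
  (∀ v, (∀ u, G.Adj v u → u ∈ S) → v ∈ S) ∧ (∀ v, (∀ u, G.Adj v u → u ∉ S) → v ∉ S)

end EdgeListGraph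

/-! ### Flow problems -/

/-- `source v` is the mass initially placed on `v`, `sink v` is the capacity of `v` as a sink, and
`cap e` is the capacity of the edge `e`. -/
structure FlowProblem (n m : ℕ) where
  source : Fin n → ℝ
  sink : Fin n → ℝ
  cap : Fin m → ℝ

/-- Each vertex of `Al` is a source of one unit, each vertex of `Ar` is a sink of capacity one,
every edge has capacity `c`. -/
noncomputable def unitFlowProblem {n m : ℕ} (c : ℕ) (Al Ar : Finset (Fin n)) : FlowProblem n m where
  source v := if v ∈ Al then 1 else 0
  sink v := if v ∈ Ar then 1 else 0
  cap _ := c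

namespace EdgeListGraph

variable {n m : ℕ}

/-- The net amount of mass that the flow `f` routes away from `v`. Here `f e` is the amount routed
along the edge `e` from its first to its second end (negative if mass is routed from the second to
the first end). -/
noncomputable def netOut (G : EdgeListGraph n m) (f : Fin m → ℝ) (v : Fin n) : ℝ :=
  ∑ e, ((if G.fst e = v then f e else 0) - (if G.snd e = v then f e else 0))

/-- `f` is a feasible flow for the flow problem `P` on the induced subgraph `G[A]`: it lives on the
edges of `G[A]`, obeys the edge capacities, the net amount of mass routed away from a vertex is at
most its source mass, and the mass ending at a vertex is at most its sink capacity. -/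
structure IsFeasibleFlowOn (G : EdgeListGraph n m) (A : Finset (Fin n)) (P : FlowProblem n m)
    (f : Fin m → ℝ) : Prop where
  support : ∀ e, ¬ (G.fst e ∈ A ∧ G.snd e ∈ A) → f e = 0
  capacity : ∀ e, G.fst e ∈ A → G.snd e ∈ A → |f e| ≤ P.cap e
  netOut_le : ∀ v ∈ A, G.netOut f v ≤ P.source v
  ending_le : ∀ v ∈ A, P.source v - G.netOut f v ≤ P.sink v

end EdgeListGraph

/-! ### The machine model

A word RAM, programmed with structured control flow. The memory consists of registers and of arrays
(a program names finitely many of each), all of whose cells hold natural numbers below a word bound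
`B`, i.e. words of `log₂ B` bits. Arrays have random access. Every constant, register access, array
access, arithmetic operation, comparison, assignment and branch costs one step. An operation whose
result is not below `B` has no result, and the program does not run to completion. -/

namespace WordRAM

structure State where
  reg : ℕ → ℕ
  arr : ℕ → ℕ → ℕ

inductive Op
  | add | sub | mul | div | lt | eq

/-- Subtraction is truncated at `0`, division rounds down (with `x / 0 = 0`), and comparisons
return `1` for true and `0` for false. -/
def Op.eval : Op → ℕ → ℕ → ℕ
  | .add, x, y => x + y
  | .sub, x, y => x - y
  | .mul, x, y => x * y
  | .div, x, y => x / y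
  | .lt, x, y => if x < y then 1 else 0
  | .eq, x, y => if x = y then 1 else 0

inductive Expr
  | const (k : ℕ)
  | reg (x : ℕ)
  /-- The entry of array `a` at the index given by `i`. -/
  | get (a : ℕ) (i : Expr)
  | op (o : Op) (e₁ e₂ : Expr)

/-- The number of steps needed to evaluate an expression. -/
def Expr.cost : Expr → ℕ
  | .const _ => 1
  | .reg _ => 1
  | .get _ i => i.cost + 1
  | .op _ e₁ e₂ => e₁.cost + e₂.cost + 1

/-- The value of an expression, if no intermediate result exceeds the word bound `B`. -/
def Expr.eval (B : ℕ) (s : State) : Expr → Option ℕ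
  | .const k => if k < B then some k else none
  | .reg x => some (s.reg x)
  | .get a i => (i.eval B s).map (s.arr a)
  | .op o e₁ e₂ =>
    (e₁.eval B s).bind fun x => (e₂.eval B s).bind fun y =>
      if o.eval x y < B then some (o.eval x y) else none

inductive Cmd
  | skip
  /-- `x := e`. -/
  | assign (x : ℕ) (e : Expr)
  /-- `a[i] := e`. -/
  | store (a : ℕ) (i e : Expr)
  | seq (p q : Cmd)
  | ite (e : Expr) (p q : Cmd)
  | while (e : Expr) (p : Cmd)

def State.setReg (s : State) (x v : ℕ) : State :=
  { s with reg := Function.update s.reg x v }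

def State.setArr (s : State) (a i v : ℕ) : State :=
  { s with arr := Function.update s.arr a (Function.update (s.arr a) i v) }

/-- `Exec B p s t s'`: with word bound `B`, the program `p` started in the state `s` halts after
exactly `t` steps in the state `s'`. A branching condition holds if its value is nonzero. -/
inductive Exec (B : ℕ) : Cmd → State → ℕ → State → Prop
  | skip (s : State) : Exec B .skip s 1 s
  | assign (s : State) (x : ℕ) (e : Expr) (v : ℕ) (he : e.eval B s = some v) :
      Exec B (.assign x e) s (e.cost + 1) (s.setReg x v)
  | store (s : State) (a : ℕ) (i e : Expr) (j v : ℕ)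
      (hi : i.eval B s = some j) (he : e.eval B s = some v) :
      Exec B (.store a i e) s (i.cost + e.cost + 1) (s.setArr a j v)
  | seq (p q : Cmd) (s s₁ s₂ : State) (t₁ t₂ : ℕ)
      (hp : Exec B p s t₁ s₁) (hq : Exec B q s₁ t₂ s₂) :
      Exec B (.seq p q) s (t₁ + t₂) s₂
  | ite_true (e : Expr) (p q : Cmd) (s s₁ : State) (v t : ℕ)
      (he : e.eval B s = some v) (hv : v ≠ 0) (hp : Exec B p s t s₁) :
      Exec B (.ite e p q) s (e.cost + 1 + t) s₁
  | ite_false (e : Expr) (p q : Cmd) (s s₁ : State) (t : ℕ)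
      (he : e.eval B s = some 0) (hq : Exec B q s t s₁) :
      Exec B (.ite e p q) s (e.cost + 1 + t) s₁
  | while_true (e : Expr) (p : Cmd) (s s₁ s₂ : State) (v t₁ t₂ : ℕ)
      (he : e.eval B s = some v) (hv : v ≠ 0)
      (hp : Exec B p s t₁ s₁) (hw : Exec B (.while e p) s₁ t₂ s₂) :
      Exec B (.while e p) s (e.cost + 1 + t₁ + t₂) s₂
  | while_false (e : Expr) (p : Cmd) (s : State) (he : e.eval B s = some 0) :
      Exec B (.while e p) s (e.cost + 1) s

/-- A program has at most one halting run from a given state. -/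
theorem Exec.deterministic {B : ℕ} {p : Cmd} {s s₁ s₂ : State} {t₁ t₂ : ℕ}
    (h₁ : Exec B p s t₁ s₁) (h₂ : Exec B p s t₂ s₂) : t₁ = t₂ ∧ s₁ = s₂ := by
  induction h₁ generalizing t₂ s₂ with
  | skip s => cases h₂; simp
  | assign s x e v he => cases h₂ with
    | assign _ _ _ v' he' => simp_all
  | store s a i e j v hi he => cases h₂ with
    | store _ _ _ _ j' v' hi' he' => simp_all
  | seq p q s s₁ s₂ t₁ t₂ hp hq ihp ihq => cases h₂ with
    | seq _ _ _ _ _ _ _ hp' hq' =>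
      obtain ⟨rfl, rfl⟩ := ihp hp'
      obtain ⟨rfl, rfl⟩ := ihq hq'
      exact ⟨rfl, rfl⟩
  | ite_true e p q s s₁ v t he hv hp ih => cases h₂ with
    | ite_true _ _ _ _ _ _ _ _ _ hp' => obtain ⟨rfl, rfl⟩ := ih hp'; exact ⟨rfl, rfl⟩
    | ite_false _ _ _ _ _ _ he' _ => simp_all
  | ite_false e p q s s₁ t he hq ih => cases h₂ with
    | ite_true _ _ _ _ _ _ _ he' _ _ => simp_all
    | ite_false _ _ _ _ _ _ _ hq' => obtain ⟨rfl, rfl⟩ := ih hq'; exact ⟨rfl, rfl⟩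
  | while_true e p s s₁ s₂ v t₁ t₂ he hv hp hw ihp ihw => cases h₂ with
    | while_true _ _ _ _ _ _ _ _ _ _ hp' hw' =>
      obtain ⟨rfl, rfl⟩ := ihp hp'
      obtain ⟨rfl, rfl⟩ := ihw hw'
      exact ⟨rfl, rfl⟩
    | while_false _ _ _ he' => simp_all
  | while_false e p s he => cases h₂ with
    | while_true _ _ _ _ _ _ _ _ he' _ _ _ => simp_all
    | while_false _ _ _ _ => simp

end WordRAM

/-! ### Input and output of a program for the unit flow problem -/

/-- The initial state: `n`, `m`, `c` in registers `0`, `1`, `2`; the ends of the edges in arrays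
`0` and `1`; the indicators of `Al` and `Ar` in arrays `2` and `3`; everything else is `0`. -/
def unitFlowInput {n m : ℕ} (G : EdgeListGraph n m) (Al Ar : Finset (Fin n)) (c : ℕ) :
    WordRAM.State where
  reg x := if x = 0 then n else if x = 1 then m else if x = 2 then c else 0
  arr a i :=
    if a = 0 then (if h : i < m then (G.fst ⟨i, h⟩ : ℕ) else 0)
    else if a = 1 then (if h : i < m then (G.snd ⟨i, h⟩ : ℕ) else 0)
    else if a = 2 then (if ∃ v ∈ Al, (v : ℕ) = i then 1 else 0)
    else if a = 3 then (if ∃ v ∈ Ar, (v : ℕ) = i then 1 else 0)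
    else 0

/-- The flow written in the final state: entry `e` of array `4` is the amount sent along the edge
`e` from its first to its second end, entry `e` of array `5` the amount sent in the opposite
direction. -/
def outputFlow (m : ℕ) (s : WordRAM.State) (e : Fin m) : ℝ :=
  (s.arr 4 e : ℝ) - (s.arr 5 e : ℝ)

/-- The cut written in the final state: the vertices whose entry in array `6` is nonzero. -/
def outputCut (n : ℕ) (s : WordRAM.State) : Finset (Fin n) :=
  Finset.univ.filter fun v => s.arr 6 v ≠ 0

/-! ### A calculus for bounded word RAM programs -/

namespace WordRAM

/-! The program is a push-relabel algorithm with labels bounded by `h = O(c log m)` that moves one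
unit of mass, the token, at a time, and removes a sparse set of vertices whenever the token climbs
to label `h`.

Each edge becomes two opposite arcs whose residual capacities add up to `2c`. Labels drop by at most
one along residual arcs, and unsaturated sinks have label 0. If the token reaches label `h` at `x`,
a ball `J` is grown around `x` along residual arcs. As long as the number `z` of residual arcs
leaving the ball satisfies `200cz > vol J`, the next layer multiplies the volume by more than `1 +
1/(200c)`. The volume never exceeds `2m`, so growth stops after fewer than `h` layers
(`lt_of_succ_pow_le`), all labels in `J` are still positive, and every sink in `J` is saturated
(`Ball.one_le_lab`). All but `z` of the arcs from `J` to the remaining vertices carry the full flow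
`c`. Balancing the mass in `J` bounds their number (`le_sum_out`), and `cut_union` turns this into
the inequality `200c·cut + 200·sinks ≤ 200·sources + 2·vol` for the union of all removed sets
(`Ball.deadInv`). Together with `|A^l| ≤ m/8` and `|A^r| ≥ 5m/24` it gives both the sparsity of the
cut and the volume of the other side (`cut_bounds`).

Flow across the boundary of a removed set is treated according to its direction. Flow into `J` is
handed back to the vertices it came from as pending mass. It runs against residual arcs leaving `J`,
so it amounts to at most `cz ≤ vol J / 200` units. Flow out of `J` stays in place during the main
loop as additional supply: an edge brings in at most `c`, which is just what the inequality gains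
when this edge disappears from the boundary. In the end each such unit is followed forward to a
saturated sink, which is released (`Ext`), so that only mass from remaining sources is left.

The running time is controlled by the potential `Net.pot`, which pays for relabelling, current arcs,
pending units, the stack and removed volume. It starts at `O(h·m)`, hence the total time is
`O(m·c·log m) = O(m/φ)`. Cancelling the external flow costs only `O(m·c)`.

The cut that is output consists of the removed vertices and of those remaining vertices all of whose
neighbours were removed. The latter add no cut edges, and there are at most as many of them as edges
on the boundary. This choice, with the fact that every removed vertex has a removed neighbour, gives
the two conditions on neighbourhoods. -/

instance : Add Expr := ⟨Expr.op .add⟩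
instance : Sub Expr := ⟨Expr.op .sub⟩
instance : Mul Expr := ⟨Expr.op .mul⟩
instance (k : ℕ) : OfNat Expr k := ⟨Expr.const k⟩

/-- The comparison `e₁ < e₂`. -/
def Expr.lt (e₁ e₂ : Expr) : Expr := .op .lt e₁ e₂

/-- The comparison `e₁ = e₂`. -/
def Expr.eq (e₁ e₂ : Expr) : Expr := .op .eq e₁ e₂

infixr:60 " ;; " => Cmd.seq

/-- The value of an expression when no word bound is imposed. -/
def Expr.val (s : State) : Expr → ℕ
  | .const k => k
  | .reg x => s.reg x
  | .get a i => s.arr a (i.val s)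
  | .op o e₁ e₂ => o.eval (e₁.val s) (e₂.val s)

/-- No intermediate result of the evaluation reaches the word bound. -/
def Expr.Ok (B : ℕ) (s : State) : Expr → Prop
  | .const k => k < B
  | .reg _ => True
  | .get _ i => i.Ok B s
  | .op o e₁ e₂ => e₁.Ok B s ∧ e₂.Ok B s ∧ o.eval (e₁.val s) (e₂.val s) < B

/-- Separates the computed value from the word-bound side conditions, so that programs can be
evaluated by `simp` and the bounds left to arithmetic. -/
theorem Expr.eval_eq_some_iff {B : ℕ} {s : State} {e : Expr} {v : ℕ} :
    e.eval B s = some v ↔ e.Ok B s ∧ e.val s = v := by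
  induction e generalizing v with
  | const k => simp [eval, Ok, val]
  | reg x => simp [eval, Ok, val]
  | get a i ih =>
    simp only [eval, Option.map_eq_some_iff, ih, Ok, val]
    constructor
    · rintro ⟨j, ⟨h, rfl⟩, rfl⟩; exact ⟨h, rfl⟩
    · rintro ⟨h, rfl⟩; exact ⟨_, ⟨h, rfl⟩, rfl⟩
  | op o e₁ e₂ ih₁ ih₂ =>
    simp only [eval, Option.bind_eq_some_iff, ih₁, ih₂, Ok, val]
    constructor
    · rintro ⟨x, ⟨h₁, rfl⟩, y, ⟨h₂, rfl⟩, h⟩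
      split_ifs at h with hB
      exact ⟨⟨h₁, h₂, hB⟩, by simpa using h⟩
    · rintro ⟨⟨h₁, h₂, hB⟩, rfl⟩
      exact ⟨_, ⟨h₁, rfl⟩, _, ⟨h₂, rfl⟩, by simp [hB]⟩

section ExprSimp

variable (B : ℕ) (s : State) (e₁ e₂ : Expr)

theorem val_add : (e₁ + e₂).val s = e₁.val s + e₂.val s := rfl
theorem val_sub : (e₁ - e₂).val s = e₁.val s - e₂.val s := rfl
theorem val_mul : (e₁ * e₂).val s = e₁.val s * e₂.val s := rfl
theorem val_lt : (e₁.lt e₂).val s = if e₁.val s < e₂.val s then 1 else 0 := rfl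
theorem val_eq : (e₁.eq e₂).val s = if e₁.val s = e₂.val s then 1 else 0 := rfl
theorem val_lit (k : ℕ) : (no_index (OfNat.ofNat k) : Expr).val s = k := rfl
theorem val_reg (x : ℕ) : (Expr.reg x).val s = s.reg x := rfl
theorem val_get (a : ℕ) : (Expr.get a e₁).val s = s.arr a (e₁.val s) := rfl
theorem ok_add : (e₁ + e₂).Ok B s ↔ e₁.Ok B s ∧ e₂.Ok B s ∧ e₁.val s + e₂.val s < B := Iff.rfl
theorem ok_sub : (e₁ - e₂).Ok B s ↔ e₁.Ok B s ∧ e₂.Ok B s ∧ e₁.val s - e₂.val s < B := Iff.rfl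
theorem ok_mul : (e₁ * e₂).Ok B s ↔ e₁.Ok B s ∧ e₂.Ok B s ∧ e₁.val s * e₂.val s < B := Iff.rfl
theorem ok_lt : (e₁.lt e₂).Ok B s ↔
    e₁.Ok B s ∧ e₂.Ok B s ∧ (if e₁.val s < e₂.val s then 1 else 0) < B := Iff.rfl
theorem ok_eq : (e₁.eq e₂).Ok B s ↔
    e₁.Ok B s ∧ e₂.Ok B s ∧ (if e₁.val s = e₂.val s then 1 else 0) < B := Iff.rfl
theorem ok_lit (k : ℕ) : (no_index (OfNat.ofNat k) : Expr).Ok B s ↔ k < B := Iff.rfl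
theorem ok_reg (x : ℕ) : (Expr.reg x).Ok B s ↔ True := Iff.rfl
theorem ok_get (a : ℕ) : (Expr.get a e₁).Ok B s ↔ e₁.Ok B s := Iff.rfl
theorem cost_add : (e₁ + e₂).cost = e₁.cost + e₂.cost + 1 := rfl
theorem cost_sub : (e₁ - e₂).cost = e₁.cost + e₂.cost + 1 := rfl
theorem cost_mul : (e₁ * e₂).cost = e₁.cost + e₂.cost + 1 := rfl
theorem cost_lt : (e₁.lt e₂).cost = e₁.cost + e₂.cost + 1 := rfl
theorem cost_eq : (e₁.eq e₂).cost = e₁.cost + e₂.cost + 1 := rfl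
theorem cost_lit (k : ℕ) : (no_index (OfNat.ofNat k) : Expr).cost = 1 := rfl
theorem cost_reg (x : ℕ) : (Expr.reg x).cost = 1 := rfl
theorem cost_get (a : ℕ) : (Expr.get a e₁).cost = e₁.cost + 1 := rfl

theorem ite_one_zero_lt_iff {B : ℕ} (hB : 1 < B) (p : Prop) [Decidable p] :
    ((if p then 1 else 0) < B) ↔ True := by
  split_ifs <;> simp <;> omega

end ExprSimp

theorem setReg_reg (s : State) (x v y : ℕ) :
    (s.setReg x v).reg y = if y = x then v else s.reg y := by
  simp [State.setReg, Function.update_apply]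

theorem setReg_arr (s : State) (x v : ℕ) : (s.setReg x v).arr = s.arr := rfl

theorem setArr_reg (s : State) (a i v : ℕ) : (s.setArr a i v).reg = s.reg := rfl

theorem setArr_arr (s : State) (a i v b : ℕ) :
    (s.setArr a i v).arr b = if b = a then Function.update (s.arr a) i v else s.arr b := by
  simp only [State.setArr, Function.update_apply]

/-- Started in the state `s` at time `t`, the program `p` halts at a time and in a state that
satisfy `Q`. -/
def Wp (B : ℕ) (p : Cmd) (Q : ℕ → State → Prop) (t : ℕ) (s : State) : Prop :=
  ∃ t' s', Exec B p s t' s' ∧ Q (t + t') s'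

section Wp

variable {B : ℕ} {Q Q' : ℕ → State → Prop} {t : ℕ} {s : State}

theorem Wp.mono {p : Cmd} (h : Wp B p Q t s) (hQ : ∀ t s, Q t s → Q' t s) : Wp B p Q' t s := by
  obtain ⟨t', s', he, hq⟩ := h
  exact ⟨t', s', he, hQ _ _ hq⟩

theorem wp_skip : Wp B .skip Q t s ↔ Q (t + 1) s := by
  constructor
  · rintro ⟨t', s', he, hq⟩; cases he; exact hq
  · intro h; exact ⟨_, _, .skip s, h⟩

theorem wp_assign {x : ℕ} {e : Expr} :
    Wp B (.assign x e) Q t s ↔ e.Ok B s ∧ Q (t + (e.cost + 1)) (s.setReg x (e.val s)) := by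
  constructor
  · rintro ⟨t', s', he, hq⟩
    cases he with
    | assign _ _ _ v h =>
      obtain ⟨h₁, rfl⟩ := Expr.eval_eq_some_iff.1 h
      exact ⟨h₁, hq⟩
  · rintro ⟨h, hq⟩
    exact ⟨_, _, .assign s x e _ (Expr.eval_eq_some_iff.2 ⟨h, rfl⟩), hq⟩

theorem wp_store {a : ℕ} {i e : Expr} :
    Wp B (.store a i e) Q t s ↔ i.Ok B s ∧ e.Ok B s ∧
      Q (t + (i.cost + e.cost + 1)) (s.setArr a (i.val s) (e.val s)) := by
  constructor
  · rintro ⟨t', s', he, hq⟩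
    cases he with
    | store _ _ _ _ j v hi h =>
      obtain ⟨h₁, rfl⟩ := Expr.eval_eq_some_iff.1 h
      obtain ⟨h₂, rfl⟩ := Expr.eval_eq_some_iff.1 hi
      exact ⟨h₂, h₁, hq⟩
  · rintro ⟨hi, h, hq⟩
    exact ⟨_, _, .store s a i e _ _ (Expr.eval_eq_some_iff.2 ⟨hi, rfl⟩)
      (Expr.eval_eq_some_iff.2 ⟨h, rfl⟩), hq⟩

theorem wp_seq {p q : Cmd} : Wp B (p ;; q) Q t s ↔ Wp B p (Wp B q Q) t s := by
  constructor
  · rintro ⟨t', s', he, hq⟩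
    cases he with
    | seq _ _ _ s₁ _ t₁ t₂ h₁ h₂ =>
      exact ⟨t₁, s₁, h₁, t₂, s', h₂, by rwa [add_assoc]⟩
  · rintro ⟨t₁, s₁, h₁, t₂, s', h₂, hq⟩
    exact ⟨_, _, .seq _ _ _ _ _ _ _ h₁ h₂, by rwa [← add_assoc]⟩

theorem wp_ite {e : Expr} {p q : Cmd} :
    Wp B (.ite e p q) Q t s ↔ e.Ok B s ∧ (e.val s ≠ 0 → Wp B p Q (t + (e.cost + 1)) s) ∧
      (e.val s = 0 → Wp B q Q (t + (e.cost + 1)) s) := by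
  constructor
  · rintro ⟨t', s', he, hq⟩
    cases he with
    | ite_true _ _ _ _ _ v t₁ h hv hp =>
      obtain ⟨h₁, rfl⟩ := Expr.eval_eq_some_iff.1 h
      exact ⟨h₁, fun _ => ⟨_, _, hp, by rwa [add_assoc]⟩, fun h => absurd h hv⟩
    | ite_false _ _ _ _ _ t₁ h hp =>
      obtain ⟨h₁, hv⟩ := Expr.eval_eq_some_iff.1 h
      exact ⟨h₁, fun h => absurd hv h, fun _ => ⟨_, _, hp, by rwa [add_assoc]⟩⟩
  · rintro ⟨hok, h₁, h₂⟩
    by_cases hv : e.val s = 0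
    · obtain ⟨t', s', he, hq⟩ := h₂ hv
      exact ⟨_, _, .ite_false _ _ _ _ _ _ (Expr.eval_eq_some_iff.2 ⟨hok, hv⟩) he,
        by rwa [← add_assoc]⟩
    · obtain ⟨t', s', he, hq⟩ := h₁ hv
      exact ⟨_, _, .ite_true _ _ _ _ _ _ _ (Expr.eval_eq_some_iff.2 ⟨hok, rfl⟩) hv he,
        by rwa [← add_assoc]⟩

/-- The invariant `I` may mention the time; it has to bound the time by `T`, which makes the loop
terminate. -/
theorem wp_while {e : Expr} {p : Cmd} (T : ℕ) (I : ℕ → State → Prop)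
    (hT : ∀ t s, I t s → t ≤ T)
    (step : ∀ t s, I t s → e.Ok B s ∧ (e.val s ≠ 0 → Wp B p I (t + (e.cost + 1)) s) ∧
      (e.val s = 0 → Q (t + (e.cost + 1)) s))
    (h : I t s) : Wp B (.while e p) Q t s := by
  induction hk : T - t using Nat.strong_induction_on generalizing t s with
  | _ k ih =>
    obtain ⟨hok, h₁, h₂⟩ := step t s h
    by_cases hv : e.val s = 0
    · exact ⟨_, _, .while_false _ _ _ (Expr.eval_eq_some_iff.2 ⟨hok, hv⟩), h₂ hv⟩
    · obtain ⟨t', s', he, hI⟩ := h₁ hv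
      -- The variant is the remaining time `T - t`; it decreases because testing the condition
      -- already takes a step.
      have hb := hT _ _ hI
      obtain ⟨t'', s'', he', hq⟩ := ih (T - (t + (e.cost + 1) + t')) (by omega) hI rfl
      refine ⟨_, _, .while_true _ _ _ _ _ _ _ _ (Expr.eval_eq_some_iff.2 ⟨hok, rfl⟩) hv he he', ?_⟩
      rw [show t + (e.cost + 1 + t' + t'') = t + (e.cost + 1) + t' + t'' by omega]
      exact hq

end Wp

attribute [simp] val_add val_sub val_mul val_lt val_eq val_lit val_reg val_get ok_add ok_sub ok_mul
  ok_lt ok_eq ok_lit ok_reg ok_get cost_add cost_sub cost_mul cost_lt cost_eq cost_lit cost_reg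
  cost_get setReg_reg setReg_arr setArr_reg setArr_arr wp_skip wp_assign wp_store wp_seq wp_ite

end WordRAM

section

/-! ### Flow networks on arcs -/

open Finset Function

/-- `p = a + 1` for the last arc `a < k` with tail `v`, and `p = 0` if there is none. -/
structure IsArcPtr (tl : ℕ → ℕ) (v k p : ℕ) : Prop where
  le : p ≤ k
  tail : p = 0 ∨ tl (p - 1) = v
  skip : ∀ a, p ≤ a → a < k → tl a ≠ v

/-- A network with `n` vertices and `M` arcs: `tl a` is the tail of the arc `a` and `rv a` its
reverse. The arcs with a given tail `v` form a linked list with first entry `hd v` and successor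
function `nx`. Vertices have sources `src` and sinks `snk`, `c` is half of the capacity of an arc
and `h` bounds the labels. -/
structure Net where
  (n M c h : ℕ)
  (tl rv hd nx src snk : ℕ → ℕ)
  one_lt_c : 1 < c
  tl_lt : ∀ a < M, tl a < n
  rv_lt : ∀ a < M, rv a < M
  rv_rv : ∀ a < M, rv (rv a) = a
  rv_ne : ∀ a < M, rv a ≠ a
  exists_tl : ∀ v < n, ∃ a < M, tl a = v
  hd_ptr : ∀ v < n, IsArcPtr tl v M (hd v)
  nx_ptr : ∀ a < M, IsArcPtr tl (tl a) a (nx a)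
  src_le : ∀ v, src v ≤ 1
  snk_le : ∀ v, snk v ≤ 1
  lt_h : ∀ d, (200 * c + 1) ^ d ≤ M * (200 * c) ^ d → d < h

namespace Net

variable (N : Net)

def dst (a : ℕ) : ℕ := N.tl (N.rv a)

/-- The arcs with tail in `J`. -/
def arcs (J : Finset ℕ) : Finset ℕ := (range N.M).filter fun a => N.tl a ∈ J

/-- The number of arcs below `p` with tail `v`. -/
def cnt (v p : ℕ) : ℕ := ((range p).filter fun a => N.tl a = v).card

def vol (J : Finset ℕ) : ℕ := (N.arcs J).card

/-- The number of arcs that leave `S`. -/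
def cut (S : Finset ℕ) : ℕ := ((N.arcs S).filter fun a => N.dst a ∉ S).card

/-- The net flow out of `v`, where the flow on the arc `a` is `c - R a`. -/
def out (R : ℕ → ℕ) (v : ℕ) : ℤ := ∑ a ∈ range N.M, if N.tl a = v then (N.c : ℤ) - R a else 0

/-- The vertices marked by `D`. -/
def dead (D : ℕ → ℕ) : Finset ℕ := (range N.n).filter fun v => D v ≠ 0

/-- The residual arcs from `J` to vertices not marked by `D`. -/
def outRes (R D : ℕ → ℕ) (J : Finset ℕ) : Finset ℕ :=
  (N.arcs J).filter fun a => D (N.dst a) = 0 ∧ 0 < R a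

variable {N}

theorem dst_lt {a : ℕ} (ha : a < N.M) : N.dst a < N.n := N.tl_lt _ (N.rv_lt a ha)

theorem dst_rv {a : ℕ} (ha : a < N.M) : N.dst (N.rv a) = N.tl a := by rw [dst, N.rv_rv a ha]

theorem mem_arcs {J : Finset ℕ} {a : ℕ} : a ∈ N.arcs J ↔ a < N.M ∧ N.tl a ∈ J := by simp [arcs]

theorem mem_dead {D : ℕ → ℕ} {v : ℕ} : v ∈ N.dead D ↔ v < N.n ∧ D v ≠ 0 := by simp [dead]

/-- All arcs between the pointer and `k` have other tails. Thus `cnt v p` is the length of the part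
of the list still ahead, and it pays for walking along it. -/
theorem cnt_eq_of_ptr {v k p : ℕ} (h : IsArcPtr N.tl v k p) : N.cnt v k = N.cnt v p := by
  unfold cnt
  congr 1
  ext a
  simp only [mem_filter, mem_range]
  have := h.skip a
  have := h.le
  constructor
  · rintro ⟨h₁, h₂⟩
    refine ⟨?_, h₂⟩
    by_contra h₃
    exact h.skip a (by omega) h₁ h₂
  · rintro ⟨h₁, h₂⟩
    exact ⟨by omega, h₂⟩

theorem cnt_succ (a : ℕ) : N.cnt (N.tl a) (a + 1) = N.cnt (N.tl a) a + 1 := by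
  unfold cnt
  rw [range_add_one, filter_insert, if_pos rfl, card_insert_of_notMem (by simp)]

theorem cnt_nx {a : ℕ} (ha : a < N.M) :
    N.cnt (N.tl a) (a + 1) = N.cnt (N.tl a) (N.nx a) + 1 := by
  rw [cnt_succ, cnt_eq_of_ptr (N.nx_ptr a ha)]

theorem cnt_mono (v : ℕ) {p q : ℕ} (h : p ≤ q) : N.cnt v p ≤ N.cnt v q := by
  unfold cnt; gcongr

theorem cnt_pos {v : ℕ} (hv : v < N.n) : 0 < N.cnt v N.M := by
  obtain ⟨a, ha, h⟩ := N.exists_tl v hv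
  exact card_pos.2 ⟨a, by simp [ha, h]⟩

theorem vol_eq_sum (J : Finset ℕ) : N.vol J = ∑ v ∈ J, N.cnt v N.M := by
  unfold vol cnt arcs
  have h : Set.MapsTo N.tl ((range N.M).filter fun a => N.tl a ∈ J : Finset ℕ) J :=
    fun a ha => by simpa using (mem_filter.1 (mem_coe.1 ha)).2
  rw [card_eq_sum_card_fiberwise h]
  refine sum_congr rfl fun v hv => ?_
  congr 1
  ext a
  simp only [mem_filter, mem_range]
  constructor
  · rintro ⟨⟨h₁, -⟩, h₂⟩; exact ⟨h₁, h₂⟩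
  · rintro ⟨h₁, rfl⟩; exact ⟨⟨h₁, hv⟩, rfl⟩

theorem vol_le (J : Finset ℕ) : N.vol J ≤ N.M := by
  simpa [vol, arcs] using card_le_card (filter_subset (fun a => N.tl a ∈ J) (range N.M))

theorem vol_mono {J K : Finset ℕ} (h : J ⊆ K) : N.vol J ≤ N.vol K := by
  refine card_le_card fun a ha => ?_
  rw [mem_arcs] at ha ⊢
  exact ⟨ha.1, h ha.2⟩

theorem card_le_vol {J : Finset ℕ} (hJ : ∀ v ∈ J, v < N.n) : J.card ≤ N.vol J := by
  rw [vol_eq_sum, card_eq_sum_ones]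
  exact sum_le_sum fun v hv => cnt_pos (hJ v hv)

theorem vol_range : N.vol (range N.n) = N.M := by
  unfold vol arcs
  rw [filter_true_of_mem, card_range]
  intro a ha
  simpa using N.tl_lt a (by simpa using ha)

theorem n_le : N.n ≤ N.M := by
  simpa using card_le_vol (N := N) (J := range N.n) (by simp) |>.trans (vol_le _)

theorem vol_union {J K : Finset ℕ} (h : Disjoint J K) : N.vol (J ∪ K) = N.vol J + N.vol K := by
  rw [vol_eq_sum, vol_eq_sum, vol_eq_sum, sum_union h]

theorem out_update (R : ℕ → ℕ) {a : ℕ} (ha : a < N.M) (x v : ℕ) :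
    N.out (update R a x) v = N.out R v + if N.tl a = v then (R a : ℤ) - x else 0 := by
  unfold out
  rw [← sub_eq_iff_eq_add', ← sum_sub_distrib, sum_eq_single_of_mem a (by simpa using ha)]
  · by_cases h : N.tl a = v <;> simp [h]
  · intro b _ hb
    simp [hb]

theorem sum_out (R : ℕ → ℕ) (J : Finset ℕ) :
    ∑ v ∈ J, N.out R v = ∑ a ∈ N.arcs J, ((N.c : ℤ) - R a) := by
  unfold out arcs
  rw [sum_comm, sum_filter]
  refine sum_congr rfl fun a _ => ?_
  rw [sum_ite_eq]

theorem neg_le_out {R : ℕ → ℕ} (hR : ∀ a < N.M, R a + R (N.rv a) = 2 * N.c) (v : ℕ) :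
    -((N.c * N.M : ℕ) : ℤ) ≤ N.out R v := by
  unfold out
  have : ∑ a ∈ range N.M, (-(N.c : ℤ)) ≤
      ∑ a ∈ range N.M, if N.tl a = v then (N.c : ℤ) - R a else 0 := by
    refine sum_le_sum fun a ha => ?_
    have := hR a (by simpa using ha)
    split_ifs <;> omega
  refine le_trans (le_of_eq ?_) this
  simp [mul_comm]

/-- The unit of mass that ended at a sink. -/
def sunk (w : ℕ) : ℤ := if w = 2 then 1 else 0

variable (N) in
/-- The part of the state that does not concern cuts: `R` residual capacities, `L` labels, `P`
current arcs, `W` states of the sinks (`0` no sink, `1` unsaturated, `2` saturated), `pe` pending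
mass, `D` marks of removed vertices, `k` additional mass. -/
structure Core (R L P W pe D : ℕ → ℕ) (k : ℕ → ℤ) : Prop where
  res : ∀ a < N.M, R a + R (N.rv a) = 2 * N.c
  cons : ∀ v < N.n, D v = 0 → (N.src v : ℤ) = pe v + sunk (W v) + k v + N.out R v
  lab : ∀ a < N.M, D (N.tl a) = 0 → D (N.dst a) = 0 → 0 < R a → L (N.tl a) ≤ L (N.dst a) + 1
  notSink : ∀ v < N.n, N.snk v = 0 → W v = 0
  sink : ∀ v < N.n, N.snk v ≠ 0 → W v = 1 ∨ W v = 2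
  sinkLab : ∀ v < N.n, W v = 1 → L v = 0
  ptrLe : ∀ v < N.n, P v ≤ N.M
  ptrTail : ∀ v < N.n, P v = 0 ∨ N.tl (P v - 1) = v
  ptrSkip : ∀ a < N.M, P (N.tl a) ≤ a → D (N.tl a) = 0 → D (N.dst a) = 0 → 0 < R a →
    L (N.tl a) ≤ L (N.dst a)

/-- One unit of mass at `u`. -/
def unit (u : ℕ) (v : ℕ) : ℤ := if v = u then 1 else 0

/-! ### Pushing one unit along an arc -/

section Push

variable {R : ℕ → ℕ} {a : ℕ}

/-- The residual capacities after pushing one unit along `a`. -/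
def pushed (N : Net) (R : ℕ → ℕ) (a : ℕ) : ℕ → ℕ :=
  update (update R a (R a - 1)) (N.rv a) (R (N.rv a) + 1)

theorem pushed_apply (ha : a < N.M) (b : ℕ) :
    pushed N R a b = if b = a then R a - 1 else if b = N.rv a then R (N.rv a) + 1 else R b := by
  have := N.rv_ne a ha
  unfold pushed
  by_cases h₁ : b = a
  · subst h₁; simp [update_of_ne this.symm]
  · by_cases h₂ : b = N.rv a
    · subst h₂; simp [this]
    · simp [h₁, h₂]

theorem pushed_res (hR : ∀ a < N.M, R a + R (N.rv a) = 2 * N.c) (ha : a < N.M) (hp : 0 < R a) :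
    ∀ b < N.M, pushed N R a b + pushed N R a (N.rv b) = 2 * N.c := by
  intro b hb
  have h₁ := N.rv_ne a ha
  have h₂ := hR a ha
  have h₃ := hR b hb
  rw [pushed_apply ha, pushed_apply ha]
  by_cases hba : b = a
  · subst hba; simp [h₁]; omega
  · by_cases hbr : b = N.rv a
    · subst hbr; simp [N.rv_rv a ha, h₁]; omega
    · have h₄ : N.rv b ≠ a := fun h => hbr (by rw [← h, N.rv_rv b hb])
      have h₅ : N.rv b ≠ N.rv a := fun h => hba (by rw [← N.rv_rv b hb, h, N.rv_rv a ha])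
      simp [hba, hbr, h₄, h₅, h₃]

theorem out_pushed (ha : a < N.M) (hp : 0 < R a) (v : ℕ) :
    N.out (pushed N R a) v = N.out R v + unit (N.tl a) v - unit (N.dst a) v := by
  unfold pushed
  rw [out_update _ (N.rv_lt a ha), out_update _ ha, update_of_ne (N.rv_ne a ha)]
  unfold unit dst
  have : ((R a - 1 : ℕ) : ℤ) = R a - 1 := by omega
  rw [this]
  simp only [eq_comm (a := v)]
  split_ifs <;> push_cast <;> ring

end Push

/-! ### The moves of the push-relabel algorithm preserve the invariant -/

section Steps

variable {R L P W pe D : ℕ → ℕ} {k : ℕ → ℤ} {a u : ℕ}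

/-- The only arc that may become residual is the reverse of `a`. It leads from the lower to the
higher label, so the labels stay valid and the current arc of its tail need not go back. -/
theorem Core.push (H : Core N R L P W pe D (unit (N.tl a))) (ha : a < N.M) (hp : 0 < R a)
    (hL : L (N.tl a) = L (N.dst a) + 1) :
    Core N (pushed N R a) L P W pe D (unit (N.dst a)) where
  res := pushed_res H.res ha hp
  cons v hv hD := by
    rw [out_pushed ha hp, H.cons v hv hD]
    ring
  lab b hb h₁ h₂ h₃ := by
    rw [pushed_apply ha] at h₃
    split_ifs at h₃ with hba hbr
    · subst hba; omega
    · subst hbr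
      rw [dst_rv ha, hL]
      change L (N.dst a) ≤ _
      omega
    · exact H.lab b hb h₁ h₂ h₃
  notSink := H.notSink
  sink := H.sink
  sinkLab := H.sinkLab
  ptrLe := H.ptrLe
  ptrTail := H.ptrTail
  ptrSkip b hb h₀ h₁ h₂ h₃ := by
    rw [pushed_apply ha] at h₃
    split_ifs at h₃ with hba hbr
    · subst hba; exact H.ptrSkip b hb h₀ h₁ h₂ hp
    · subst hbr
      rw [dst_rv ha, hL]
      change L (N.dst a) ≤ _
      omega
    · exact H.ptrSkip b hb h₀ h₁ h₂ h₃

theorem Core.absorb (H : Core N R L P W pe D (unit u)) (hW : W u = 1) :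
    Core N R L P (update W u 2) pe D 0 where
  res := H.res
  cons v hv hD := by
    rw [H.cons v hv hD]
    by_cases h : v = u
    · subst h; simp [sunk, unit, hW]
    · simp [unit, h]
  lab := H.lab
  notSink v hv h := by
    have := H.notSink v hv h
    rw [update_of_ne (by rintro rfl; omega), this]
  sink v hv h := by
    by_cases hvu : v = u
    · subst hvu; simp
    · rw [update_of_ne hvu]; exact H.sink v hv h
  sinkLab v hv h := by
    by_cases hvu : v = u
    · subst hvu; simp at h
    · rw [update_of_ne hvu] at h; exact H.sinkLab v hv h
  ptrLe := H.ptrLe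
  ptrTail := H.ptrTail
  ptrSkip := H.ptrSkip

theorem Core.inject (H : Core N R L P W pe D 0) (hp : 0 < pe u) :
    Core N R L P W (update pe u (pe u - 1)) D (unit u) where
  res := H.res
  cons v hv hD := by
    rw [H.cons v hv hD]
    by_cases h : v = u
    · subst h
      simp only [Pi.zero_apply, update_self, unit]
      have : ((pe v - 1 : ℕ) : ℤ) = pe v - 1 := by omega
      rw [this]; simp; ring
    · simp [unit, h]
  lab := H.lab
  notSink := H.notSink
  sink := H.sink
  sinkLab := H.sinkLab
  ptrLe := H.ptrLe
  ptrTail := H.ptrTail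
  ptrSkip := H.ptrSkip

/-- Validity of the labels leaves only `L (tl a) ≤ L (dst a)` for a residual arc that is not
admissible, so `a` may join the skipped arcs. -/
theorem Core.advance (H : Core N R L P W pe D k) (ha : a < N.M) (hP : P (N.tl a) = a + 1)
    (hadm : D (N.dst a) = 0 → 0 < R a → L (N.tl a) ≠ L (N.dst a) + 1) :
    Core N R L (update P (N.tl a) (N.nx a)) W pe D k where
  res := H.res
  cons := H.cons
  lab := H.lab
  notSink := H.notSink
  sink := H.sink
  sinkLab := H.sinkLab
  ptrLe v hv := by
    by_cases h : v = N.tl a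
    · subst h; simpa using (N.nx_ptr a ha).le.trans ha.le
    · rw [update_of_ne h]; exact H.ptrLe v hv
  ptrTail v hv := by
    by_cases h : v = N.tl a
    · subst h; simpa using (N.nx_ptr a ha).tail
    · rw [update_of_ne h]; exact H.ptrTail v hv
  ptrSkip b hb h₀ h₁ h₂ h₃ := by
    by_cases h : N.tl b = N.tl a
    · rw [h, update_self] at h₀
      by_cases hba : b = a
      · subst hba
        have := H.lab b hb h₁ h₂ h₃
        have := hadm h₂ h₃
        omega
      · refine H.ptrSkip b hb ?_ h₁ h₂ h₃
        rw [h, hP]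
        by_contra hlt
        exact (N.nx_ptr a ha).skip b h₀ (by omega) h
    · rw [update_of_ne h] at h₀
      exact H.ptrSkip b hb h₀ h₁ h₂ h₃

/-- When the current arc is exhausted, `ptrSkip` covers every arc out of `u`, so no residual one
descends and the label can rise by one. For arcs into `u` a larger label only weakens the
conditions. -/
theorem Core.relabel (H : Core N R L P W pe D k) (hu : u < N.n) (hP : P u = 0) (hW : W u ≠ 1) :
    Core N R (update L u (L u + 1)) (update P u (N.hd u)) W pe D k where
  res := H.res
  cons := H.cons
  lab a ha h₁ h₂ h₃ := by
    have h₄ := H.lab a ha h₁ h₂ h₃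
    have h₅ := H.ptrSkip a ha
    simp only [update_apply]
    split_ifs with h₆ h₇ h₇
    · omega
    · have := h₅ (by rw [h₆]; omega) h₁ h₂ h₃
      rw [h₆] at this; omega
    · rw [← h₇]; omega
    · exact h₄
  notSink := H.notSink
  sink := H.sink
  sinkLab v hv h := by
    rw [update_of_ne (by rintro rfl; exact hW h)]
    exact H.sinkLab v hv h
  ptrLe v hv := by
    by_cases h : v = u
    · subst h; simpa using (N.hd_ptr v hv).le
    · rw [update_of_ne h]; exact H.ptrLe v hv
  ptrTail v hv := by
    by_cases h : v = u
    · subst h; simpa using (N.hd_ptr v hv).tail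
    · rw [update_of_ne h]; exact H.ptrTail v hv
  ptrSkip a ha h₀ h₁ h₂ h₃ := by
    by_cases h : N.tl a = u
    · rw [h, update_self] at h₀
      exact absurd h ((N.hd_ptr u hu).skip a h₀ ha)
    · rw [update_of_ne h] at h₀ ⊢
      have := H.ptrSkip a ha h₀ h₁ h₂ h₃
      simp only [update_apply]
      split_ifs with h₇
      · rw [← h₇]; omega
      · exact this

end Steps

end Net

namespace Net

variable {N : Net}

/-! ### Removing a set of vertices -/

/-- The marks after marking the vertices of `J`. -/
def mark (D : ℕ → ℕ) (J : Finset ℕ) (v : ℕ) : ℕ := if v ∈ J then 1 else D v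

theorem mark_eq_zero {D : ℕ → ℕ} {J : Finset ℕ} {v : ℕ} :
    mark D J v = 0 ↔ v ∉ J ∧ D v = 0 := by
  unfold mark; split_ifs with h <;> simp [h]

theorem mark_insert (D : ℕ → ℕ) (J : Finset ℕ) (w : ℕ) :
    mark D (insert w J) = update (mark D J) w 1 := by
  ext v
  by_cases h : v = w
  · subst h; simp [mark]
  · simp [mark, h]

theorem dead_mark {D : ℕ → ℕ} {J : Finset ℕ} (hJ : ∀ v ∈ J, v < N.n) :
    N.dead (mark D J) = N.dead D ∪ J := by
  ext v
  simp only [mem_dead, mem_union, ne_eq, mark_eq_zero]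
  have := hJ v
  tauto

theorem mem_outRes {R D : ℕ → ℕ} {J : Finset ℕ} {a : ℕ} :
    a ∈ N.outRes R D J ↔ (a < N.M ∧ N.tl a ∈ J) ∧ D (N.dst a) = 0 ∧ 0 < R a := by
  simp [outRes, mem_arcs]

theorem sum_update {n u : ℕ} (hu : u < n) (f : ℕ → ℕ) (x : ℕ) (g : ℕ → ℕ → ℕ) :
    ∑ v ∈ range n, g v (update f u x v) + g u (f u) = ∑ v ∈ range n, g v (f v) + g u x := by
  have hu' : u ∈ range n := by simpa using hu
  rw [← add_sum_erase _ _ hu', ← add_sum_erase _ _ hu', update_self]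
  have : ∑ v ∈ (range n).erase u, g v (update f u x v) = ∑ v ∈ (range n).erase u, g v (f v) :=
    sum_congr rfl fun v hv => by rw [update_of_ne (ne_of_mem_erase hv)]
  omega

/-- Internal arcs do not contribute to the net flow out of a set of vertices. -/
theorem sum_internal {R : ℕ → ℕ} (hR : ∀ a < N.M, R a + R (N.rv a) = 2 * N.c) (J : Finset ℕ) :
    ∑ a ∈ (N.arcs J).filter (fun a => N.dst a ∈ J), ((N.c : ℤ) - R a) = 0 := by
  refine sum_involution (fun a _ => N.rv a) (fun a ha => ?_) (fun a ha _ => ?_) (fun a ha => ?_)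
    (fun a ha => ?_) <;> simp only [mem_filter, mem_arcs] at ha ⊢
  · have := hR a ha.1.1; omega
  · exact N.rv_ne a ha.1.1
  · exact ⟨⟨N.rv_lt a ha.1.1, ha.2⟩, by rw [dst_rv ha.1.1]; exact ha.1.2⟩
  · exact N.rv_rv a ha.1.1

variable {R L P W pe D : ℕ → ℕ} {J : Finset ℕ} {x : ℕ}

/-- All arcs from `J` to unmarked vertices other than the residual ones are saturated. -/
theorem le_sum_out (hR : ∀ a < N.M, R a + R (N.rv a) = 2 * N.c) (D : ℕ → ℕ) (J : Finset ℕ) :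
    (N.c * ((N.arcs J).filter fun a => mark D J (N.dst a) = 0).card : ℤ)
      ≤ ∑ v ∈ J, N.out R v + 2 * N.c * (N.outRes R (mark D J) J).card
        + N.c * ((N.arcs J).filter fun a => N.dst a ∉ J ∧ D (N.dst a) ≠ 0).card := by
  rw [sum_out, ← sum_filter_add_sum_filter_not _ (fun a => N.dst a ∈ J), sum_internal hR, zero_add]
  -- Termwise: a saturated arc carries `c`, a residual arc at least `-c = c - 2c`, and an arc to an
  -- already marked vertex at least `-c`.
  have key : ∑ a ∈ (N.arcs J).filter (fun a => ¬ N.dst a ∈ J),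
      ((if mark D J (N.dst a) = 0 then (N.c : ℤ) else 0)
        - 2 * N.c * (if mark D J (N.dst a) = 0 ∧ 0 < R a then 1 else 0)
        - N.c * (if D (N.dst a) ≠ 0 then 1 else 0))
      ≤ ∑ a ∈ (N.arcs J).filter (fun a => ¬ N.dst a ∈ J), ((N.c : ℤ) - R a) := by
    refine sum_le_sum fun a ha => ?_
    simp only [mem_filter, mem_arcs] at ha
    have h₁ := hR a ha.1.1
    simp only [mark, ha.2, if_false]
    by_cases hD : D (N.dst a) = 0
    · by_cases hp : 0 < R a
      · simp [hD, hp]; omega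
      · simp [hD, hp]; omega
    · simp [hD]; omega
  rw [sum_sub_distrib, sum_sub_distrib, ← mul_sum, ← mul_sum] at key
  simp only [sum_boole, filter_filter, ← sum_filter, sum_const, nsmul_eq_mul] at key
  have e₁ : ((N.arcs J).filter fun a => N.dst a ∉ J ∧ mark D J (N.dst a) = 0)
      = (N.arcs J).filter fun a => mark D J (N.dst a) = 0 := by
    refine filter_congr fun a _ => ?_
    rw [mark_eq_zero]; tauto
  have e₂ : ((N.arcs J).filter fun a => N.dst a ∉ J ∧ mark D J (N.dst a) = 0 ∧ 0 < R a)
      = N.outRes R (mark D J) J := by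
    refine filter_congr fun a _ => ?_
    rw [mark_eq_zero]; tauto
  rw [e₁, e₂] at key
  linarith

/-- Removing `J` exposes the arcs from `J` to the remaining vertices and hides those between `J` and
the earlier removed set. Reversal lets the hidden arcs be counted from the side of `J`. -/
theorem cut_union (hJ : ∀ v ∈ J, v < N.n ∧ D v = 0) :
    N.cut (N.dead D ∪ J) + ((N.arcs J).filter fun a => N.dst a ∉ J ∧ D (N.dst a) ≠ 0).card
      = N.cut (N.dead D) + ((N.arcs J).filter fun a => mark D J (N.dst a) = 0).card := by
  have hdead : ∀ a < N.M, (N.dst a ∈ N.dead D ↔ D (N.dst a) ≠ 0) := fun a ha => by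
    rw [mem_dead]; exact and_iff_right (dst_lt ha)
  have hdead' : ∀ a < N.M, (N.tl a ∈ N.dead D ↔ D (N.tl a) ≠ 0) := fun a ha => by
    rw [mem_dead]; exact and_iff_right (N.tl_lt a ha)
  have hcard : ((N.arcs J).filter fun a => N.dst a ∉ J ∧ D (N.dst a) ≠ 0).card
      = ((N.arcs (N.dead D)).filter fun a => N.dst a ∈ J).card := by
    refine card_bij' (fun a _ => N.rv a) (fun a _ => N.rv a) ?_ ?_ ?_ ?_
    · intro a ha
      simp only [mem_filter, mem_arcs] at ha ⊢
      exact ⟨⟨N.rv_lt a ha.1.1, (hdead a ha.1.1).2 ha.2.2⟩, by rw [dst_rv ha.1.1]; exact ha.1.2⟩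
    · intro a ha
      simp only [mem_filter, mem_arcs] at ha ⊢
      have hD := (hdead' a ha.1.1).1 ha.1.2
      refine ⟨⟨N.rv_lt a ha.1.1, ha.2⟩, ?_, ?_⟩ <;> rw [dst_rv ha.1.1]
      · exact fun h => hD (hJ _ h).2
      · exact hD
    · intro a ha
      exact N.rv_rv a (mem_arcs.1 (mem_filter.1 ha).1).1
    · intro a ha
      exact N.rv_rv a (mem_arcs.1 (mem_filter.1 ha).1).1
  have h₁ : (N.arcs (N.dead D ∪ J)).filter (fun a => N.dst a ∉ N.dead D ∪ J)
      = ((N.arcs (N.dead D)).filter fun a => N.dst a ∉ N.dead D ∧ N.dst a ∉ J) ∪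
        ((N.arcs J).filter fun a => mark D J (N.dst a) = 0) := by
    ext a
    simp only [mem_filter, mem_arcs, mem_union, mark_eq_zero]
    by_cases ha : a < N.M
    · have := hdead a ha
      tauto
    · tauto
  have h₂ : Disjoint ((N.arcs (N.dead D)).filter fun a => N.dst a ∉ N.dead D ∧ N.dst a ∉ J)
      ((N.arcs J).filter fun a => mark D J (N.dst a) = 0) := by
    rw [disjoint_left]
    intro a ha hb
    simp only [mem_filter, mem_arcs, mem_dead] at ha hb
    exact ha.1.2.2 (hJ _ hb.1.2).2
  have h₃ : (N.arcs (N.dead D)).filter (fun a => N.dst a ∉ N.dead D)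
      = ((N.arcs (N.dead D)).filter fun a => N.dst a ∉ N.dead D ∧ N.dst a ∉ J) ∪
        ((N.arcs (N.dead D)).filter fun a => N.dst a ∈ J) := by
    ext a
    simp only [mem_filter, mem_arcs, mem_union]
    by_cases ha : a < N.M
    · have := hdead a ha
      have := hJ (N.dst a)
      tauto
    · tauto
  have h₄ : Disjoint ((N.arcs (N.dead D)).filter fun a => N.dst a ∉ N.dead D ∧ N.dst a ∉ J)
      ((N.arcs (N.dead D)).filter fun a => N.dst a ∈ J) := by
    rw [disjoint_left]
    intro a ha hb
    exact (mem_filter.1 ha).2.2 (mem_filter.1 hb).2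
  unfold cut
  rw [h₁, card_union_of_disjoint h₂, h₃, card_union_of_disjoint h₄, hcard]
  ring

/-- The properties of the set of removed vertices. -/
structure DeadInv (N : Net) (D : ℕ → ℕ) : Prop where
  cut_le : 200 * N.c * N.cut (N.dead D) + 200 * ∑ v ∈ N.dead D, N.snk v
    ≤ 200 * ∑ v ∈ N.dead D, N.src v + 2 * N.vol (N.dead D)
  nbr : ∀ v < N.n, D v ≠ 0 → ∃ a < N.M, N.tl a = v ∧ D (N.dst a) ≠ 0

/-- `J` is a residual ball around the vertex `x` of label `h`. -/
structure Ball (N : Net) (L D : ℕ → ℕ) (x : ℕ) (J : Finset ℕ) : Prop where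
  mem : x ∈ J
  alive : ∀ v ∈ J, v < N.n ∧ D v = 0
  lab : ∃ d, (∀ v ∈ J, N.h ≤ L v + d) ∧ (200 * N.c + 1) ^ d ≤ N.vol J * (200 * N.c) ^ d
  nbr : J = {x} ∨ ∀ v ∈ J, ∃ a < N.M, N.tl a = v ∧ N.dst a ∈ J

theorem Ball.singleton (hx : x < N.n) (hD : D x = 0) (hL : L x = N.h) : Ball N L D x {x} where
  mem := by simp
  alive v hv := by rw [mem_singleton.1 hv]; exact ⟨hx, hD⟩
  lab := ⟨0, fun v hv => by rw [mem_singleton.1 hv]; omega, by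
    have := cnt_pos hx
    rw [vol_eq_sum, sum_singleton, pow_zero, pow_zero]; omega⟩
  nbr := Or.inl rfl

/-- The ball together with the next layer. -/
def grown (N : Net) (R D : ℕ → ℕ) (J : Finset ℕ) : Finset ℕ :=
  J ∪ (N.outRes R (mark D J) J).image N.dst

/-- The reverse of a residual arc leaving `J` has its tail in the new layer, and reversal is
injective. -/
theorem vol_grown (J : Finset ℕ) :
    N.vol J + (N.outRes R (mark D J) J).card ≤ N.vol (grown N R D J) := by
  have hinj : Set.InjOn N.rv (N.outRes R (mark D J) J) := by
    intro a ha b hb h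
    rw [mem_coe, mem_outRes] at ha hb
    rw [← N.rv_rv a ha.1.1, h, N.rv_rv b hb.1.1]
  rw [vol, ← card_image_of_injOn hinj, ← card_union_of_disjoint]
  · refine card_le_card fun a ha => ?_
    rw [mem_union, mem_arcs, mem_image] at ha
    rw [mem_arcs, grown, mem_union, mem_image]
    rcases ha with ha | ⟨b, hb, rfl⟩
    · exact ⟨ha.1, Or.inl ha.2⟩
    · exact ⟨N.rv_lt b (mem_outRes.1 hb).1.1, Or.inr ⟨b, hb, rfl⟩⟩
  · rw [disjoint_left]
    intro a ha hb'
    obtain ⟨b, hb, rfl⟩ := mem_image.1 hb'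
    exact (mark_eq_zero.1 (mem_outRes.1 hb).2.1).1 (mem_arcs.1 ha).2

/-- One more layer costs at most one in the label. The new layer contributes more than `vol J /
(200c)` arcs, so the volume grows by a factor above `1 + 1/(200c)`, which is the inequality recorded
without denominators in `lab`. -/
theorem Ball.grow (H : Ball N L D x J)
    (hlab : ∀ a < N.M, D (N.tl a) = 0 → D (N.dst a) = 0 → 0 < R a → L (N.tl a) ≤ L (N.dst a) + 1)
    (hz : N.vol J < 200 * N.c * (N.outRes R (mark D J) J).card) :
    Ball N L D x (grown N R D J) where
  mem := mem_union_left _ H.mem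
  alive v hv := by
    rcases mem_union.1 hv with hv | hv
    · exact H.alive v hv
    · obtain ⟨a, ha, rfl⟩ := mem_image.1 hv
      rw [mem_outRes, mark_eq_zero] at ha
      exact ⟨dst_lt ha.1.1, ha.2.1.2⟩
  lab := by
    obtain ⟨d, h₁, h₂⟩ := H.lab
    refine ⟨d + 1, fun v hv => ?_, ?_⟩
    · rcases mem_union.1 hv with hv | hv
      · have := h₁ v hv; omega
      · obtain ⟨a, ha, rfl⟩ := mem_image.1 hv
        rw [mem_outRes, mark_eq_zero] at ha
        have := h₁ _ ha.1.2
        have := hlab a ha.1.1 (H.alive _ ha.1.2).2 ha.2.1.2 ha.2.2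
        omega
    · have h₃ := vol_grown (N := N) (R := R) (D := D) J
      set k := 200 * N.c
      set z := (N.outRes R (mark D J) J).card
      have h₄ : N.vol J * (k + 1) ≤ N.vol (grown N R D J) * k := by nlinarith
      calc (k + 1) ^ (d + 1) = (k + 1) ^ d * (k + 1) := pow_succ _ _
        _ ≤ N.vol J * k ^ d * (k + 1) := by gcongr
        _ = N.vol J * (k + 1) * k ^ d := by ring
        _ ≤ N.vol (grown N R D J) * k * k ^ d := by gcongr
        _ = _ := by ring
  nbr := by
    right
    have hnew : ∀ a ∈ N.outRes R (mark D J) J, N.dst a ∈ grown N R D J := fun a ha =>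
      mem_union_right _ (mem_image_of_mem _ ha)
    intro v hv
    rcases mem_union.1 hv with hv | hv
    · rcases H.nbr with h | h
      · rw [h, mem_singleton] at hv
        have hpos : 0 < (N.outRes R (mark D J) J).card := by
          by_contra h0
          have : (N.outRes R (mark D J) J).card = 0 := by omega
          rw [this] at hz; omega
        obtain ⟨a, ha⟩ := card_pos.1 hpos
        have ha' := mem_outRes.1 ha
        refine ⟨a, ha'.1.1, ?_, hnew a ha⟩
        have := ha'.1.2
        rw [h, mem_singleton] at this
        rw [this, hv]
      · obtain ⟨a, h₁, h₂, h₃⟩ := h v hv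
        exact ⟨a, h₁, h₂, mem_union_left _ h₃⟩
    · obtain ⟨a, ha, rfl⟩ := mem_image.1 hv
      have ha' := mem_outRes.1 ha
      exact ⟨N.rv a, N.rv_lt a ha'.1.1, rfl, mem_union_left _ (by rw [dst_rv ha'.1.1]; exact ha'.1.2)⟩

/-- The volume is at most `M`, so the exponential growth allows fewer than `h` layers. -/
theorem Ball.one_le_lab (H : Ball N L D x J) : ∀ v ∈ J, 1 ≤ L v := by
  obtain ⟨d, h₁, h₂⟩ := H.lab
  intro v hv
  have := h₁ v hv
  have := N.lt_h d (h₂.trans (Nat.mul_le_mul_right _ (vol_le J)))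
  omega

/-- Mass balance in `J`: the net flow out is at most the sources minus the sinks, all of which are
saturated. Combined with `le_sum_out` and `cut_union` this bounds the increase of the cut; the `z`
residual arcs contribute `400cz ≤ 2·vol J`. -/
theorem Ball.deadInv (H : Ball N L D x J) (hC : Core N R L P W pe D (unit x)) (hD : DeadInv N D)
    (hz : 200 * N.c * (N.outRes R (mark D J) J).card ≤ N.vol J) : DeadInv N (mark D J) := by
  have hlt : ∀ v ∈ J, v < N.n := fun v hv => (H.alive v hv).1
  have hflow := le_sum_out hC.res D J
  have hsum : ∑ v ∈ J, (N.src v : ℤ) = ∑ v ∈ J, ((pe v : ℤ) + sunk (W v) + unit x v + N.out R v) :=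
    sum_congr rfl fun v hv => hC.cons v (H.alive v hv).1 (H.alive v hv).2
  -- An unsaturated sink has label 0, whereas labels in the ball are positive.
  have hsnk : ∑ v ∈ J, (N.snk v : ℤ) ≤ ∑ v ∈ J, sunk (W v) := by
    refine sum_le_sum fun v hv => ?_
    have h₁ := H.one_le_lab v hv
    have h₂ := hC.sinkLab v (hlt v hv)
    have h₃ := N.snk_le v
    have h₄ := hC.sink v (hlt v hv)
    unfold sunk
    split_ifs <;> omega
  have hpe : 0 ≤ ∑ v ∈ J, (pe v : ℤ) := sum_nonneg fun v _ => by positivity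
  have hun : ∑ v ∈ J, unit x v = 1 := by simp [unit, H.mem]
  rw [sum_add_distrib, sum_add_distrib, sum_add_distrib, hun] at hsum
  have hcut := cut_union (N := N) H.alive
  have hdisj : Disjoint (N.dead D) J := by
    rw [disjoint_left]
    intro v hv hJ
    exact (mem_dead.1 hv).2 (H.alive v hJ).2
  refine ⟨?_, ?_⟩
  · rw [dead_mark hlt, sum_union hdisj, sum_union hdisj, vol_union hdisj]
    have h₀ := hD.cut_le
    generalize ((N.arcs J).filter fun a => mark D J (N.dst a) = 0).card = e₁ at hflow hcut
    generalize ((N.arcs J).filter fun a => N.dst a ∉ J ∧ D (N.dst a) ≠ 0).card = e₂ at hflow hcut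
    zify at hz hcut h₀ ⊢
    have h₁ := congrArg (fun y : ℤ => 200 * (N.c : ℤ) * y) hcut
    simp only [mul_add] at h₁
    linarith
  · intro v hv hm
    have hmark : ∀ w, D w ≠ 0 → mark D J w ≠ 0 := fun w hw h => hw (mark_eq_zero.1 h).2
    have hmark' : ∀ w ∈ J, mark D J w ≠ 0 := fun w hw h => (mark_eq_zero.1 h).1 hw
    by_cases hvD : D v = 0
    · have hvJ : v ∈ J := by
        by_contra h
        exact hm (mark_eq_zero.2 ⟨h, hvD⟩)
      rcases H.nbr with h | h
      -- A ball that consists of `x` alone must touch a marked vertex (possibly `x` itself, by a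
      -- loop). Otherwise, as the token at `x` makes up for its source, the net outflow would be at
      -- most 0, and `c·vol J ≤ 2cz ≤ vol J / 100` would follow.
      · by_contra! hno
        have hvx : v = x := by rw [h, mem_singleton] at hvJ; exact hvJ
        have hno' : ∀ a ∈ N.arcs J, mark D J (N.dst a) = 0 := fun a ha => by
          rw [mem_arcs, h, mem_singleton] at ha
          exact hno a ha.1 (by rw [ha.2, hvx])
        have e₁ : ((N.arcs J).filter fun a => mark D J (N.dst a) = 0).card = N.vol J := by
          rw [filter_true_of_mem hno', vol]
        have e₂ : ((N.arcs J).filter fun a => N.dst a ∉ J ∧ D (N.dst a) ≠ 0).card = 0 := by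
          rw [card_eq_zero, filter_eq_empty_iff]
          intro a ha h'
          exact h'.2 (mark_eq_zero.1 (hno' a ha)).2
        have hsrc : ∑ v ∈ J, (N.src v : ℤ) ≤ 1 := by
          rw [h, sum_singleton]; exact_mod_cast N.src_le x
        have hs0 : 0 ≤ ∑ v ∈ J, sunk (W v) := sum_nonneg fun v _ => by unfold sunk; split_ifs <;> simp
        rw [e₁, e₂] at hflow
        have hvol : 0 < N.vol J := by
          rw [h, vol_eq_sum, sum_singleton]; exact cnt_pos (hvx ▸ hv)
        have hc := N.one_lt_c
        zify at hz hvol hc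
        have h₁ : (N.vol J : ℤ) ≤ N.c * N.vol J := by nlinarith
        push_cast at hflow
        linarith
      · obtain ⟨a, h₁, h₂, h₃⟩ := h v hvJ
        exact ⟨a, h₁, h₂, hmark' _ h₃⟩
    · obtain ⟨a, h₁, h₂, h₃⟩ := hD.nbr v hv hvD
      exact ⟨a, h₁, h₂, hmark _ h₃⟩

/-- The token disappears together with `x`, since conservation is only demanded at unmarked
vertices. -/
theorem Core.mark (H : Core N R L P W pe D (unit x)) (hx : x ∈ J) :
    Core N R L P W pe (Net.mark D J) 0 where
  res := H.res
  cons v hv hD := by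
    rw [mark_eq_zero] at hD
    have := H.cons v hv hD.2
    rw [this, unit, if_neg (by rintro rfl; exact hD.1 hx)]; rfl
  lab a ha h₁ h₂ := H.lab a ha (mark_eq_zero.1 h₁).2 (mark_eq_zero.1 h₂).2
  notSink := H.notSink
  sink := H.sink
  sinkLab := H.sinkLab
  ptrLe := H.ptrLe
  ptrTail := H.ptrTail
  ptrSkip a ha h₀ h₁ h₂ := H.ptrSkip a ha h₀ (mark_eq_zero.1 h₁).2 (mark_eq_zero.1 h₂).2

/-- The residual capacities after the flow on the arc `a` and its reverse has been cancelled. -/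
def cancelled (N : Net) (R : ℕ → ℕ) (a : ℕ) : ℕ → ℕ := update (update R a N.c) (N.rv a) N.c

theorem cancelled_apply (R : ℕ → ℕ) (a b : ℕ) :
    cancelled N R a b = if b = a ∨ b = N.rv a then N.c else R b := by
  unfold cancelled
  by_cases h₂ : b = N.rv a
  · subst h₂; simp
  · by_cases h₁ : b = a
    · subst h₁; simp [h₂]
    · simp [h₁, h₂]

/-- As `c < R a`, the arc carries `R a - c` units from `dst a` into the marked set. They become
pending at `dst a`. Only arcs with a marked end change, so nothing about labels or current arcs is
affected. -/
theorem Core.cancel {a : ℕ} (H : Core N R L P W pe D 0) (ha : a < N.M) (h₁ : D (N.tl a) ≠ 0)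
    (h₂ : D (N.dst a) = 0) (h₃ : N.c < R a) :
    Core N (cancelled N R a) L P W (update pe (N.dst a) (pe (N.dst a) + (R a - N.c))) D 0 where
  res b hb := by
    have h := H.res b hb
    rw [cancelled_apply, cancelled_apply]
    by_cases hba : b = a
    · subst hba; simp; ring
    · by_cases hbr : b = N.rv a
      · subst hbr; simp [N.rv_rv a ha]; ring
      · have h₄ : N.rv b ≠ a := fun h => hbr (by rw [← h, N.rv_rv b hb])
        have h₅ : N.rv b ≠ N.rv a := fun h => hba (by rw [← N.rv_rv b hb, h, N.rv_rv a ha])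
        simp [hba, hbr, h₄, h₅, h]
  cons v hv hD := by
    unfold cancelled
    rw [out_update _ (N.rv_lt a ha), out_update _ ha, update_of_ne (N.rv_ne a ha),
      if_neg (by rintro rfl; exact h₁ hD), H.cons v hv hD]
    have h := H.res a ha
    change _ = _ + (_ + 0 + if N.dst a = v then _ else _)
    by_cases hva : N.dst a = v
    · subst hva; simp; omega
    · simp [hva, Ne.symm hva]
  lab b hb h₄ h₅ h₆ := by
    rw [cancelled_apply] at h₆
    refine H.lab b hb h₄ h₅ ?_
    split_ifs at h₆ with h
    · rcases h with rfl | rfl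
      · exact absurd h₄ h₁
      · rw [dst_rv ha] at h₅; exact absurd h₅ h₁
    · exact h₆
  notSink := H.notSink
  sink := H.sink
  sinkLab := H.sinkLab
  ptrLe := H.ptrLe
  ptrTail := H.ptrTail
  ptrSkip b hb h₀ h₄ h₅ h₆ := by
    rw [cancelled_apply] at h₆
    refine H.ptrSkip b hb h₀ h₄ h₅ ?_
    split_ifs at h₆ with h
    · rcases h with rfl | rfl
      · exact absurd h₄ h₁
      · rw [dst_rv ha] at h₅; exact absurd h₅ h₁
    · exact h₆

/-- Only reverse flow enters removed vertices. -/
def DeadArcs (N : Net) (R D : ℕ → ℕ) : Prop :=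
  ∀ a < N.M, D (N.tl a) = 0 → D (N.dst a) ≠ 0 → N.c ≤ R a

/-! ### Cancelling the mass that comes from removed vertices -/

/-- The state while the mass that leaves the removed vertices is cancelled; `k` is the mass still
missing. -/
structure Ext (N : Net) (R P W D : ℕ → ℕ) (k : ℕ → ℤ) : Prop where
  res : ∀ a < N.M, R a + R (N.rv a) = 2 * N.c
  cons : ∀ v < N.n, D v = 0 → (N.src v : ℤ) = sunk (W v) - k v + N.out R v
  deadArcs : DeadArcs N R D
  notSink : ∀ v < N.n, N.snk v = 0 → W v = 0
  ptrLe : ∀ v < N.n, P v ≤ N.M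
  ptrTail : ∀ v < N.n, P v = 0 ∨ N.tl (P v - 1) = v
  ptrSkip : ∀ a < N.M, P (N.tl a) ≤ a → D (N.tl a) = 0 → N.c ≤ R a

section Ext

variable {k : ℕ → ℤ} {a u : ℕ}

/-- Here `c < R a` says that flow enters `tl a` from a removed vertex. Pushing along `a` takes back
one unit of it and leaves a unit missing at `tl a`. -/
theorem Ext.start (H : Ext N R P W D 0) (ha : a < N.M) (h₁ : D (N.dst a) ≠ 0) (h₂ : N.c < R a) :
    Ext N (pushed N R a) P W D (unit (N.tl a)) where
  res := pushed_res H.res ha (by omega)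
  cons v hv hD := by
    rw [out_pushed ha (by omega), H.cons v hv hD]
    have : unit (N.dst a) v = 0 := if_neg (by rintro rfl; exact h₁ hD)
    simp [this]
  deadArcs b hb h₃ h₄ := by
    have := H.deadArcs b hb h₃ h₄
    rw [pushed_apply ha]
    split_ifs with h h <;> subst_vars <;> omega
  notSink := H.notSink
  ptrLe := H.ptrLe
  ptrTail := H.ptrTail
  ptrSkip b hb h₀ h₃ := by
    have := H.ptrSkip b hb h₀ h₃
    rw [pushed_apply ha]
    split_ifs with h h <;> subst_vars <;> omega

theorem Ext.unsink (H : Ext N R P W D (unit u)) (hW : W u = 2) :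
    Ext N R P (update W u 1) D 0 where
  res := H.res
  cons v hv hD := by
    rw [H.cons v hv hD]
    by_cases h : v = u
    · subst h; simp [sunk, unit, hW]
    · simp [unit, h]
  deadArcs := H.deadArcs
  notSink v hv h := by
    have := H.notSink v hv h
    rw [update_of_ne (by rintro rfl; omega), this]
  ptrLe := H.ptrLe
  ptrTail := H.ptrTail
  ptrSkip := H.ptrSkip

/-- Positive flow on `a` stays among unremoved vertices by `deadArcs`. Taking back one unit moves
the missing unit to the head. Flows only shrink towards zero, so skipped arcs remain without
positive flow. -/
theorem Ext.walk (H : Ext N R P W D (unit (N.tl a))) (ha : a < N.M) (h₁ : D (N.tl a) = 0)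
    (hP : P (N.tl a) = a + 1) (h₂ : R a < N.c) :
    Ext N (pushed N R (N.rv a)) P W D (unit (N.dst a)) := by
  have hr := H.res a ha
  have ha' := N.rv_lt a ha
  have hD : D (N.dst a) = 0 := by
    by_contra h
    have := H.deadArcs a ha h₁ h
    omega
  refine ⟨pushed_res H.res ha' (by omega), fun v hv hDv => ?_, fun b hb h₃ h₄ => ?_, H.notSink,
    H.ptrLe, H.ptrTail, fun b hb h₀ h₃ => ?_⟩
  · rw [out_pushed ha' (by omega), H.cons v hv hDv, dst_rv ha]
    change _ = _ + (_ + unit (N.dst a) v - _)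
    ring
  · have := H.deadArcs b hb h₃ h₄
    rw [pushed_apply ha', N.rv_rv a ha]
    split_ifs with h h <;> subst_vars <;> omega
  · rw [pushed_apply ha', N.rv_rv a ha]
    split_ifs with h h
    · omega
    · subst h; omega
    · exact H.ptrSkip b hb h₀ h₃

theorem Ext.advance (H : Ext N R P W D k) (ha : a < N.M) (hP : P (N.tl a) = a + 1)
    (h₂ : N.c ≤ R a) : Ext N R (update P (N.tl a) (N.nx a)) W D k where
  res := H.res
  cons := H.cons
  deadArcs := H.deadArcs
  notSink := H.notSink
  ptrLe v hv := by
    by_cases h : v = N.tl a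
    · subst h; simpa using (N.nx_ptr a ha).le.trans ha.le
    · rw [update_of_ne h]; exact H.ptrLe v hv
  ptrTail v hv := by
    by_cases h : v = N.tl a
    · subst h; simpa using (N.nx_ptr a ha).tail
    · rw [update_of_ne h]; exact H.ptrTail v hv
  ptrSkip b hb h₀ h₁ := by
    by_cases h : N.tl b = N.tl a
    · rw [h, update_self] at h₀
      by_cases hba : b = a
      · subst hba; exact h₂
      · refine H.ptrSkip b hb ?_ h₁
        rw [h, hP]
        by_contra hlt
        exact (N.nx_ptr a ha).skip b h₀ (by omega) h
    · rw [update_of_ne h] at h₀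
      exact H.ptrSkip b hb h₀ h₁

/-- If `u` is no saturated sink, conservation with a missing unit forces the net outflow `src u + 1
> 0`. Hence some arc out of `u` carries positive flow, and such an arc has not been skipped. -/
theorem Ext.ptr_ne_zero (H : Ext N R P W D (unit u)) (hu : u < N.n) (hD : D u = 0) (hW : W u ≠ 2) :
    P u ≠ 0 := by
  intro hP
  have h := H.cons u hu hD
  have hle : N.out R u ≤ 0 := by
    refine sum_nonpos fun a ha => ?_
    split_ifs with hau
    · have := H.ptrSkip a (by simpa using ha) (by rw [hau]; omega) (by rw [hau]; exact hD)
      omega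
    · rfl
  simp only [sunk, hW, if_false, unit, if_true] at h
  omega

/-- The total amount of flow. -/
def flowSum (N : Net) (R : ℕ → ℕ) : ℕ := ∑ a ∈ range N.M, (N.c - R a)

/-- Truncated subtraction makes an edge count once, with the absolute value of its flow. Since `c <
R a`, the push takes back a unit of the flow on `rv a`. -/
theorem flowSum_pushed (hR : ∀ a < N.M, R a + R (N.rv a) = 2 * N.c) (ha : a < N.M)
    (h : N.c < R a) : flowSum N (pushed N R a) < flowSum N R := by
  have h₀ := hR a ha
  have h₁ := N.rv_ne a ha
  refine sum_lt_sum (fun b _ => ?_) ⟨N.rv a, by simpa using N.rv_lt a ha, ?_⟩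
  · rw [pushed_apply ha]
    split_ifs with h h <;> subst_vars <;> omega
  · rw [pushed_apply ha, if_neg h₁, if_pos rfl]
    omega

theorem flowSum_le : flowSum N R ≤ N.M * N.c := by
  calc flowSum N R ≤ ∑ a ∈ range N.M, N.c := sum_le_sum fun a _ => Nat.sub_le _ _
    _ = _ := by simp

end Ext

end Net

/-! ### Loops over the arcs of a list of vertices -/

namespace WordRAM

-- The numbering exploits the input and output conventions: the indicators of sources and sinks
-- serve directly as pending masses and sink states, and with `c` in `arrCap` the output flow is `c
-- - R`.
notation "regN" => (0 : ℕ)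
notation "regE" => (1 : ℕ)
notation "regC" => (2 : ℕ)
notation "regFlag" => (3 : ℕ)
notation "regM" => (4 : ℕ)
notation "regH" => (5 : ℕ)
notation "regK" => (6 : ℕ)
notation "regI" => (7 : ℕ)
notation "regP" => (8 : ℕ)
notation "regA" => (9 : ℕ)
notation "regCnt" => (10 : ℕ)
notation "regSz" => (11 : ℕ)
notation "regVol" => (12 : ℕ)
notation "regOut" => (13 : ℕ)
notation "regSp" => (14 : ℕ)
notation "regTok" => (15 : ℕ)
notation "regU" => (16 : ℕ)
notation "regW" => (17 : ℕ)
notation "arrFst" => (0 : ℕ)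
notation "arrSnd" => (1 : ℕ)
notation "arrPend" => (2 : ℕ)
notation "arrSink" => (3 : ℕ)
notation "arrCap" => (4 : ℕ)
notation "arrRes" => (5 : ℕ)
notation "arrCut" => (6 : ℕ)
notation "arrTl" => (7 : ℕ)
notation "arrRv" => (8 : ℕ)
notation "arrHd" => (9 : ℕ)
notation "arrNx" => (10 : ℕ)
notation "arrPtr" => (11 : ℕ)
notation "arrLab" => (12 : ℕ)
notation "arrDead" => (13 : ℕ)
notation "arrStack" => (14 : ℕ)
notation "arrQueue" => (15 : ℕ)

open WordRAM.Expr (reg get)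

/-- Runs `body` for every arc, in register `regA`, whose tail is one of the first `regCnt` entries
of the queue. -/
def scan (body : Cmd) : Cmd :=
  .assign regI 0 ;;
  .while ((reg regI).lt (reg regCnt))
    (.assign regP (get arrHd (get arrQueue (reg regI))) ;;
     .while (reg regP)
       (.assign regA (reg regP - 1) ;; body ;; .assign regP (get arrNx (reg regA))) ;;
     .assign regI (reg regI + 1))

/-- All numbers that occur are below the word bound. -/
def _root_.Net.Fits (N : Net) (B : ℕ) : Prop :=
  N.n + 2 * N.M + N.h + 200 * N.c * (N.M + 2) + 10 ≤ B

variable {N : Net} {B : ℕ}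

/-- The arcs of `v` are visited in decreasing order, so the processed ones are those with index at
least the pointer. The remaining time is `(κ + 9) * cnt v p`, one body and its overhead for each
list entry ahead. -/
theorem wp_scan_arcs {v T κ : ℕ} {I : Finset ℕ → State → Prop} {body : Cmd} {X₀ : Finset ℕ}
    {i : ℕ} (hB : N.Fits B) (hX₀ : ∀ a, N.tl a = v → a ∉ X₀)
    (hfr : ∀ X s, I X s → s.arr arrNx = N.nx)
    (hst : ∀ X s r x, r = regI ∨ r = regP ∨ r = regA → I X s → I X (s.setReg r x))
    (hbody : ∀ X t s a, I X s → a < N.M → N.tl a = v → a ∉ X → s.reg regA = a →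
      Wp B body (fun t' s' => t' ≤ t + κ ∧ I (insert a X) s' ∧ s'.reg regI = s.reg regI ∧
        s'.reg regA = a) t s)
    {t : ℕ} {s : State} (hP : IsArcPtr N.tl v N.M (s.reg regP)) (hi : s.reg regI = i)
    (hI : I X₀ s) (hT : t + (κ + 9) * N.cnt v N.M ≤ T) :
    Wp B (.while (reg regP)
       (.assign regA (reg regP - 1) ;; body ;; .assign regP (get arrNx (reg regA))))
      (fun t' s' => t' ≤ T + 2 ∧ I (X₀ ∪ N.arcs {v}) s' ∧ s'.reg regI = i) t s := by
  refine wp_while T (fun t s => ∃ p, s.reg regP = p ∧ s.reg regI = i ∧ p ≤ N.M ∧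
    (p = 0 ∨ N.tl (p - 1) = v) ∧ I (X₀ ∪ (N.arcs {v}).filter (p ≤ ·)) s ∧
    t + (κ + 9) * N.cnt v p ≤ T) ?_ ?_ ?_
  · rintro t s ⟨p, -, -, -, -, -, h⟩; omega
  · rintro t s ⟨p, hp, hi, hpM, hpt, hI, ht⟩
    refine ⟨trivial, fun h => ?_, fun h => ?_⟩
    · rw [val_reg, hp] at h
      obtain ⟨a, rfl⟩ := Nat.exists_eq_succ_of_ne_zero h
      have hav : N.tl a = v := by simpa using hpt
      simp only [wp_seq, wp_assign, val_sub, val_reg, val_lit, ok_sub, ok_reg, ok_lit, hp,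
        true_and, cost_sub, cost_reg, cost_lit]
      unfold Net.Fits at hB
      refine ⟨⟨by omega, by omega⟩, ?_⟩
      have hI' := hst _ _ regA (a + 1 - 1) (by simp) hI
      refine (hbody _ _ _ a hI' (by omega) hav ?_ (by simp)).mono ?_
      · simp only [mem_union, mem_filter, Net.mem_arcs]
        intro h'
        rcases h' with h' | h'
        · exact hX₀ a hav h'
        · omega
      rintro t' s' ⟨ht', hI'', hi', ha'⟩
      have hnx := hfr _ _ hI''
      have hptr := N.nx_ptr a (by omega)
      rw [wp_assign]
      refine ⟨trivial, N.nx a, by simp [hnx, ha'], by simp [hi', hi], ?_, ?_, ?_, ?_⟩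
      · have := hptr.le; omega
      · rw [← hav]; exact hptr.tail
      · convert hst _ _ regP _ (by simp) hI'' using 1
        ext b
        simp only [mem_union, mem_filter, Net.mem_arcs, mem_singleton, mem_insert]
        have h₁ := hptr.le
        have h₂ := hptr.skip b
        rw [hav] at h₂
        by_cases hb : b = a
        · subst hb; simp [hav, h₁]; right; omega
        · have : (b < N.M ∧ N.tl b = v) ∧ N.nx a ≤ b ↔ (b < N.M ∧ N.tl b = v) ∧ a.succ ≤ b := by
            constructor
            · rintro ⟨h₃, h₄⟩
              refine ⟨h₃, ?_⟩
              by_contra h₅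
              exact h₂ h₄ (by omega) h₃.2
            · rintro ⟨h₃, h₄⟩
              exact ⟨h₃, by omega⟩
          rw [this]; simp [hb]
      · have h₁ := Net.cnt_nx (N := N) (a := a) (by omega)
        rw [hav] at h₁
        rw [Nat.succ_eq_add_one, h₁] at ht
        simp only [cost_reg, cost_get] at ht' ⊢
        linarith
    · rw [val_reg, hp] at h
      subst h
      refine ⟨by simp only [cost_reg]; omega, ?_, hi⟩
      simpa using hI
  · refine ⟨_, rfl, hi, hP.le, hP.tail, ?_, by rwa [← Net.cnt_eq_of_ptr hP]⟩
    rw [filter_false_of_mem, union_empty]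
    · exact hI
    · intro a ha h
      rw [Net.mem_arcs, mem_singleton] at ha
      exact hP.skip a h ha.1 ha.2

/-- Only the first `z` queue entries and `regCnt` have to stay fixed; the body may append to the
queue behind them, as `expand` does. Every vertex has an arc, so the overhead per vertex is absorbed
by the volume. -/
theorem wp_scan {J : Finset ℕ} {q : ℕ → ℕ} {z κ : ℕ} {I : Finset ℕ → State → Prop} {body : Cmd}
    (hB : N.Fits B) (hq : (range z).image q = J) (hz : J.card = z) (hJ : ∀ v ∈ J, v < N.n)
    (hfr : ∀ X s, I X s → s.arr arrHd = N.hd ∧ s.arr arrNx = N.nx ∧ s.reg regCnt = z ∧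
      ∀ i < z, s.arr arrQueue i = q i)
    (hst : ∀ X s r x, r = regI ∨ r = regP ∨ r = regA → I X s → I X (s.setReg r x))
    (hbody : ∀ X t s a, I X s → a ∈ N.arcs J → a ∉ X → s.reg regA = a →
      Wp B body (fun t' s' => t' ≤ t + κ ∧ I (insert a X) s' ∧ s'.reg regI = s.reg regI ∧
        s'.reg regA = a) t s)
    {t : ℕ} {s : State} (hI : I ∅ s) :
    Wp B (scan body) (fun t' s' => t' ≤ t + (κ + 30) * N.vol J + 6 ∧ I (N.arcs J) s') t s := by
  have hinj : Set.InjOn q (range z) := by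
    rw [← card_image_iff, hq, hz, card_range]
  have hzv : z ≤ N.vol J := hz ▸ Net.card_le_vol hJ
  have hzn : z ≤ N.n := by
    rw [← hz]; simpa using card_le_card (fun v hv => by simpa using hJ v hv : J ⊆ range N.n)
  have hF := hB
  unfold Net.Fits at hF
  unfold scan
  simp only [wp_seq, wp_assign, val_lit, ok_lit, cost_lit]
  refine ⟨by omega, ?_⟩
  set Ji : ℕ → Finset ℕ := fun i => (range i).image q with hJi
  have hmono : ∀ i ≤ z, N.vol (Ji i) ≤ N.vol J := fun i hi => by
    rw [← hq]; exact Net.vol_mono (image_subset_image (range_subset_range.2 hi))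
  refine wp_while (t + (κ + 9) * N.vol J + 20 * z + 2) (fun t' s => ∃ i, s.reg regI = i ∧ i ≤ z ∧
    I (N.arcs (Ji i)) s ∧ t' ≤ t + (κ + 9) * N.vol (Ji i) + 20 * i + 2) ?_ ?_ ?_
  · rintro t' s ⟨i, -, hi, -, ht⟩
    have := Nat.mul_le_mul_left (κ + 9) (hmono i hi)
    omega
  · rintro t' s ⟨i, hi, hiz, hI, ht⟩
    obtain ⟨hhd, hnx, hcnt, hqs⟩ := hfr _ _ hI
    refine ⟨⟨trivial, trivial, ?_⟩, fun h => ?_, fun h => ?_⟩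
    · rw [Op.eval]; split_ifs <;> omega
    · rw [val_lt, val_reg, val_reg, hi, hcnt] at h
      have hlt : i < z := by by_contra h'; simp [h'] at h
      have hv : q i ∈ J := by rw [← hq]; exact mem_image_of_mem _ (by simpa using hlt)
      simp only [wp_seq, wp_assign, val_get, val_reg, ok_get, ok_reg, hi, hhd, hqs i hlt, true_and,
        cost_get, cost_reg]
      have hnot : q i ∉ Ji i := by
        intro h'
        obtain ⟨j, hj, hji⟩ := mem_image.1 h'
        have hj := mem_range.1 hj
        have := hinj (by simp; omega) (by simp; omega) hji
        omega
      have hvol : N.vol (Ji (i + 1)) = N.vol (Ji i) + N.cnt (q i) N.M := by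
        rw [hJi]
        simp only [range_add_one, image_insert]
        rw [Net.vol_eq_sum, sum_insert hnot, ← Net.vol_eq_sum, add_comm]
      refine (wp_scan_arcs (v := q i) (κ := κ) (i := i) (X₀ := N.arcs (Ji i))
        (T := t + (κ + 9) * N.vol (Ji (i + 1)) + 20 * i + 10) hB ?_ (fun X s h => (hfr X s h).2.1)
        hst ?_ ?_ ?_ (hst _ _ _ _ (by simp) hI) ?_).mono ?_
      · intro a ha h'; exact hnot (ha ▸ (Net.mem_arcs.1 h').2)
      · intro X t s a h₁ h₂ h₃ h₄ h₅
        exact hbody X t s a h₁ (Net.mem_arcs.2 ⟨h₂, h₃ ▸ hv⟩) h₄ h₅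
      · simpa using N.hd_ptr _ (hJ _ hv)
      · simp [hi]
      · rw [hvol, mul_add]
        simp only [cost_lt, cost_reg]
        omega
      · rintro t₁ s₁ ⟨ht₁, hI₁, hi₁⟩
        simp only [wp_assign, ok_add, ok_reg, ok_lit, val_add, val_reg, val_lit, hi₁, true_and, cost_add,
          cost_reg, cost_lit]
        refine ⟨⟨by omega, by omega⟩, i + 1, by simp, hlt, ?_, by omega⟩
        convert hst _ _ regI _ (by simp) hI₁ using 1
        ext a
        simp only [Net.mem_arcs, mem_union, mem_singleton, hJi, range_add_one, image_insert,
          mem_insert]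
        tauto
    · rw [val_lt, val_reg, val_reg, hi, hcnt] at h
      have hlt : i = z := by
        by_contra h'
        rw [if_pos (by omega)] at h
        omega
      subst hlt
      rw [show Ji i = J from hq] at hI ht
      refine ⟨?_, hI⟩
      simp only [cost_lt, cost_reg]
      rw [add_mul] at ht ⊢
      omega
  · refine ⟨0, by simp, by omega, ?_, by omega⟩
    have h := hst _ _ regI 0 (by simp) hI
    have : N.arcs (Ji 0) = ∅ := by
      ext a; simp [Net.mem_arcs, hJi]
    rwa [this]

end WordRAM

/-! ### Cutting off a set of vertices of large label -/

namespace WordRAM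

open WordRAM.Expr (reg get)

variable {N : Net} {B : ℕ}

/-- The states agree outside the registers `rs` and the arrays `as`. -/
structure Agree (rs as : List ℕ) (s s' : State) : Prop where
  reg : ∀ r, r ∉ rs → s'.reg r = s.reg r
  arr : ∀ a, a ∉ as → s'.arr a = s.arr a

theorem Agree.refl (rs as : List ℕ) (s : State) : Agree rs as s s := ⟨fun _ _ => rfl, fun _ _ => rfl⟩

theorem Agree.trans {rs as rs' as' : List ℕ} {s₁ s₂ s₃ : State} (h₁ : Agree rs as s₁ s₂)
    (h₂ : Agree rs' as' s₂ s₃) (hr : rs' ⊆ rs) (ha : as' ⊆ as) : Agree rs as s₁ s₃ :=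
  ⟨fun r h => (h₂.reg r fun h' => h (hr h')).trans (h₁.reg r h),
    fun r h => (h₂.arr r fun h' => h (ha h')).trans (h₁.arr r h)⟩

theorem Agree.mono {rs as rs' as' : List ℕ} {s s' : State} (h : Agree rs' as' s s')
    (hr : rs' ⊆ rs) (ha : as' ⊆ as) : Agree rs as s s' :=
  (Agree.refl rs as s).trans h hr ha

theorem Agree.setReg {rs as : List ℕ} {s s' : State} (h : Agree rs as s s') {r : ℕ} (x : ℕ)
    (hr : r ∈ rs) : Agree rs as s (s'.setReg r x) :=
  ⟨fun r' h' => by rw [setReg_reg, if_neg (by rintro rfl; exact h' hr)]; exact h.reg r' h', h.arr⟩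

theorem Agree.setArr {rs as : List ℕ} {s s' : State} (h : Agree rs as s s') {a : ℕ} (i x : ℕ)
    (ha : a ∈ as) : Agree rs as s (s'.setArr a i x) :=
  ⟨h.reg, fun r' h' => by
    rw [setArr_arr, if_neg (by rintro rfl; exact h' ha)]; exact h.arr r' h'⟩

/-- The parts of the state that describe the network. -/
structure Static (N : Net) (s : State) : Prop where
  n : s.reg regN = N.n
  c : s.reg regC = N.c
  M : s.reg regM = N.M
  h : s.reg regH = N.h
  k : s.reg regK = 200 * N.c
  tl : s.arr arrTl = N.tl
  rv : s.arr arrRv = N.rv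
  hd : s.arr arrHd = N.hd
  nx : s.arr arrNx = N.nx

theorem Static.of_agree {rs as : List ℕ} {s s' : State} (h : Static N s) (ha : Agree rs as s s')
    (hr : ∀ r ∈ rs, r = regFlag ∨ regK < r) (has : ∀ a ∈ as, a ≤ arrCut ∨ arrNx < a) :
    Static N s' := by
  have h₁ : ∀ r, r ≠ regFlag → r ≤ regK → s'.reg r = s.reg r := fun r h₁ h₂ =>
    ha.reg r fun h₃ => by rcases hr r h₃ with h | h <;> omega
  have h₂ : ∀ a, arrCut < a → a ≤ arrNx → s'.arr a = s.arr a := fun a h₁ h₂ =>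
    ha.arr a fun h₃ => by rcases has a h₃ with h | h <;> omega
  constructor
  · rw [h₁ _ (by simp) (by simp), h.n]
  · rw [h₁ _ (by simp) (by simp), h.c]
  · rw [h₁ _ (by simp) (by simp), h.M]
  · rw [h₁ _ (by simp) (by simp), h.h]
  · rw [h₁ _ (by simp) (by simp), h.k]
  · rw [h₂ _ (by simp) (by simp), h.tl]
  · rw [h₂ _ (by simp) (by simp), h.rv]
  · rw [h₂ _ (by simp) (by simp), h.hd]
  · rw [h₂ _ (by simp) (by simp), h.nx]

/-- The first `regCnt` entries of the queue enumerate `J`. -/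
structure Enum (N : Net) (J : Finset ℕ) (s : State) : Prop where
  image : (range (s.reg regCnt)).image (s.arr arrQueue) = J
  card : J.card = s.reg regCnt
  lt : ∀ v ∈ J, v < N.n

/-- Assigns the head of the arc `regA` to `regW`. -/
def loadHead : Cmd := .assign regW (get arrTl (get arrRv (reg regA)))

/-- Whether the vertex in `regW` has not been removed. -/
def isAlive : Expr := (get arrDead (reg regW)).lt 1

/-- Computes the volume of the queue and the number of residual arcs that leave it. -/
def count : Cmd :=
  .assign regVol 0 ;; .assign regOut 0 ;;
  scan (.assign regVol (reg regVol + 1) ;; loadHead ;;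
    .ite (isAlive * Expr.lt 0 (get arrRes (reg regA))) (.assign regOut (reg regOut + 1)) .skip)

theorem wp_count {D : ℕ → ℕ} {J : Finset ℕ} {t : ℕ} {s : State} (hB : N.Fits B)
    (hS : Static N s) (hE : Enum N J s) (hD : s.arr arrDead = D) :
    Wp B count (fun t' s' => t' ≤ t + 60 * N.vol J + 10 ∧
      Agree [regI, regP, regA, regVol, regOut, regW] [] s s' ∧ s'.reg regVol = N.vol J ∧
      s'.reg regOut = (N.outRes (s.arr arrRes) D J).card) t s := by
  have hF := hB
  unfold Net.Fits at hF
  unfold count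
  simp only [wp_seq, wp_assign, ok_lit, val_lit, cost_lit]
  refine ⟨by omega, by omega, ?_⟩
  refine (wp_scan (κ := 30) (J := J) (q := s.arr arrQueue) (z := s.reg regCnt)
    (I := fun X s' => X ⊆ N.arcs J ∧ Agree [regI, regP, regA, regVol, regOut, regW] [] s s' ∧
      s'.reg regVol = X.card ∧ s'.reg regOut =
        (X.filter fun a => D (N.dst a) = 0 ∧ 0 < s.arr arrRes a).card)
    hB hE.image hE.card hE.lt ?_ ?_ ?_ ?_).mono ?_
  · rintro X s' ⟨-, h, -, -⟩
    have hS' := hS.of_agree h (by simp) (by simp)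
    exact ⟨hS'.hd, hS'.nx, h.reg _ (by simp), fun i _ => by rw [h.arr _ (by simp)]⟩
  · rintro X s' r x hr ⟨h₀, h, h₁, h₂⟩
    refine ⟨h₀, h.setReg x (by simp only [List.mem_cons]; tauto), ?_, ?_⟩ <;>
    · rcases hr with rfl | rfl | rfl <;> simpa
  · rintro X t' s' a ⟨h₀, h, h₁, h₂⟩ ha haX hra
    have hS' := hS.of_agree h (by simp) (by simp)
    have hX : X.card ≤ N.M := (card_le_card h₀).trans (Net.vol_le J)
    have hX' : (X.filter fun a => D (N.dst a) = 0 ∧ 0 < s.arr arrRes a).card ≤ X.card :=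
      card_filter_le _ _
    have hda : N.tl (N.rv a) = N.dst a := rfl
    have hR : s'.arr arrRes = s.arr arrRes := h.arr _ (by simp)
    have hD' : s'.arr arrDead = D := by rw [← hD]; exact h.arr _ (by simp)
    have hag := (((h.setReg (X.card + 1) (r := regVol) (by simp)).setReg (N.dst a)
      (r := regW) (by simp)))
    simp only [loadHead, isAlive, wp_seq, wp_assign, wp_ite, wp_skip, ok_add, ok_reg, ok_lit,
      ok_get, ok_mul, ok_lt, val_add, val_reg, val_lit, val_get, val_mul, val_lt, cost_add,
      cost_reg, cost_lit, cost_get, cost_mul, cost_lt, setReg_reg, setReg_arr, h₁, h₂, hra, hS'.tl,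
      hS'.rv, hD', hR, hda, Nat.reduceEqDiff, if_true, if_false, true_and, Nat.lt_one_iff,
      ite_one_zero_lt_iff (show 1 < B by omega), and_true, mul_ite, mul_one, mul_zero]
    refine ⟨⟨by omega, by omega⟩, ⟨by omega, by omega, by split_ifs <;> omega⟩, fun hc => ?_,
      fun hc => ?_⟩
    · have hc' : D (N.dst a) = 0 ∧ 0 < s.arr arrRes a := by
        by_contra h'
        apply hc
        split_ifs <;> tauto
      refine ⟨⟨by omega, by omega⟩, by omega, ⟨insert_subset ha h₀, hag.setReg _ (by simp), ?_, ?_⟩⟩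
      · rw [card_insert_of_notMem haX]
      · rw [filter_insert, if_pos hc', card_insert_of_notMem (by simp [haX])]
    · have hc' : ¬ (D (N.dst a) = 0 ∧ 0 < s.arr arrRes a) := by
        rintro ⟨h', h''⟩
        simp [h', h''] at hc
      refine ⟨by omega, ⟨insert_subset ha h₀, hag, ?_, ?_⟩⟩
      · rw [card_insert_of_notMem haX]
      · rw [filter_insert, if_neg hc']
  · exact ⟨empty_subset _, ((Agree.refl _ _ s).setReg _ (by simp)).setReg _ (by simp), by simp,
      by simp⟩
  · rintro t' s' ⟨ht, -, h, h₁, h₂⟩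
    exact ⟨by omega, h, h₁, h₂⟩

/-- Adds to the queue the heads of the residual arcs that leave it, and marks them. -/
def expand : Cmd :=
  .assign regSz (reg regCnt) ;;
  scan (loadHead ;; .ite (isAlive * Expr.lt 0 (get arrRes (reg regA)))
    (.store arrDead (reg regW) 1 ;; .store arrQueue (reg regSz) (reg regW) ;;
      .assign regSz (reg regSz + 1)) .skip) ;;
  .assign regCnt (reg regSz)

theorem wp_expand {D : ℕ → ℕ} {J : Finset ℕ} {t : ℕ} {s : State} (hB : N.Fits B)
    (hS : Static N s) (hE : Enum N J s) (hD : s.arr arrDead = Net.mark D J) :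
    Wp B expand (fun t' s' => t' ≤ t + 60 * N.vol J + 12 ∧
      Agree [regI, regP, regA, regCnt, regSz, regW] [arrDead, arrQueue] s s' ∧
      Enum N (Net.grown N (s.arr arrRes) D J) s' ∧
      s'.arr arrDead = Net.mark D (Net.grown N (s.arr arrRes) D J)) t s := by
  have hF := hB
  unfold Net.Fits at hF
  unfold expand
  simp only [wp_seq, wp_assign, ok_reg, val_reg, cost_reg, true_and]
  -- The contents of the queue once the arcs in `X` have been processed. Marks made on the way only
  -- suppress heads that are already in it, so it can be described by the initial marks.
  set K : Finset ℕ → Finset ℕ := fun X =>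
    J ∪ (X.filter fun a => Net.mark D J (N.dst a) = 0 ∧ 0 < s.arr arrRes a).image N.dst with hK
  refine (wp_scan (κ := 30) (J := J) (q := s.arr arrQueue) (z := s.reg regCnt)
    (I := fun X s' => X ⊆ N.arcs J ∧
      Agree [regI, regP, regA, regSz, regW] [arrDead, arrQueue] s s' ∧
      (∀ i < s.reg regCnt, s'.arr arrQueue i = s.arr arrQueue i) ∧
      (range (s'.reg regSz)).image (s'.arr arrQueue) = K X ∧ (K X).card = s'.reg regSz ∧
      s'.arr arrDead = Net.mark D (K X))
    hB hE.image hE.card hE.lt ?_ ?_ ?_ ?_).mono ?_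
  · rintro X s' ⟨-, h, hq, -, -⟩
    have hS' := hS.of_agree h (by simp) (by simp)
    exact ⟨hS'.hd, hS'.nx, h.reg _ (by simp), hq⟩
  · rintro X s' r x hr ⟨h₀, h, h₁, h₂, h₃, h₄⟩
    refine ⟨h₀, h.setReg x (by simp only [List.mem_cons]; tauto), h₁, ?_, ?_, h₄⟩ <;>
    · rcases hr with rfl | rfl | rfl <;> simpa
  · rintro X t' s' a ⟨h₀, h, h₁, h₂, h₃, h₄⟩ ha haX hra
    have hS' := hS.of_agree h (by simp) (by simp)
    have hKlt : K X ⊆ range N.n := by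
      intro v hv
      rcases mem_union.1 hv with hv | hv
      · simpa using hE.lt v hv
      · obtain ⟨b, hb, rfl⟩ := mem_image.1 hv
        simpa using Net.dst_lt (Net.mem_arcs.1 (h₀ (mem_filter.1 hb).1)).1
    have hKn : (K X).card ≤ N.n := by simpa using card_le_card hKlt
    have hda : N.tl (N.rv a) = N.dst a := rfl
    have hR : s'.arr arrRes = s.arr arrRes := h.arr _ (by simp)
    have hag := h.setReg (N.dst a) (r := regW) (by simp)
    simp only [loadHead, isAlive, wp_seq, wp_assign, wp_store, wp_ite, wp_skip, ok_add, ok_reg,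
      ok_lit, ok_get, ok_mul, ok_lt, val_add, val_reg, val_lit, val_get, val_mul, val_lt, cost_add,
      cost_reg, cost_lit, cost_get, cost_mul, cost_lt, setReg_reg, setReg_arr, setArr_arr,
      setArr_reg, hra, hS'.tl,
      hS'.rv, h₄, hR, hda, Nat.reduceEqDiff, if_true, if_false, true_and, Nat.lt_one_iff,
      ite_one_zero_lt_iff (show 1 < B by omega), and_true, mul_ite, mul_one, mul_zero]
    refine ⟨⟨by omega, by omega, by split_ifs <;> omega⟩, fun hc => ?_, fun hc => ?_⟩
    · have hc' : Net.mark D (K X) (N.dst a) = 0 ∧ 0 < s.arr arrRes a := by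
        by_contra h'
        apply hc
        split_ifs <;> tauto
      have hw := Net.mark_eq_zero.1 hc'.1
      have hwJ : Net.mark D J (N.dst a) = 0 :=
        Net.mark_eq_zero.2 ⟨fun h => hw.1 (mem_union_left _ h), hw.2⟩
      have hKX : K (insert a X) = insert (N.dst a) (K X) := by
        simp only [hK]
        rw [filter_insert, if_pos ⟨hwJ, hc'.2⟩, image_insert, union_insert]
      have hsz : s.reg regCnt ≤ s'.reg regSz := by
        rw [← h₃, ← hE.card]; exact card_le_card subset_union_left
      refine ⟨by omega, by omega, by omega, ⟨insert_subset ha h₀,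
        ((hag.setArr _ _ (by simp)).setArr _ _ (by simp)).setReg _ (by simp), ?_, ?_, ?_, ?_⟩⟩
      · intro i hi
        rw [update_of_ne (by omega)]
        exact h₁ i hi
      · rw [range_add_one, image_insert, update_self, hKX, ← h₂]
        congr 1
        refine image_congr fun i hi => ?_
        rw [update_of_ne]
        have := mem_range.1 (mem_coe.1 hi)
        omega
      · rw [hKX, card_insert_of_notMem hw.1, h₃]
      · rw [hKX, Net.mark_insert]
    · have hc' : ¬ (Net.mark D (K X) (N.dst a) = 0 ∧ 0 < s.arr arrRes a) := by
        rintro ⟨h', h''⟩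
        simp [h', h''] at hc
      have hKX : K (insert a X) = K X := by
        simp only [hK]
        rw [filter_insert]
        split_ifs with h'
        · rw [image_insert, union_insert, insert_eq_self]
          rw [Net.mark_eq_zero] at hc' h'
          tauto
        · rfl
      rw [hKX]
      exact ⟨by omega, ⟨insert_subset ha h₀, hag, h₁, h₂, h₃, rfl⟩⟩
  · have hK0 : K ∅ = J := by simp [hK]
    refine ⟨empty_subset _, (Agree.refl _ _ s).setReg _ (by simp), fun i _ => rfl, ?_, ?_, ?_⟩
    · rw [hK0]; simpa using hE.image
    · rw [hK0]; simpa using hE.card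
    · rw [hK0]; exact hD
  · rintro t' s' ⟨ht, -, h, h₁, h₂, h₃, h₄⟩
    have hKJ : K (N.arcs J) = Net.grown N (s.arr arrRes) D J := rfl
    rw [wp_assign]
    simp only [ok_reg, val_reg, cost_reg, true_and]
    refine ⟨by omega, (h.mono (by simp) (by simp)).setReg _ (by simp),
      ⟨?_, ?_, ?_⟩, ?_⟩
    · rw [← hKJ]; simpa using h₂
    · rw [← hKJ]; simpa using h₃
    · intro v hv
      rcases mem_union.1 hv with hv | hv
      · exact hE.lt v hv
      · obtain ⟨b, hb, rfl⟩ := mem_image.1 hv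
        exact Net.dst_lt (Net.mem_outRes.1 hb).1.1
    · exact h₄

end WordRAM

/-! ### Pending mass, remaining volume, and cancelling the flow into a removed set -/

namespace Net

variable {N : Net}

/-- Keeps pending mass within a word: a vertex has at most its own unit and `c` units per arc. -/
theorem Core.pe_le {R L P W pe D : ℕ → ℕ} {k : ℕ → ℤ} (H : Core N R L P W pe D k) {v : ℕ}
    (hv : v < N.n) (hD : D v = 0) (hk : 0 ≤ k v) : pe v ≤ 1 + N.c * N.M := by
  have h₁ := H.cons v hv hD
  have h₂ := neg_le_out H.res v
  have h₃ := N.src_le v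
  have h₄ : 0 ≤ sunk (W v) := by unfold sunk; split_ifs <;> simp
  zify
  push_cast at h₂
  have : (N.src v : ℤ) ≤ 1 := by exact_mod_cast h₃
  linarith

/-- The pending mass on vertices that are not removed. -/
def pendSum (N : Net) (pe D : ℕ → ℕ) : ℕ := ∑ v ∈ range N.n, if D v = 0 then pe v else 0

/-- The volume of the set of vertices that are not removed. -/
def aliveVol (N : Net) (D : ℕ → ℕ) : ℕ := N.vol ((range N.n).filter fun v => D v = 0)

theorem pendSum_update {pe D : ℕ → ℕ} {v x : ℕ} (hv : v < N.n) (hD : D v = 0) :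
    N.pendSum (update pe v x) D + pe v = N.pendSum pe D + x := by
  simpa [hD, pendSum] using sum_update hv pe x fun v x => if D v = 0 then x else 0

theorem pendSum_mark_le (pe D : ℕ → ℕ) (J : Finset ℕ) :
    N.pendSum pe (mark D J) ≤ N.pendSum pe D := by
  refine sum_le_sum fun v _ => ?_
  have := @mark_eq_zero D J v
  split_ifs <;> omega

theorem aliveVol_mark {D : ℕ → ℕ} {J : Finset ℕ} (hJ : ∀ v ∈ J, v < N.n ∧ D v = 0) :
    N.aliveVol (mark D J) + N.vol J = N.aliveVol D := by
  unfold aliveVol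
  rw [← vol_union]
  · congr 1
    ext v
    simp only [mem_union, mem_filter, mem_range, mark_eq_zero]
    have := hJ v
    tauto
  · rw [disjoint_left]
    intro v hv hJv
    exact (mark_eq_zero.1 (mem_filter.1 hv).2).1 hJv

/-- The state while the flow into the removed set `J` is cancelled; `X` is the set of the arcs of
`J` that have been processed. -/
structure CancelInv (N : Net) (J : Finset ℕ) (L P W D R₀ pe₀ : ℕ → ℕ) (sp₀ : ℕ) (X : Finset ℕ)
    (R pe stk : ℕ → ℕ) (sp : ℕ) : Prop where
  sub : X ⊆ N.arcs J
  core : Core N R L P W pe (mark D J) 0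
  unproc : ∀ a ∈ N.arcs J, a ∉ X → mark D J (N.dst a) = 0 → R a = R₀ a
  proc : ∀ a ∈ X, mark D J (N.dst a) = 0 → R a ≤ N.c
  old : ∀ a < N.M, mark D J (N.tl a) = 0 → D (N.dst a) ≠ 0 → N.c ≤ R a
  pend : N.pendSum pe (mark D J) ≤ N.pendSum pe₀ (mark D J) +
    N.c * (X.filter fun a => mark D J (N.dst a) = 0 ∧ 0 < R₀ a).card
  spLe : sp ≤ sp₀ + X.card
  stackMem : ∀ v < N.n, mark D J v = 0 → 0 < pe v → ∃ i < sp, stk i = v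
  stackLt : ∀ i < sp, stk i < N.n

variable {J X : Finset ℕ} {L P W D R₀ pe₀ R pe stk : ℕ → ℕ} {sp₀ sp a : ℕ}

theorem CancelInv.skip (H : CancelInv N J L P W D R₀ pe₀ sp₀ X R pe stk sp) (ha : a ∈ N.arcs J)
    (haX : a ∉ X) (h : mark D J (N.dst a) = 0 → R a ≤ N.c) :
    CancelInv N J L P W D R₀ pe₀ sp₀ (insert a X) R pe stk sp where
  sub := insert_subset ha H.sub
  core := H.core
  unproc b hb hbX := H.unproc b hb fun h => hbX (mem_insert_of_mem h)
  proc b hb := by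
    rcases mem_insert.1 hb with rfl | hb
    · exact h
    · exact H.proc b hb
  old := H.old
  pend := H.pend.trans (Nat.add_le_add_left (Nat.mul_le_mul_left _
    (card_le_card (filter_subset_filter _ (subset_insert a X)))) _)
  spLe := by have := H.spLe; rw [card_insert_of_notMem haX]; omega
  stackMem := H.stackMem
  stackLt := H.stackLt

/-- An unprocessed arc still has its initial capacity, so it was residual when the ball was
complete. It returns at most `c` units, which are charged to it in `pend`. -/
theorem CancelInv.step (H : CancelInv N J L P W D R₀ pe₀ sp₀ X R pe stk sp) (ha : a ∈ N.arcs J)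
    (haX : a ∉ X) (h₁ : mark D J (N.dst a) = 0) (h₂ : N.c < R a) :
    CancelInv N J L P W D R₀ pe₀ sp₀ (insert a X) (cancelled N R a)
      (update pe (N.dst a) (pe (N.dst a) + (R a - N.c))) (update stk sp (N.dst a)) (sp + 1) := by
  have ha' := mem_arcs.1 ha
  have hres := H.core.res a ha'.1
  refine ⟨insert_subset ha H.sub, H.core.cancel ha'.1
    (fun h => (mark_eq_zero.1 h).1 ha'.2) h₁ h₂, fun b hb hbX h => ?_, fun b hb h => ?_,
    fun b hb h₃ h₄ => ?_, ?_, ?_, fun v hv hD hp => ?_, fun i hi => ?_⟩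
  · rw [cancelled_apply, if_neg]
    · exact H.unproc b hb (fun h => hbX (mem_insert_of_mem h)) h
    · rintro (rfl | rfl)
      · exact hbX (mem_insert_self _ _)
      · exact (mark_eq_zero.1 h₁).1 (mem_arcs.1 hb).2
  · rw [cancelled_apply]
    split_ifs with hba
    · rfl
    · rcases mem_insert.1 hb with rfl | hb
      · simp at hba
      · exact H.proc b hb h
  · rw [cancelled_apply]
    split_ifs
    · rfl
    · exact H.old b hb h₃ h₄
  · have h₃ := pendSum_update (N := N) (pe := pe) (x := pe (N.dst a) + (R a - N.c))
      (dst_lt ha'.1) h₁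
    have h₄ := H.unproc a ha haX h₁
    have h₅ := H.pend
    rw [filter_insert, if_pos ⟨h₁, by omega⟩, card_insert_of_notMem (by simp [haX]), mul_add]
    omega
  · have := H.spLe; rw [card_insert_of_notMem haX]; omega
  · by_cases hv' : v = N.dst a
    · exact ⟨sp, by omega, by rw [update_self, hv']⟩
    · rw [update_of_ne hv'] at hp
      obtain ⟨i, hi, h⟩ := H.stackMem v hv hD hp
      exact ⟨i, by omega, by rw [update_of_ne (by omega), h]⟩
  · by_cases hi' : i = sp
    · rw [hi', update_self]; exact dst_lt ha'.1
    · rw [update_of_ne hi']; exact H.stackLt i (by omega)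

/-- An arc into `J` is the reverse of a processed arc `b` with `R b ≤ c`, and the two capacities add
up to `2c`. -/
theorem CancelInv.deadArcs (H : CancelInv N J L P W D R₀ pe₀ sp₀ (N.arcs J) R pe stk sp) :
    DeadArcs N R (mark D J) := by
  intro a ha h₁ h₂
  by_cases hD : D (N.dst a) = 0
  · have hJ : N.dst a ∈ J := by
      by_contra h
      exact h₂ (mark_eq_zero.2 ⟨h, hD⟩)
    have h₃ := H.proc (N.rv a) (mem_arcs.2 ⟨N.rv_lt a ha, hJ⟩) (by rwa [dst_rv ha])
    have := H.core.res a ha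
    omega
  · exact H.old a ha h₁ hD

end Net

/-! ### Growing the ball and cancelling the flow into it -/

namespace WordRAM

open WordRAM.Expr (reg get)

variable {N : Net} {B : ℕ}

/-- Expands the queue, layer by layer, until few residual arcs leave it. -/
def grow : Cmd := .while ((reg regVol).lt (reg regK * reg regOut)) (expand ;; count)

/-- A round takes time linear in the volumes `V` before and `V'` after it. It only runs if `V <
200cz`, and it adds at least `z` to the volume. So the time is charged to the added volume at rate
`150·200c`, without a factor for the number of rounds. -/
theorem wp_grow {L D : ℕ → ℕ} {x : ℕ} {J : Finset ℕ} {t : ℕ} {s : State} (hB : N.Fits B)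
    (hS : Static N s) (hE : Enum N J s) (hD : s.arr arrDead = Net.mark D J)
    (hball : Net.Ball N L D x J)
    (hlab : ∀ a < N.M, D (N.tl a) = 0 → D (N.dst a) = 0 → 0 < s.arr arrRes a →
      L (N.tl a) ≤ L (N.dst a) + 1)
    (hvol : s.reg regVol = N.vol J)
    (hout : s.reg regOut = (N.outRes (s.arr arrRes) (Net.mark D J) J).card) :
    Wp B grow (fun t' s' => ∃ J', t' ≤ t + 150 * (200 * N.c) * N.vol J' + 6 ∧
      Agree [regI, regP, regA, regCnt, regSz, regVol, regOut, regW] [arrDead, arrQueue] s s' ∧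
      Enum N J' s' ∧ s'.arr arrDead = Net.mark D J' ∧ Net.Ball N L D x J' ∧
      200 * N.c * (N.outRes (s.arr arrRes) (Net.mark D J') J').card ≤ N.vol J') t s := by
  have hF := hB
  unfold Net.Fits at hF
  set R := s.arr arrRes with hR
  refine wp_while (t + 150 * (200 * N.c) * N.M) (fun t' s' => ∃ J',
    t' ≤ t + 150 * (200 * N.c) * N.vol J' ∧
    Agree [regI, regP, regA, regCnt, regSz, regVol, regOut, regW] [arrDead, arrQueue] s s' ∧
    Enum N J' s' ∧ s'.arr arrDead = Net.mark D J' ∧ Net.Ball N L D x J' ∧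
    s'.reg regVol = N.vol J' ∧ s'.reg regOut = (N.outRes R (Net.mark D J') J').card) ?_ ?_ ?_
  · rintro t' s' ⟨J', h, -⟩
    have := Nat.mul_le_mul_left (150 * (200 * N.c)) (Net.vol_le (N := N) J')
    omega
  · rintro t' s' ⟨J', ht, hag, hE', hD', hball', hvol', hout'⟩
    have hS' := hS.of_agree hag (by simp) (by simp)
    have hz : (N.outRes R (Net.mark D J') J').card ≤ N.M :=
      (card_filter_le _ _).trans (Net.vol_le J')
    have hmul : 200 * N.c * (N.outRes R (Net.mark D J') J').card ≤ 200 * N.c * (N.M + 2) :=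
      Nat.mul_le_mul_left _ (by omega)
    simp only [ok_lt, ok_mul, ok_reg, val_lt, val_mul, val_reg, hvol', hout', hS'.k, cost_lt,
      cost_mul, cost_reg, true_and, ite_one_zero_lt_iff (show 1 < B by omega), and_true, wp_seq]
    refine ⟨by omega, fun h => ?_, fun h => ?_⟩
    · have hlt : N.vol J' < 200 * N.c * (N.outRes R (Net.mark D J') J').card := by
        by_contra h'; simp [h'] at h
      have hR' : s'.arr arrRes = R := hag.arr _ (by simp)
      have hc := N.one_lt_c
      have hgrown := Net.vol_grown (N := N) (R := R) (D := D) J'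
      have h1 : 0 < N.vol J' := by
        rw [Net.vol_eq_sum]
        exact lt_of_lt_of_le (Net.cnt_pos (hball'.alive x hball'.mem).1)
          (single_le_sum (f := fun v => N.cnt v N.M) (fun _ _ => Nat.zero_le _) hball'.mem)
      refine (wp_expand hB hS' hE' hD').mono ?_
      rintro t₁ s₁ ⟨ht₁, hag₁, hE₁, hD₁⟩
      rw [hR'] at hE₁ hD₁
      refine (wp_count hB (hS'.of_agree hag₁ (by simp) (by simp)) hE₁ hD₁).mono ?_
      rintro t₂ s₂ ⟨ht₂, hag₂, hv₂, ho₂⟩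
      have hE₂ : Enum N (Net.grown N R D J') s₂ := by
        refine ⟨?_, ?_, hE₁.lt⟩
        · rw [hag₂.reg _ (by simp), hag₂.arr _ (by simp)]; exact hE₁.image
        · rw [hag₂.reg _ (by simp)]; exact hE₁.card
      have hR₁ : s₁.arr arrRes = R := by rw [hag₁.arr _ (by simp), hR']
      refine ⟨_, ?_, (hag.trans hag₁ (by simp) (by simp)).trans hag₂ (by simp) (by simp), hE₂, ?_,
        hball'.grow hlab hlt, hv₂, ?_⟩
      · set V := N.vol J'
        set V' := N.vol (Net.grown N R D J')
        set z := (N.outRes R (Net.mark D J') J').card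
        obtain ⟨δ, hδ⟩ : ∃ δ, V' = V + δ := ⟨V' - V, by omega⟩
        have h2 : 200 * N.c * z ≤ 200 * N.c * δ := Nat.mul_le_mul_left _ (by omega)
        have h3 : 2 * δ ≤ 200 * N.c * δ := Nat.mul_le_mul_right _ (by omega)
        rw [hδ] at ht₂ ⊢
        rw [mul_assoc] at ht ⊢
        rw [mul_add]
        omega
      · rw [hag₂.arr _ (by simp)]; exact hD₁
      · rw [ho₂, hR₁]
    · have hle : 200 * N.c * (N.outRes R (Net.mark D J') J').card ≤ N.vol J' := by
        by_contra h'; simp [not_le.1 h'] at h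
      exact ⟨J', by omega, hag, hE', hD', hball', hle⟩
  · exact ⟨J, by omega, Agree.refl _ _ _, hE, hD, hball, hvol, hout⟩

/-- Cancels the flow into the queue along the arc in `regA` and makes it pending. -/
def cancelArc : Cmd :=
  loadHead ;; .ite (isAlive * (reg regC).lt (get arrRes (reg regA)))
    (.store arrPend (reg regW)
        (get arrPend (reg regW) + (get arrRes (reg regA) - reg regC)) ;;
      .store arrRes (reg regA) (reg regC) ;; .store arrRes (get arrRv (reg regA)) (reg regC) ;;
      .store arrStack (reg regSp) (reg regW) ;; .assign regSp (reg regSp + 1)) .skip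

theorem wp_cancel {L P W D : ℕ → ℕ} {J : Finset ℕ} {t : ℕ} {s : State} (hB : N.Fits B)
    (hS : Static N s) (hE : Enum N J s) (hD : s.arr arrDead = Net.mark D J)
    (hsp : s.reg regSp ≤ N.n + N.M)
    (hI : Net.CancelInv N J L P W D (s.arr arrRes) (s.arr arrPend) (s.reg regSp) ∅
      (s.arr arrRes) (s.arr arrPend) (s.arr arrStack) (s.reg regSp)) :
    Wp B (scan cancelArc) (fun t' s' => t' ≤ t + 90 * N.vol J + 6 ∧
      Agree [regI, regP, regA, regSp, regW] [arrPend, arrRes, arrStack] s s' ∧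
      Net.CancelInv N J L P W D (s.arr arrRes) (s.arr arrPend) (s.reg regSp) (N.arcs J)
        (s'.arr arrRes) (s'.arr arrPend) (s'.arr arrStack) (s'.reg regSp)) t s := by
  have hF := hB
  unfold Net.Fits at hF
  refine (wp_scan (κ := 60) (J := J) (q := s.arr arrQueue) (z := s.reg regCnt)
    (I := fun X s' => Agree [regI, regP, regA, regSp, regW] [arrPend, arrRes, arrStack] s s' ∧
      Net.CancelInv N J L P W D (s.arr arrRes) (s.arr arrPend) (s.reg regSp) X
        (s'.arr arrRes) (s'.arr arrPend) (s'.arr arrStack) (s'.reg regSp))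
    hB hE.image hE.card hE.lt ?_ ?_ ?_ ?_).mono ?_
  · rintro X s' ⟨h, -⟩
    have hS' := hS.of_agree h (by simp) (by simp)
    exact ⟨hS'.hd, hS'.nx, h.reg _ (by simp), fun i _ => by rw [h.arr _ (by simp)]⟩
  · rintro X s' r x hr ⟨h, h₁⟩
    refine ⟨h.setReg x (by simp only [List.mem_cons]; tauto), ?_⟩
    rcases hr with rfl | rfl | rfl <;> simpa
  · rintro X t' s' a ⟨h, hC⟩ ha haX hra
    have hS' := hS.of_agree h (by simp) (by simp)
    have haM := (Net.mem_arcs.1 ha).1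
    have hX : X.card ≤ N.M := (card_le_card hC.sub).trans (Net.vol_le J)
    have hda : N.tl (N.rv a) = N.dst a := rfl
    have hD' : s'.arr arrDead = Net.mark D J := by rw [← hD]; exact h.arr _ (by simp)
    have hag := h.setReg (N.dst a) (r := regW) (by simp)
    have hres := hC.core.res a haM
    have hspX := hC.spLe
    have hmul : N.c * N.M ≤ 200 * N.c * (N.M + 2) := Nat.mul_le_mul (by omega) (by omega)
    have hmul' : 200 * N.c * 2 ≤ 200 * N.c * (N.M + 2) := Nat.mul_le_mul_left _ (by omega)
    simp only [cancelArc, loadHead, isAlive, wp_seq, wp_assign, wp_store, wp_ite, wp_skip, ok_add,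
      ok_sub, val_sub, cost_sub, ok_reg, ok_lit, ok_get, ok_mul, ok_lt, val_add, val_reg, val_lit,
      val_get, val_mul, val_lt, cost_add, cost_reg, cost_lit, cost_get, cost_mul, cost_lt,
      setReg_reg, setReg_arr, setArr_arr, setArr_reg, hra, hS'.tl, hS'.rv, hS'.c, hD', hda,
      Nat.reduceEqDiff, if_true, if_false, true_and, Nat.lt_one_iff,
      ite_one_zero_lt_iff (show 1 < B by omega), and_true, mul_ite, mul_one, mul_zero]
    refine ⟨⟨by omega, by split_ifs <;> omega⟩, fun hc => ?_, fun hc => ?_⟩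
    · have hc' : Net.mark D J (N.dst a) = 0 ∧ N.c < s'.arr arrRes a := by
        by_contra h'
        apply hc
        split_ifs <;> tauto
      have hstep := hC.step ha haX hc'.1 hc'.2
      have hpe := hstep.core.pe_le (Net.dst_lt haM) hc'.1 le_rfl
      rw [update_self] at hpe
      refine ⟨⟨by omega, by omega⟩, ⟨by omega, by omega⟩, by omega,
        ((((hag.setArr _ _ (by simp)).setArr _ _ (by simp)).setArr _ _ (by simp)).setArr _ _
          (by simp)).setReg _ (by simp), hstep⟩
    · have hc' : Net.mark D J (N.dst a) = 0 → s'.arr arrRes a ≤ N.c := by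
        intro h'
        by_contra h''
        simp [h', not_le.1 h''] at hc
      exact ⟨by omega, hag, hC.skip ha haX hc'⟩
  · exact ⟨Agree.refl _ _ _, hI⟩
  · rintro t' s' ⟨ht, h, hC⟩
    exact ⟨by omega, h, hC⟩

end WordRAM

/-! ### The potential of the main loop -/

namespace Net

/-- The potential that pays for the main loop; `lt` is one more than the label of the token. -/
def pot (N : Net) (L P pe D : ℕ → ℕ) (sp lt : ℕ) : ℕ :=
  ∑ v ∈ range N.n, (N.h - L v) * (N.cnt v N.M + 2) + ∑ v ∈ range N.n, N.cnt v (P v)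
    + N.pendSum pe D * (N.h + 2) + lt + sp + N.aliveVol D * (N.h + 400 * N.c + 10)

variable {N : Net} {L P pe D : ℕ → ℕ} {sp lt u : ℕ}

/-- The label sum releases `cnt u M + 2`: the count refills the list of the current arc, one unit
covers the higher label of the token, and one remains. -/
theorem pot_relabel (hu : u < N.n) (hL : L u < N.h) (hP : P u = 0) :
    N.pot (update L u (L u + 1)) (update P u (N.hd u)) pe D sp (lt + 1) + 1
      ≤ N.pot L P pe D sp lt := by
  have h₁ := sum_update hu L (L u + 1) fun v x => (N.h - x) * (N.cnt v N.M + 2)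
  have h₂ := sum_update hu P (N.hd u) fun v x => N.cnt v x
  have h₃ := cnt_eq_of_ptr (N.hd_ptr u hu)
  have h₄ : N.cnt u 0 = 0 := by simp [cnt]
  have h₅ : (N.h - L u) * (N.cnt u N.M + 2)
      = (N.h - (L u + 1)) * (N.cnt u N.M + 2) + (N.cnt u N.M + 2) := by
    rw [show N.h - L u = N.h - (L u + 1) + 1 by omega]; ring
  rw [hP, h₄] at h₂
  unfold pot
  omega

theorem pot_advance {a : ℕ} (ha : a < N.M) (hP : P (N.tl a) = a + 1) :
    N.pot L (update P (N.tl a) (N.nx a)) pe D sp lt + 1 = N.pot L P pe D sp lt := by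
  have h₂ := sum_update (N.tl_lt a ha) P (N.nx a) fun v x => N.cnt v x
  have h₃ := cnt_nx ha
  rw [hP] at h₂
  unfold pot
  omega

/-- The weight `h + 2` of a pending unit exceeds the label term `L u + 1` of the token it turns
into. -/
theorem pot_inject (hu : u < N.n) (hD : D u = 0) (hp : 0 < pe u) (hL : L u < N.h) :
    N.pot L P (update pe u (pe u - 1)) D sp (L u + 1) + 1 ≤ N.pot L P pe D sp 0 := by
  have h := pendSum_update (pe := pe) (x := pe u - 1) hu hD
  have h' : N.pendSum pe D = N.pendSum (update pe u (pe u - 1)) D + 1 := by omega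
  unfold pot
  rw [h', add_mul]
  omega

/-- A unit of removed volume releases `h + 400c + 10`. Of this, `h + 2` pays for at most one new
pending unit and 1 for a stack entry; the remaining `400c + 7` finances the work of the cut. -/
theorem pot_cut {pe' : ℕ → ℕ} {J : Finset ℕ} {sp' z : ℕ} (hJ : ∀ v ∈ J, v < N.n ∧ D v = 0)
    (hpe : N.pendSum pe' (mark D J) ≤ N.pendSum pe (mark D J) + N.c * z)
    (hz : 200 * N.c * z ≤ N.vol J) (hsp : sp' ≤ sp + N.vol J) :
    N.pot L P pe' (mark D J) sp' 0 + N.vol J * (400 * N.c + 7) ≤ N.pot L P pe D sp lt := by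
  have h₁ := aliveVol_mark hJ
  have h₂ := pendSum_mark_le (N := N) pe D J
  have h₃ : N.pendSum pe' (mark D J) ≤ N.pendSum pe D + N.vol J := by
    have : N.c * z ≤ 200 * N.c * z := by rw [mul_assoc]; omega
    omega
  have h₄ := Nat.mul_le_mul_right (N.h + 2) h₃
  unfold pot
  rw [← h₁]
  nlinarith

end Net

namespace WordRAM

open WordRAM.Expr (reg get)

variable {N : Net} {B : ℕ}

/-- The invariant of the main loop. -/
structure Inv (N : Net) (s : State) : Prop where
  static : Static N s
  core : N.Core (s.arr arrRes) (s.arr arrLab) (s.arr arrPtr) (s.arr arrSink) (s.arr arrPend)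
    (s.arr arrDead) (if s.reg regTok = 0 then 0 else Net.unit (s.reg regU))
  deadInv : N.DeadInv (s.arr arrDead)
  deadArcs : N.DeadArcs (s.arr arrRes) (s.arr arrDead)
  stackMem : ∀ v < N.n, s.arr arrDead v = 0 → 0 < s.arr arrPend v →
    ∃ i < s.reg regSp, s.arr arrStack i = v
  stackLt : ∀ i < s.reg regSp, s.arr arrStack i < N.n
  spLe : s.reg regSp + N.aliveVol (s.arr arrDead) ≤ N.n + N.M
  tok : s.reg regTok ≠ 0 → s.reg regU < N.n ∧ s.arr arrDead (s.reg regU) = 0 ∧ 0 < s.reg regSp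
  flag : (s.reg regFlag = 0 ∧ N.dead (s.arr arrDead) = ∅) ∨
    (s.reg regFlag = 1 ∧ (N.dead (s.arr arrDead)).Nonempty)

/-- The potential of a state. -/
def pot (N : Net) (s : State) : ℕ :=
  N.pot (s.arr arrLab) (s.arr arrPtr) (s.arr arrPend) (s.arr arrDead) (s.reg regSp)
    (if s.reg regTok = 0 then 0 else s.arr arrLab (s.reg regU) + 1)

/-- The labels of all vertices that are not removed are small. -/
def LabLt (N : Net) (s : State) : Prop := ∀ v < N.n, s.arr arrDead v = 0 → s.arr arrLab v < N.h

/-- Removes a ball around the vertex in `regU`. -/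
def cutOff : Cmd :=
  .store arrQueue 0 (reg regU) ;; .assign regCnt 1 ;; .store arrDead (reg regU) 1 ;;
  .assign regFlag 1 ;; .assign regTok 0 ;; count ;; grow ;; scan cancelArc

theorem wp_cutOff {t : ℕ} {s : State} (hB : N.Fits B) (hI : Inv N s) (htok : s.reg regTok ≠ 0)
    (hL : s.arr arrLab (s.reg regU) = N.h)
    (hLlt : ∀ v < N.n, v ≠ s.reg regU → s.arr arrDead v = 0 → s.arr arrLab v < N.h) :
    Wp B cutOff (fun t' s' => t' + 100 * pot N s' ≤ t + 100 * pot N s ∧ Inv N s' ∧ LabLt N s')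
      t s := by
  have hF := hB
  unfold Net.Fits at hF
  obtain ⟨hu, huD, husp⟩ := hI.tok htok
  have hcore := hI.core
  rw [if_neg htok] at hcore
  set u := s.reg regU with hudef
  set D := s.arr arrDead with hDdef
  unfold cutOff
  simp only [wp_seq, wp_assign, wp_store, ok_lit, ok_reg, val_lit, val_reg, cost_lit, cost_reg,
    true_and, setReg_reg, setArr_reg, Nat.reduceEqDiff, if_false]
  refine ⟨by omega, by omega, by omega, by omega, by omega, ?_⟩
  generalize hs₁ : State.setReg _ regTok 0 = s₁
  have hag₁ : Agree [regFlag, regCnt, regTok] [arrDead, arrQueue] s s₁ := by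
    rw [← hs₁]
    exact (((((Agree.refl _ _ s).setArr _ _ (by simp)).setReg _ (by simp)).setArr _ _
      (by simp)).setReg _ (by simp)).setReg _ (by simp)
  have hflag₁ : s₁.reg regFlag = 1 := by rw [← hs₁]; simp
  have htok₁ : s₁.reg regTok = 0 := by rw [← hs₁]; simp
  have hcnt₁ : s₁.reg regCnt = 1 := by rw [← hs₁]; simp
  have hq₁ : s₁.arr arrQueue 0 = u := by rw [← hs₁]; simp [hudef]
  have hD₁ : s₁.arr arrDead = Net.mark D {u} := by
    rw [← hs₁]
    ext v
    by_cases hv : v = u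
    · subst hv; simp [Net.mark, ← hudef]
    · simp [Net.mark, hv, ← hudef, hDdef]
  have hE₁ : Enum N {u} s₁ := ⟨by simp [hcnt₁, hq₁], by simp [hcnt₁], by simpa using hu⟩
  have hS₁ := hI.static.of_agree hag₁ (by simp) (by simp)
  clear hs₁
  refine (wp_count hB hS₁ hE₁ hD₁).mono ?_
  rintro t₂ s₂ ⟨ht₂, hag₂, hvol₂, hout₂⟩
  have hag₂' : Agree [regFlag, regI, regP, regA, regCnt, regVol, regOut, regTok, regW]
      [arrDead, arrQueue] s s₂ :=
    (hag₁.mono (by simp) (by simp)).trans hag₂ (by simp) (by simp)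
  have hS₂ := hS₁.of_agree hag₂ (by simp) (by simp)
  have hE₂ : Enum N {u} s₂ := by
    refine ⟨?_, ?_, hE₁.lt⟩
    · rw [hag₂.reg _ (by simp), hag₂.arr _ (by simp)]; exact hE₁.image
    · rw [hag₂.reg _ (by simp)]; exact hE₁.card
  have hR₁ : s₁.arr arrRes = s.arr arrRes := hag₁.arr _ (by simp)
  have hR₂ : s₂.arr arrRes = s.arr arrRes := hag₂'.arr _ (by simp)
  have hD₂ : s₂.arr arrDead = Net.mark D {u} := by rw [hag₂.arr _ (by simp), hD₁]
  rw [wp_seq]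
  refine (wp_grow (L := s.arr arrLab) (x := u) hB hS₂ hE₂ hD₂
    (Net.Ball.singleton hu huD hL) ?_ hvol₂ ?_).mono ?_
  · rw [hR₂]; exact hcore.lab
  · rw [hout₂, hR₁, hR₂]
  rintro t₃ s₃ ⟨J, ht₃, hag₃, hE₃, hD₃, hball, hz⟩
  rw [hR₂] at hz
  have hag₃' : Agree [regFlag, regI, regP, regA, regCnt, regSz, regVol, regOut, regTok, regW]
      [arrDead, arrQueue] s s₃ :=
    (hag₂'.mono (by simp) (by simp)).trans hag₃ (by simp) (by simp)
  have hS₃ := hI.static.of_agree hag₃' (by simp) (by simp)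
  have hR₃ : s₃.arr arrRes = s.arr arrRes := hag₃'.arr _ (by simp)
  have hp₃ : s₃.arr arrPend = s.arr arrPend := hag₃'.arr _ (by simp)
  have hk₃ : s₃.arr arrStack = s.arr arrStack := hag₃'.arr _ (by simp)
  have hsp₃ : s₃.reg regSp = s.reg regSp := hag₃'.reg _ (by simp)
  have hspLe : s.reg regSp + N.aliveVol D ≤ N.n + N.M := hI.spLe
  refine (wp_cancel (L := s.arr arrLab) (P := s.arr arrPtr) (W := s.arr arrSink) hB hS₃ hE₃ hD₃
    (by omega) ?_).mono ?_
  · rw [hR₃, hp₃, hk₃, hsp₃]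
    refine ⟨empty_subset _, hcore.mark hball.mem, fun _ _ _ _ => rfl, by simp, fun a ha h₁ h₂ => ?_,
      by simp, by simp, fun v hv h₁ h₂ => ?_, hI.stackLt⟩
    · exact hI.deadArcs a ha (Net.mark_eq_zero.1 h₁).2 h₂
    · exact hI.stackMem v hv (Net.mark_eq_zero.1 h₁).2 h₂
  rintro t₄ s₄ ⟨ht₄, hag₄, hC⟩
  rw [hR₃, hp₃, hsp₃] at hC
  have hag₄' : Agree [regFlag, regI, regP, regA, regCnt, regSz, regVol, regOut, regSp, regTok, regW]
      [arrPend, arrRes, arrDead, arrStack, arrQueue] s s₄ :=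
    (hag₃'.mono (by simp) (by simp)).trans hag₄ (by simp) (by simp)
  have hD₄ : s₄.arr arrDead = Net.mark D J := by rw [hag₄.arr _ (by simp), hD₃]
  have hL₄ : s₄.arr arrLab = s.arr arrLab := hag₄'.arr _ (by simp)
  have hP₄ : s₄.arr arrPtr = s.arr arrPtr := hag₄'.arr _ (by simp)
  have hW₄ : s₄.arr arrSink = s.arr arrSink := hag₄'.arr _ (by simp)
  have hflag₄ : s₄.reg regFlag = 1 := by
    rw [hag₄.reg _ (by simp), hag₃.reg _ (by simp), hag₂.reg _ (by simp), hflag₁]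
  have htok₄ : s₄.reg regTok = 0 := by
    rw [hag₄.reg _ (by simp), hag₃.reg _ (by simp), hag₂.reg _ (by simp), htok₁]
  have hvolJ : N.vol {u} ≤ N.vol J := Net.vol_mono (by simpa using hball.mem)
  have hvol1 : 0 < N.vol J := by
    refine lt_of_lt_of_le ?_ hvolJ
    rw [Net.vol_eq_sum, sum_singleton]; exact Net.cnt_pos hu
  refine ⟨?_, ⟨hI.static.of_agree hag₄' (by simp) (by simp), ?_, ?_, ?_, ?_, hC.stackLt, ?_, ?_, ?_⟩,
    ?_⟩
  -- At 100 steps per unit of potential, `100·(400c + 7)` per unit of volume covers the `150·200c`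
  -- for growing the ball and the linear cost of counting and cancelling.
  · have hpot := Net.pot_cut (L := s.arr arrLab) (P := s.arr arrPtr) (sp := s.reg regSp)
      (lt := s.arr arrLab u + 1) hball.alive hC.pend hz hC.spLe
    unfold pot
    rw [htok₄, if_pos rfl, if_neg htok, hD₄, hL₄, hP₄]
    have hc := N.one_lt_c
    nlinarith
  · rw [hD₄, hL₄, hP₄, hW₄, htok₄, if_pos rfl]; exact hC.core
  · rw [hD₄]; exact hball.deadInv hcore hI.deadInv hz
  · rw [hD₄]; exact hC.deadArcs
  · rw [hD₄]; exact hC.stackMem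
  · have h₁ := Net.aliveVol_mark (N := N) hball.alive
    have h₂ := hC.spLe
    rw [hD₄]
    change _ + N.vol J = N.aliveVol D at h₁
    change _ ≤ _ + N.vol J at h₂
    omega
  · exact fun h => absurd htok₄ h
  · refine Or.inr ⟨hflag₄, u, ?_⟩
    rw [Net.mem_dead, hD₄]
    exact ⟨hu, fun h => (Net.mark_eq_zero.1 h).1 hball.mem⟩
  · intro v hv hDv
    rw [hD₄, Net.mark_eq_zero] at hDv
    rw [hL₄]
    exact hLlt v hv (by rintro rfl; exact hDv.1 hball.mem) hDv.2

end WordRAM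

/-! ### The main loop -/

namespace WordRAM

open WordRAM.Expr (reg get)

variable {N : Net} {B : ℕ}

/-- Pushes one unit along the arc in `regA`. -/
def pushArc : Cmd :=
  .store arrRes (reg regA) (get arrRes (reg regA) - 1) ;;
  .store arrRes (get arrRv (reg regA)) (get arrRes (get arrRv (reg regA)) + 1)

theorem wp_pushArc {Q : ℕ → State → Prop} {t a : ℕ} {s : State} (hB : N.Fits B) (hS : Static N s)
    (ha : a < N.M) (hra : s.reg regA = a)
    (hres : ∀ a < N.M, s.arr arrRes a + s.arr arrRes (N.rv a) = 2 * N.c)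
    (hp : 0 < s.arr arrRes a)
    (hQ : ∀ s', Agree [] [arrRes] s s' → s'.arr arrRes = N.pushed (s.arr arrRes) a →
      Q (t + 14) s') : Wp B pushArc Q t s := by
  have hF := hB
  unfold Net.Fits at hF
  have hmul : 200 * N.c * 2 ≤ 200 * N.c * (N.M + 2) := Nat.mul_le_mul_left _ (by omega)
  have hr := hres a ha
  have hne := N.rv_ne a ha
  simp only [pushArc, wp_seq, wp_store, ok_add, ok_sub, val_sub, cost_sub, ok_reg, ok_lit, ok_get,
    val_add, val_reg, val_lit, val_get, cost_add, cost_reg, cost_lit, cost_get, setArr_arr,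
    setArr_reg, hra, hS.rv, Nat.reduceEqDiff, if_true, if_false, true_and, update_of_ne hne]
  refine ⟨⟨by omega, by omega⟩, ⟨by omega, by omega⟩, ?_⟩
  refine hQ _ (((Agree.refl _ _ s).setArr _ _ (by simp)).setArr _ _ (by simp)) ?_
  simp [Net.pushed]

/-- Moves the token from a vertex with current arc `0`, or pushes it, or advances the arc. -/
def stepToken : Cmd :=
  .ite ((get arrSink (reg regU)).eq 1)
    (.store arrSink (reg regU) 2 ;; .assign regTok 0)
    (.assign regP (get arrPtr (reg regU)) ;;
      .ite (reg regP)
        (.assign regA (reg regP - 1) ;; loadHead ;;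
          .ite (isAlive * Expr.lt 0 (get arrRes (reg regA))
              * (get arrLab (reg regW)).lt (get arrLab (reg regU)))
            (pushArc ;; .assign regU (reg regW))
            (.store arrPtr (reg regU) (get arrNx (reg regA))))
        (.store arrLab (reg regU) (get arrLab (reg regU) + 1) ;;
          .store arrPtr (reg regU) (get arrHd (reg regU)) ;;
          .ite ((get arrLab (reg regU)).lt (reg regH)) .skip cutOff))

/-- Puts a token on the top vertex of the stack if mass is pending there, otherwise pops it. -/
def popStack : Cmd :=
  .assign regU (get arrStack (reg regSp - 1)) ;;
  .ite (Expr.lt 0 (get arrPend (reg regU)) * (get arrDead (reg regU)).lt 1)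
    (.store arrPend (reg regU) (get arrPend (reg regU) - 1) ;; .assign regTok 1)
    (.assign regSp (reg regSp - 1))

def mainLoop : Cmd := .while (reg regSp) (.ite (reg regTok) stepToken popStack)

theorem wp_popStack {t : ℕ} {s : State} (hB : N.Fits B) (hI : Inv N s) (hL : LabLt N s)
    (hsp : s.reg regSp ≠ 0) (htok : s.reg regTok = 0) :
    Wp B popStack (fun t' s' => t' + 100 * pot N s' + 50 ≤ t + 100 * pot N s ∧ Inv N s' ∧
      LabLt N s') t s := by
  have hF := hB
  unfold Net.Fits at hF
  have hspLe := hI.spLe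
  have halive : N.aliveVol (s.arr arrDead) ≤ N.M := Net.vol_le _
  have hn := N.n_le
  obtain ⟨p, hp⟩ := Nat.exists_eq_succ_of_ne_zero hsp
  have hu := hI.stackLt p (by omega)
  have hcore := hI.core
  rw [if_pos htok] at hcore
  have hmul : N.c * N.M ≤ 200 * N.c * (N.M + 2) := Nat.mul_le_mul (by omega) (by omega)
  set u := s.arr arrStack p with hudef
  simp only [popStack, wp_seq, wp_assign, wp_store, wp_ite, ok_sub, val_sub, cost_sub,
    ok_reg, ok_lit, ok_get, ok_mul, ok_lt, val_reg, val_lit, val_get, val_mul, val_lt,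
    cost_reg, cost_lit, cost_get, cost_mul, cost_lt, setReg_reg, setReg_arr,
    Nat.reduceEqDiff, if_true, if_false, true_and, Nat.lt_one_iff, hp,
    Nat.succ_eq_add_one, Nat.add_sub_cancel, ← hudef,
    ite_one_zero_lt_iff (show 1 < B by omega), and_true, mul_ite, mul_one, mul_zero]
  refine ⟨⟨by omega, by omega⟩, ⟨by omega, by omega, by split_ifs <;> omega⟩, fun hc => ?_,
    fun hc => ?_⟩
  · have hc' : s.arr arrDead u = 0 ∧ 0 < s.arr arrPend u := by
      by_contra h'
      apply hc
      split_ifs <;> tauto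
    have hpe := hcore.pe_le hu hc'.1 le_rfl
    have hpot := Net.pot_inject (P := s.arr arrPtr) (sp := s.reg regSp) hu hc'.1 hc'.2
      (hL u hu hc'.1)
    refine ⟨by omega, by omega, ?_, ⟨?_, ?_, ?_, ?_, ?_, ?_, ?_, ?_, ?_⟩, ?_⟩
    · simp only [pot, setReg_reg, setReg_arr, setArr_reg, setArr_arr, Nat.reduceEqDiff, if_true,
        if_false, htok]
      omega
    · exact hI.static.of_agree (rs := [regU, regTok]) (as := [arrPend])
        ((((Agree.refl _ _ s).setReg _ (by simp)).setArr _ _ (by simp)).setReg _ (by simp))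
        (by simp) (by simp)
    · simpa using hcore.inject hc'.2
    · simpa using hI.deadInv
    · simpa using hI.deadArcs
    · intro v hv hD hp
      simp only [setReg_reg, setReg_arr, setArr_reg, setArr_arr, Nat.reduceEqDiff, if_true,
        if_false] at hD hp ⊢
      refine hI.stackMem v hv hD ?_
      rw [update_apply] at hp
      split_ifs at hp with h
      · rw [h]; omega
      · exact hp
    · simpa using hI.stackLt
    · simpa using hI.spLe
    · intro _
      simpa using ⟨hu, hc'.1, by omega⟩
    · simpa using hI.flag
    · simpa [LabLt] using hL
  · have hc' : s.arr arrDead u = 0 → s.arr arrPend u = 0 := by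
      intro h'
      by_contra h''
      rw [if_pos h', if_pos (by omega)] at hc
      exact one_ne_zero hc
    refine ⟨⟨by omega, by omega⟩, ?_, ⟨?_, ?_, ?_, ?_, ?_, ?_, ?_, ?_, ?_⟩, ?_⟩
    · simp only [pot, Net.pot, setReg_reg, setReg_arr, Nat.reduceEqDiff, if_true,
        if_false, htok, hp]
      omega
    · exact hI.static.of_agree (rs := [regU, regSp]) (as := [])
        (((Agree.refl _ _ s).setReg _ (by simp)).setReg _ (by simp)) (by simp) (by simp)
    · simpa [htok] using hcore
    · simpa using hI.deadInv
    · simpa using hI.deadArcs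
    -- Only the top entry is lost, and it is either removed or has no pending mass.
    · intro v hv hD hpv
      simp only [setReg_reg, setReg_arr, Nat.reduceEqDiff, if_true, if_false] at hD hpv ⊢
      obtain ⟨i, hi, h⟩ := hI.stackMem v hv hD hpv
      refine ⟨i, ?_, h⟩
      by_contra h'
      have : i = p := by omega
      rw [this, ← hudef] at h
      rw [h] at hc'
      have := hc' hD
      omega
    · intro i hi
      simp only [setReg_reg, setReg_arr, Nat.reduceEqDiff, if_true] at hi ⊢
      exact hI.stackLt i (by omega)
    · simp only [setReg_reg, setReg_arr, Nat.reduceEqDiff, if_true]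
      omega
    · intro h
      simp [htok] at h
    · simpa using hI.flag
    · simpa [LabLt] using hL

/-- Each branch lowers the potential: absorption removes the label term of the token, a push lowers
it by one, an advance shortens the list of the current arc, and relabelling and cutting are paid for
by `pot_relabel` and `wp_cutOff`. -/
theorem wp_stepToken {t : ℕ} {s : State} (hB : N.Fits B) (hI : Inv N s) (hL : LabLt N s)
    (htok : s.reg regTok ≠ 0) :
    Wp B stepToken (fun t' s' => t' + 100 * pot N s' + 20 ≤ t + 100 * pot N s ∧ Inv N s' ∧
      LabLt N s') t s := by
  have hF := hB
  unfold Net.Fits at hF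
  obtain ⟨hu, huD, husp⟩ := hI.tok htok
  have hcore := hI.core
  have hS := hI.static
  rw [if_neg htok] at hcore
  set u := s.reg regU with hudef
  have hLu := hL u hu huD
  have hptrle := hcore.ptrLe u hu
  unfold stepToken
  rw [wp_ite]
  simp only [ok_eq, ok_get, ok_reg, ok_lit, val_eq, val_get, val_reg, val_lit, cost_eq, cost_get,
    cost_reg, cost_lit, ite_one_zero_lt_iff (show 1 < B by omega), and_true, true_and, ← hudef]
  refine ⟨by omega, fun hW => ?_, fun hW => ?_⟩
  · have hW : s.arr arrSink u = 1 := by by_contra h; simp [h] at hW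
    simp only [wp_seq, wp_assign, wp_store, ok_reg, ok_lit, val_reg, val_lit, cost_reg, cost_lit,
      ← hudef, true_and]
    refine ⟨by omega, by omega, ?_, ⟨?_, ?_, ?_, ?_, ?_, ?_, ?_, ?_, ?_⟩, ?_⟩
    · simp only [pot, Net.pot, setReg_reg, setReg_arr, setArr_arr, setArr_reg, Nat.reduceEqDiff,
        if_true, if_false, htok, ← hudef]
      omega
    · exact hI.static.of_agree (rs := [regTok]) (as := [arrSink])
        (((Agree.refl _ _ s).setArr _ _ (by simp)).setReg _ (by simp)) (by simp) (by simp)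
    · simpa using hcore.absorb hW
    · simpa using hI.deadInv
    · simpa using hI.deadArcs
    · simpa using hI.stackMem
    · simpa using hI.stackLt
    · simpa using hI.spLe
    · simp
    · simpa using hI.flag
    · simpa [LabLt] using hL
  have hW : s.arr arrSink u ≠ 1 := by intro h; simp [h] at hW
  rw [wp_seq, wp_assign]
  simp only [ok_get, ok_reg, val_get, val_reg, cost_get, cost_reg, true_and, ← hudef]
  rw [wp_ite]
  simp only [ok_reg, val_reg, setReg_reg, if_true, true_and, cost_reg]
  refine ⟨fun hP => ?_, fun hP => ?_⟩
  · obtain ⟨a, hPa⟩ := Nat.exists_eq_succ_of_ne_zero hP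
    have hau : N.tl a = u := by simpa [hPa] using hcore.ptrTail u hu
    have haM : a < N.M := by omega
    have hda : N.tl (N.rv a) = N.dst a := rfl
    simp only [loadHead, isAlive, wp_seq, wp_assign, ok_sub, val_sub, cost_sub,
      ok_reg, ok_lit, ok_get, val_reg, val_lit, val_get,
      cost_reg, cost_lit, cost_get, setReg_reg, setReg_arr,
      Nat.reduceEqDiff, if_true, if_false, true_and, hPa,
      Nat.succ_eq_add_one, Nat.add_sub_cancel, hS.tl, hS.rv, hda]
    refine ⟨⟨by omega, by omega⟩, ?_⟩
    generalize hs₁ : State.setReg _ regW (N.dst a) = s₁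
    have hag₁ : Agree [regP, regA, regW] [] s s₁ := by
      rw [← hs₁]
      exact (((Agree.refl _ _ s).setReg _ (by simp)).setReg _ (by simp)).setReg _ (by simp)
    have hS₁ := hS.of_agree hag₁ (by simp) (by simp)
    have hra : s₁.reg regA = a := by rw [← hs₁]; simp
    have hrw : s₁.reg regW = N.dst a := by rw [← hs₁]; simp
    have hru : s₁.reg regU = u := by rw [← hs₁]; simp [hudef]
    have harr : s₁.arr = s.arr := by rw [← hs₁]; rfl
    clear hs₁
    have hlab : s.arr arrLab u < B := by omega
    rw [wp_ite]
    simp only [ok_reg, ok_lit, ok_get, ok_mul, ok_lt, val_reg, val_lit,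
      val_get, val_mul, val_lt, cost_reg, cost_lit, cost_get, cost_mul, cost_lt,
      hra, hrw, hru, harr, true_and, Nat.lt_one_iff,
      ite_one_zero_lt_iff (show 1 < B by omega), and_true, mul_ite, mul_one, mul_zero]
    by_cases hadm : s.arr arrDead (N.dst a) = 0 ∧ 0 < s.arr arrRes a ∧
        s.arr arrLab (N.dst a) < s.arr arrLab u
    · obtain ⟨h₁, h₂, h₄⟩ := hadm
      -- Validity of the labels turns strict descent along a residual arc into a drop of exactly
      -- one.
      have h₃ : s.arr arrLab u = s.arr arrLab (N.dst a) + 1 := by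
        have := hcore.lab a haM (by rw [hau]; exact huD) h₁ h₂
        rw [hau] at this
        omega
      rw [if_pos h₂, if_pos h₁, if_pos h₄]
      refine ⟨by omega, fun _ => ?_, fun h => absurd h one_ne_zero⟩
      rw [wp_seq]
      refine wp_pushArc hB hS₁ haM hra (by rw [harr]; exact hcore.res) (by rw [harr]; exact h₂) ?_
      intro s₂ hag₂ hR₂
      rw [wp_assign]
      have hag := (hag₁.mono (rs := [regP, regA, regW, regU]) (as := [arrRes]) (by simp)
        (by simp)).trans hag₂ (by simp) (by simp)
      have hrw₂ : s₂.reg regW = N.dst a := by rw [hag₂.reg _ (by simp), hrw]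
      have hL₂ : s₂.arr arrLab = s.arr arrLab := hag.arr _ (by simp)
      have hP₂ : s₂.arr arrPtr = s.arr arrPtr := hag.arr _ (by simp)
      have hp₂ : s₂.arr arrPend = s.arr arrPend := hag.arr _ (by simp)
      have hD₂ : s₂.arr arrDead = s.arr arrDead := hag.arr _ (by simp)
      have hk₂ : s₂.arr arrStack = s.arr arrStack := hag.arr _ (by simp)
      have hW₂ : s₂.arr arrSink = s.arr arrSink := hag.arr _ (by simp)
      have hsp₂ : s₂.reg regSp = s.reg regSp := hag.reg _ (by simp)
      have htok₂ : s₂.reg regTok = s.reg regTok := hag.reg _ (by simp)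
      have hflag₂ : s₂.reg regFlag = s.reg regFlag := hag.reg _ (by simp)
      rw [harr] at hR₂
      rw [← hau] at hcore h₃
      simp only [ok_reg, val_reg, cost_reg, true_and, hrw₂]
      refine ⟨?_, ⟨hI.static.of_agree (hag.setReg _ (by simp)) (by simp) (by simp), ?_, ?_, ?_, ?_,
        ?_, ?_, ?_, ?_⟩, ?_⟩
      · simp only [pot, Net.pot, setReg_reg, setReg_arr, Nat.reduceEqDiff, if_true,
          if_false, htok, htok₂, hL₂, hP₂, hp₂, hD₂, hsp₂, ← hudef, ← hau, h₃]
        omega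
      · simpa [hR₂, hL₂, hP₂, hW₂, hp₂, hD₂, htok₂, htok] using hcore.push haM h₂ h₃
      · simpa [hD₂] using hI.deadInv
      · intro b hb h₄ h₅
        simp only [setReg_arr, hD₂, hR₂] at h₄ h₅ ⊢
        have h₆ := hI.deadArcs b hb h₄ h₅
        rw [Net.pushed_apply haM]
        split_ifs with h h
        · subst h; exact absurd h₁ h₅
        · subst h; rw [N.dst_rv haM, hau] at h₅; exact absurd huD h₅
        · exact h₆
      · simpa [hD₂, hp₂, hk₂, hsp₂] using hI.stackMem
      · simpa [hk₂, hsp₂] using hI.stackLt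
      · simpa [hD₂, hsp₂] using hI.spLe
      · intro _
        simpa [hD₂, hsp₂] using ⟨N.dst_lt haM, h₁, husp⟩
      · simpa [hD₂, hflag₂] using hI.flag
      · simpa [LabLt, hD₂, hL₂] using hL
    · have hval : (if s.arr arrLab (N.dst a) < s.arr arrLab u then
          (if 0 < s.arr arrRes a then (if s.arr arrDead (N.dst a) = 0 then 1 else 0) else 0)
          else 0) = 0 := by
        split_ifs <;> first | rfl | (exfalso; apply hadm; refine ⟨?_, ?_, ?_⟩ <;> omega)
      rw [hval]
      refine ⟨⟨⟨by omega, by omega, by split_ifs <;> omega⟩, by omega⟩, fun h => absurd rfl h,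
        fun _ => ?_⟩
      have hag := hag₁.mono (rs := [regP, regA, regW]) (as := [arrPtr]) (by simp) (by simp)
      have hsp₁ : s₁.reg regSp = s.reg regSp := hag.reg _ (by simp)
      have htok₁ : s₁.reg regTok = s.reg regTok := hag.reg _ (by simp)
      have hflag₁ : s₁.reg regFlag = s.reg regFlag := hag.reg _ (by simp)
      have hpot := Net.pot_advance (L := s.arr arrLab) (P := s.arr arrPtr) (pe := s.arr arrPend) (D := s.arr arrDead)
        (sp := s.reg regSp) (lt := s.arr arrLab u + 1) haM (by rw [hau, hPa])
      rw [hau] at hpot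
      have hadv := hcore.advance haM (by rw [hau, hPa]) (fun h₁ h₂ h₃ =>
        hadm ⟨h₁, h₂, by rw [← hau, h₃]; omega⟩)
      rw [hau] at hadv
      simp only [wp_store, ok_reg, ok_get, val_reg, val_get, cost_reg, cost_get, hru, hra, hS₁.nx,
        true_and]
      refine ⟨?_, ⟨hI.static.of_agree (hag.setArr _ _ (by simp)) (by simp) (by simp), ?_, ?_, ?_, ?_,
        ?_, ?_, ?_, ?_⟩, ?_⟩
      · simp only [pot, setArr_reg, setArr_arr, Nat.reduceEqDiff, if_true, if_false, htok, htok₁,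
          harr, hsp₁, hru, ← hudef]
        omega
      · simpa [harr, htok₁, htok, hru] using hadv
      · simpa [harr] using hI.deadInv
      · simpa [harr] using hI.deadArcs
      · simpa [harr, hsp₁] using hI.stackMem
      · simpa [harr, hsp₁] using hI.stackLt
      · simpa [harr, hsp₁] using hI.spLe
      · intro _
        simpa [harr, hsp₁, hru] using ⟨hu, huD, husp⟩
      · simpa [harr, hflag₁] using hI.flag
      · simpa [LabLt, harr] using hL
  · have hrelabel := hcore.relabel hu hP hW
    have hpot := Net.pot_relabel (pe := s.arr arrPend) (D := s.arr arrDead)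
        (sp := s.reg regSp) (lt := s.arr arrLab u + 1) hu hLu hP
    simp only [wp_seq, wp_store, ok_add, ok_reg, ok_lit, ok_get, val_add, val_reg, val_lit,
      val_get, cost_add, cost_reg, cost_lit, cost_get, setReg_reg, setReg_arr, setArr_reg,
      setArr_arr, Nat.reduceEqDiff, if_false, true_and, ← hudef, hS.hd]
    refine ⟨⟨by omega, by omega⟩, ?_⟩
    generalize hs₁ : State.setArr _ arrPtr u (N.hd u) = s₁
    have hag₁ : Agree [regP] [arrLab, arrPtr] s s₁ := by
      rw [← hs₁]
      exact (((Agree.refl _ _ s).setReg _ (by simp)).setArr _ _ (by simp)).setArr _ _ (by simp)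
    have hS₁ := hS.of_agree hag₁ (by simp) (by simp)
    have hL₁ : s₁.arr arrLab = update (s.arr arrLab) u (s.arr arrLab u + 1) := by
      rw [← hs₁]; simp
    have hP₁ : s₁.arr arrPtr = update (s.arr arrPtr) u (N.hd u) := by
      rw [← hs₁]; simp
    clear hs₁
    have hR₁ : s₁.arr arrRes = s.arr arrRes := hag₁.arr _ (by simp)
    have hp₁ : s₁.arr arrPend = s.arr arrPend := hag₁.arr _ (by simp)
    have hD₁ : s₁.arr arrDead = s.arr arrDead := hag₁.arr _ (by simp)
    have hk₁ : s₁.arr arrStack = s.arr arrStack := hag₁.arr _ (by simp)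
    have hW₁ : s₁.arr arrSink = s.arr arrSink := hag₁.arr _ (by simp)
    have hsp₁ : s₁.reg regSp = s.reg regSp := hag₁.reg _ (by simp)
    have hu₁ : s₁.reg regU = u := hag₁.reg _ (by simp)
    have htok₁ : s₁.reg regTok = s.reg regTok := hag₁.reg _ (by simp)
    have hflag₁ : s₁.reg regFlag = s.reg regFlag := hag₁.reg _ (by simp)
    have hLu₁ : s₁.arr arrLab u = s.arr arrLab u + 1 := by rw [hL₁, update_self]
    have hLv₁ : ∀ v < N.n, v ≠ u → s₁.arr arrDead v = 0 → s₁.arr arrLab v < N.h :=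
      fun v hv hvu hDv => by
        rw [hL₁, update_of_ne hvu]
        exact hL v hv (by rwa [← hD₁])
    have hpot₁ : pot N s₁ + 1 ≤ pot N s := by
      unfold pot
      rw [hL₁, hP₁, hp₁, hD₁, hsp₁, htok₁, hu₁, if_neg htok, if_neg htok, update_self, ← hudef]
      exact hpot
    have hI₁ : Inv N s₁ := by
      refine ⟨hS₁, ?_, ?_, ?_, ?_, ?_, ?_, ?_, ?_⟩
      · rw [hL₁, hP₁, hp₁, hD₁, htok₁, hu₁, if_neg htok, hR₁, hW₁]; exact hrelabel
      · rw [hD₁]; exact hI.deadInv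
      · rw [hD₁, hR₁]; exact hI.deadArcs
      · rw [hD₁, hp₁, hk₁, hsp₁]; exact hI.stackMem
      · rw [hk₁, hsp₁]; exact hI.stackLt
      · rw [hD₁, hsp₁]; exact hI.spLe
      · rw [hD₁, hsp₁, hu₁]; exact fun _ => ⟨hu, huD, husp⟩
      · rw [hD₁, hflag₁]; exact hI.flag
    rw [wp_ite]
    simp only [ok_reg, ok_lt, ok_get, val_lt, val_reg, val_get, cost_lt, cost_reg, cost_get, hu₁,
      hS₁.h, ite_one_zero_lt_iff (show 1 < B by omega), true_and, hLu₁]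
    refine ⟨fun h => ?_, fun h => ?_⟩
    · have hlt : s.arr arrLab u + 1 < N.h := by by_contra h'; simp [h'] at h
      rw [wp_skip]
      refine ⟨by omega, hI₁, fun v hv hDv => ?_⟩
      by_cases hvu : v = u
      · rw [hvu, hLu₁]; exact hlt
      · exact hLv₁ v hv hvu hDv
    · have hlt : ¬ s.arr arrLab u + 1 < N.h := by intro h'; simp [h'] at h
      refine (wp_cutOff hB hI₁ (by rw [htok₁]; exact htok) ?_ ?_).mono ?_
      · rw [hu₁, hLu₁]; omega
      · rw [hu₁]; exact hLv₁
      · rintro t' s' ⟨ht, hI', hL'⟩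
        exact ⟨by omega, hI', hL'⟩

theorem wp_mainLoop {t : ℕ} {s : State} (hB : N.Fits B) (hI : Inv N s) (hL : LabLt N s) :
    Wp B mainLoop (fun t' s' => t' ≤ t + 100 * pot N s + 2 ∧ Inv N s' ∧ s'.reg regSp = 0) t s := by
  refine wp_while (t + 100 * pot N s) (fun t' s' => t' + 100 * pot N s' ≤ t + 100 * pot N s ∧
    Inv N s' ∧ LabLt N s') ?_ ?_ ⟨le_rfl, hI, hL⟩
  · rintro t' s' ⟨h, -⟩; omega
  · rintro t' s' ⟨ht, hI, hL⟩
    refine ⟨trivial, fun h => ?_, fun h => ?_⟩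
    · rw [wp_ite]
      simp only [cost_reg, ok_reg, val_reg, true_and] at h ⊢
      refine ⟨fun h' => ?_, fun h' => ?_⟩
      · refine (wp_stepToken hB hI hL h').mono ?_
        rintro t₁ s₁ ⟨h₁, h₂⟩
        exact ⟨by omega, h₂⟩
      · refine (wp_popStack hB hI hL h h').mono ?_
        rintro t₁ s₁ ⟨h₁, h₂⟩
        exact ⟨by omega, h₂⟩
    · simp only [cost_reg, val_reg] at h ⊢
      exact ⟨by omega, hI, h⟩

end WordRAM

/-! ### Cancelling the mass from removed vertices, and the output -/

namespace WordRAM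

open WordRAM.Expr (reg get)

variable {N : Net} {B : ℕ}

/-- Resets the current arcs, fills the stack with all vertices and puts all vertices into the
cut. -/
def resetPtrs : Cmd :=
  .assign regI 0 ;;
  .while ((reg regI).lt (reg regN))
    (.store arrPtr (reg regI) (get arrHd (reg regI)) ;; .store arrStack (reg regI) (reg regI) ;;
      .store arrCut (reg regI) 1 ;; .assign regI (reg regI + 1))

/-- Serves twice: in the setup, where the stack has to contain every possible source, and after the
main loop, where the current arcs restart because they then search for positive flow instead of
admissible arcs. -/
theorem wp_resetPtrs {n t : ℕ} {s : State} (hB : n + 2 ≤ B) (hn : s.reg regN = n) :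
    Wp B resetPtrs (fun t' s' => t' ≤ t + 30 * n + 10 ∧
      Agree [regI] [arrPtr, arrStack, arrCut] s s' ∧
      ∀ v < n, s'.arr arrPtr v = s.arr arrHd v ∧ s'.arr arrStack v = v ∧ s'.arr arrCut v = 1)
      t s := by
  unfold resetPtrs
  simp only [wp_seq, wp_assign, ok_lit, val_lit, cost_lit]
  refine ⟨by omega, ?_⟩
  refine wp_while (t + 30 * n + 10) (fun t' s' => ∃ i, s'.reg regI = i ∧ i ≤ n ∧
    t' ≤ t + 30 * i + 3 ∧ Agree [regI] [arrPtr, arrStack, arrCut] s s' ∧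
      ∀ v < i, s'.arr arrPtr v = s.arr arrHd v ∧ s'.arr arrStack v = v ∧ s'.arr arrCut v = 1)
    ?_ ?_ ?_
  · rintro t' s' ⟨i, -, hi, ht, -⟩; omega
  · rintro t' s' ⟨i, hi, hin, ht, hag, h⟩
    have hn' : s'.reg regN = n := by rw [hag.reg _ (by simp), hn]
    have hhd : s'.arr arrHd = s.arr arrHd := hag.arr _ (by simp)
    simp only [wp_seq, wp_assign, wp_store, ok_lit, ok_reg, ok_get, ok_add, ok_lt, val_lit, val_reg,
      val_get, val_add, val_lt, cost_lit, cost_reg, cost_get, cost_add, cost_lt, setArr_reg,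
      true_and, hi, hn', hhd,
      ite_one_zero_lt_iff (show 1 < B by omega)]
    refine ⟨fun h' => ?_, fun h' => ?_⟩
    · have hlt : i < n := by by_contra h; simp [h] at h'
      refine ⟨by omega, ⟨by omega, by omega⟩, i + 1, by simp, hlt, by omega,
        (((hag.setArr _ _ (by simp)).setArr _ _ (by simp)).setArr _ _ (by simp)).setReg _ (by simp),
        fun v hv => ?_⟩
      simp only [setReg_arr, setArr_arr, Nat.reduceEqDiff, if_true, if_false]
      by_cases hvi : v = i
      · subst hvi; simp
      · simp only [update_of_ne hvi]; exact h v (by omega)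
    · have hge : i = n := by
        by_contra h; rw [if_pos (by omega)] at h'; omega
      subst hge
      exact ⟨by omega, hag, h⟩
  · exact ⟨0, by simp, by omega, by omega, (Agree.refl _ _ s).setReg _ (by simp), by simp⟩

/-- Moves the missing unit backwards along the flow. -/
def stepDeficit : Cmd :=
  .ite ((get arrSink (reg regU)).eq 2)
    (.store arrSink (reg regU) 1 ;; .assign regTok 0)
    (.assign regA (get arrPtr (reg regU) - 1) ;;
      .ite ((get arrRes (reg regA)).lt (reg regC))
        (loadHead ;; .assign regA (get arrRv (reg regA)) ;; pushArc ;; .assign regU (reg regW))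
        (.store arrPtr (reg regU) (get arrNx (reg regA))))

/-- Cancels one unit of flow from a removed vertex, or goes to the next arc. -/
def startDeficit : Cmd :=
  .assign regA (reg regI) ;; loadHead ;;
  .ite (Expr.lt 0 (get arrDead (reg regW)) * (reg regC).lt (get arrRes (reg regA))
      * (get arrDead (get arrTl (reg regA))).lt 1)
    (pushArc ;; .assign regU (get arrTl (reg regA)) ;; .assign regTok 1)
    (.assign regI (reg regI + 1))

def cancelExternal : Cmd :=
  .assign regI 0 ;; .while ((reg regI).lt (reg regM)) (.ite (reg regTok) stepDeficit startDeficit)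

/-- The invariant of `cancelExternal`. -/
structure ExtInv (N : Net) (s₀ s : State) : Prop where
  agree : Agree [regI, regA, regTok, regU, regW] [arrSink, arrRes, arrPtr] s₀ s
  ext : N.Ext (s.arr arrRes) (s.arr arrPtr) (s.arr arrSink) (s.arr arrDead)
    (if s.reg regTok = 0 then 0 else Net.unit (s.reg regU))
  tok : s.reg regTok ≠ 0 → s.reg regU < N.n ∧ s.arr arrDead (s.reg regU) = 0 ∧ s.reg regI < N.M
  le : s.reg regI ≤ N.M
  done : ∀ a < s.reg regI, s.arr arrDead (N.tl a) = 0 → s.arr arrDead (N.dst a) ≠ 0 →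
    s.arr arrRes a ≤ N.c

/-- The potential that pays for `cancelExternal`. -/
def extPot (N : Net) (s : State) : ℕ :=
  2 * N.flowSum (s.arr arrRes) + ∑ v ∈ range N.n, N.cnt v (s.arr arrPtr v)
    + (N.M - s.reg regI) + if s.reg regTok = 0 then 0 else 1

theorem wp_stepDeficit {t : ℕ} {s₀ s : State} (hB : N.Fits B) (hS : Static N s₀)
    (hI : ExtInv N s₀ s) (htok : s.reg regTok ≠ 0) :
    Wp B stepDeficit (fun t' s' => t' + 100 * extPot N s' + 20 ≤ t + 100 * extPot N s ∧
      ExtInv N s₀ s') t s := by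
  have hF := hB
  unfold Net.Fits at hF
  have hS := hS.of_agree hI.agree (by simp) (by simp)
  obtain ⟨hu, huD, hiM⟩ := hI.tok htok
  have hext := hI.ext
  rw [if_neg htok] at hext
  set u := s.reg regU with hudef
  have hptrle := hext.ptrLe u hu
  unfold stepDeficit
  rw [wp_ite]
  simp only [ok_eq, ok_get, ok_reg, ok_lit, val_eq, val_get, val_reg, val_lit, cost_eq, cost_get,
    cost_reg, cost_lit, ite_one_zero_lt_iff (show 1 < B by omega), and_true, true_and, ← hudef]
  refine ⟨by omega, fun hW => ?_, fun hW => ?_⟩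
  · have hW : s.arr arrSink u = 2 := by by_contra h; simp [h] at hW
    simp only [wp_seq, wp_assign, wp_store, ok_reg, ok_lit, val_reg, val_lit, cost_reg, cost_lit,
      ← hudef, true_and]
    refine ⟨by omega, by omega, ?_,
      ⟨(hI.agree.setArr _ _ (by simp)).setReg _ (by simp), ?_, ?_, ?_, ?_⟩⟩
    · simp only [extPot, setReg_reg, setReg_arr, setArr_arr, setArr_reg, Nat.reduceEqDiff,
        if_true, if_false, htok]
      omega
    · simpa using hext.unsink hW
    · simp
    · simpa using hI.le
    · simpa using hI.done
  have hW : s.arr arrSink u ≠ 2 := by intro h; simp [h] at hW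
  obtain ⟨a, hPa⟩ := Nat.exists_eq_succ_of_ne_zero (hext.ptr_ne_zero hu huD hW)
  have hau : N.tl a = u := by simpa [hPa] using hext.ptrTail u hu
  have haM : a < N.M := by omega
  have hda : N.tl (N.rv a) = N.dst a := rfl
  have hcB : 2 * N.c < B := by
    have : 200 * N.c * 2 ≤ 200 * N.c * (N.M + 2) := Nat.mul_le_mul_left _ (by omega)
    omega
  simp only [wp_seq, wp_assign, ok_sub, ok_get, ok_reg, ok_lit, val_sub, val_get, val_reg, val_lit,
    cost_sub, cost_get, cost_reg, cost_lit, ← hudef, true_and, hPa, Nat.succ_eq_add_one,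
    Nat.add_sub_cancel]
  refine ⟨⟨by omega, by omega⟩, ?_⟩
  have hag₁ := hI.agree.setReg a (r := regA) (by simp)
  have hS₁ := hS.of_agree ((Agree.refl [regA] [] s).setReg a (r := regA) (by simp)) (by simp) (by simp)
  rw [wp_ite]
  simp only [ok_lt, ok_get, ok_reg, val_lt, val_get, val_reg, setReg_reg, setReg_arr, if_true,
    Nat.reduceEqDiff, if_false, hS.c, true_and, cost_lt, cost_get, cost_reg,
    ite_one_zero_lt_iff (show 1 < B by omega)]
  refine ⟨fun h => ?_, fun h => ?_⟩
  · have hlt : s.arr arrRes a < N.c := by by_contra h'; simp [h'] at h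
    simp only [loadHead, wp_seq, wp_assign, ok_get, ok_reg, val_get, val_reg, cost_get, cost_reg,
      setReg_reg, setReg_arr, Nat.reduceEqDiff, if_true, if_false, hS.tl, hS.rv, hda, true_and]
    have hres := hext.res a haM
    have hrM := N.rv_lt a haM
    refine wp_pushArc hB (a := N.rv a)
      (hS₁.of_agree (((Agree.refl [regA, regW] [] _).setReg _ (by simp)).setReg _ (by simp))
        (by simp) (by simp)) hrM (by simp) hext.res ?_ ?_
    · simp only [setReg_arr]; omega
    intro s₂ hag₂ hR₂
    have hag := ((hag₁.setReg (N.dst a) (r := regW) (by simp)).setReg (N.rv a) (r := regA)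
      (by simp)).trans hag₂ (by simp) (by simp)
    have hP₂ : s₂.arr arrPtr = s.arr arrPtr := by rw [hag₂.arr _ (by simp)]; rfl
    have hW₂ : s₂.arr arrSink = s.arr arrSink := by rw [hag₂.arr _ (by simp)]; rfl
    have hD₂ : s₂.arr arrDead = s.arr arrDead := by rw [hag₂.arr _ (by simp)]; rfl
    have htok₂ : s₂.reg regTok = s.reg regTok := by rw [hag₂.reg _ (by simp)]; simp
    have hi₂ : s₂.reg regI = s.reg regI := by rw [hag₂.reg _ (by simp)]; simp
    have hw₂ : s₂.reg regW = N.dst a := by rw [hag₂.reg _ (by simp)]; simp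
    simp only [setReg_arr] at hR₂
    have hflow := Net.flowSum_pushed hext.res hrM (by omega)
    rw [← hau] at hext huD
    have hdD : s.arr arrDead (N.dst a) = 0 := by
      by_contra hD
      have := hext.deadArcs a haM huD hD
      omega
    simp only [wp_assign, ok_reg, val_reg, cost_reg, true_and, hw₂]
    refine ⟨?_, ⟨hag.setReg _ (by simp), ?_, ?_, ?_, ?_⟩⟩
    · simp only [extPot, setReg_reg, setReg_arr, Nat.reduceEqDiff, if_false, htok, htok₂, hR₂, hP₂,
        hi₂]
      omega
    · simpa [hR₂, hP₂, hW₂, hD₂, htok₂, htok] using hext.walk haM huD (by rw [hau, hPa]) hlt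
    · intro _
      simpa [hD₂, hi₂] using ⟨N.dst_lt haM, hdD, hiM⟩
    · simpa [hi₂] using hI.le
    · simp only [setReg_reg, setReg_arr, Nat.reduceEqDiff, if_false, hi₂, hD₂, hR₂]
      intro b hb h₁ h₂
      rw [Net.pushed_apply hrM, N.rv_rv a haM]
      split_ifs with h₃ h₄
      · subst h₃; rw [N.dst_rv haM] at h₂; exact absurd huD h₂
      · subst h₄; exact absurd hdD h₂
      · exact hI.done b hb h₁ h₂
  · have hle : N.c ≤ s.arr arrRes a := by by_contra h'; simp [not_le.1 h'] at h
    simp only [wp_store, ok_get, ok_reg, val_get, val_reg, cost_get, cost_reg, setReg_reg,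
      setReg_arr, Nat.reduceEqDiff, if_true, if_false, hS.nx, true_and, ← hudef]
    have hadv := hext.advance haM (by rw [hau, hPa]) hle
    have hsum := Net.sum_update hu (s.arr arrPtr) (N.nx a) fun v x => N.cnt v x
    have hcnt := Net.cnt_nx haM
    rw [hau] at hadv hcnt
    rw [hPa, Nat.succ_eq_add_one, hcnt] at hsum
    refine ⟨?_, ⟨hag₁.setArr _ _ (by simp), ?_, ?_, ?_, ?_⟩⟩
    · simp only [extPot, setReg_reg, setReg_arr, setArr_arr, setArr_reg, Nat.reduceEqDiff,
        if_true, if_false, htok]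
      omega
    · simpa [htok] using hadv
    · simpa using hI.tok
    · simpa using hI.le
    · simpa using hI.done

/-- The weight 2 of the flow in `extPot` pays both for the step and for the new token. The arc index
does not move while units are taken from the arc, so it only advances once the arc is settled. -/
theorem wp_startDeficit {t : ℕ} {s₀ s : State} (hB : N.Fits B) (hS : Static N s₀)
    (hI : ExtInv N s₀ s) (htok : s.reg regTok = 0) (hi : s.reg regI < N.M) :
    Wp B startDeficit (fun t' s' => t' + 100 * extPot N s' + 20 ≤ t + 100 * extPot N s ∧
      ExtInv N s₀ s') t s := by
  have hF := hB
  unfold Net.Fits at hF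
  have hS := hS.of_agree hI.agree (by simp) (by simp)
  have hext := hI.ext
  rw [if_pos htok] at hext
  set a := s.reg regI with hadef
  have hda : N.tl (N.rv a) = N.dst a := rfl
  simp only [startDeficit, loadHead, wp_seq, wp_assign, ok_get, ok_reg, val_get, val_reg, cost_get,
    cost_reg, setReg_reg, setReg_arr, if_true, hS.tl, hS.rv, ← hadef, hda, true_and]
  have hag₁ := (hI.agree.setReg a (r := regA) (by simp)).setReg (N.dst a) (r := regW) (by simp)
  have hS₁ := hS.of_agree (((Agree.refl [regA, regW] [] s).setReg a (r := regA) (by simp)).setReg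
    (N.dst a) (r := regW) (by simp)) (by simp) (by simp)
  rw [wp_ite]
  simp only [ok_reg, ok_lit, ok_get, ok_mul, ok_lt, val_reg, val_lit, val_get, val_mul, val_lt,
    cost_reg, cost_lit, cost_get, cost_mul, cost_lt, setReg_reg, setReg_arr, Nat.reduceEqDiff,
    if_true, if_false, true_and, Nat.lt_one_iff, hS.tl, hS.c,
    ite_one_zero_lt_iff (show 1 < B by omega), and_true, mul_ite, mul_one, mul_zero]
  refine ⟨⟨⟨by omega, by split_ifs <;> omega⟩, by omega, by split_ifs <;> omega⟩, fun h => ?_,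
    fun h => ?_⟩
  · obtain ⟨h₁, h₂, h₃⟩ : s.arr arrDead (N.tl a) = 0 ∧ N.c < s.arr arrRes a ∧
        0 < s.arr arrDead (N.dst a) := by
      by_contra h'
      apply h
      split_ifs <;> tauto
    rw [wp_seq]
    refine wp_pushArc hB (a := a) hS₁ hi (by simp) hext.res ?_ ?_
    · simp only [setReg_arr]; omega
    intro s₂ hag₂ hR₂
    have hag := hag₁.trans hag₂ (by simp) (by simp)
    have hS₂ := hS₁.of_agree hag₂ (by simp) (by simp)
    have hP₂ : s₂.arr arrPtr = s.arr arrPtr := by rw [hag₂.arr _ (by simp)]; rfl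
    have hW₂ : s₂.arr arrSink = s.arr arrSink := by rw [hag₂.arr _ (by simp)]; rfl
    have hD₂ : s₂.arr arrDead = s.arr arrDead := by rw [hag₂.arr _ (by simp)]; rfl
    have hi₂ : s₂.reg regI = a := by rw [hag₂.reg _ (by simp)]; simp [hadef]
    have ha₂ : s₂.reg regA = a := by rw [hag₂.reg _ (by simp)]; simp
    simp only [setReg_arr] at hR₂
    have hflow := Net.flowSum_pushed hext.res hi h₂
    simp only [wp_seq, wp_assign, ok_reg, ok_get, ok_lit, val_reg, val_get, val_lit, cost_reg,
      cost_get, cost_lit, true_and, ha₂, hS₂.tl]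
    refine ⟨by omega, ?_, ⟨(hag.setReg _ (by simp)).setReg _ (by simp), ?_, ?_, ?_, ?_⟩⟩
    · simp only [extPot, setReg_reg, setReg_arr, Nat.reduceEqDiff, if_true, if_false, htok, hR₂,
        hP₂, hi₂, ← hadef, one_ne_zero]
      omega
    · simpa [hR₂, hP₂, hW₂, hD₂] using hext.start hi h₃.ne' h₂
    · intro _
      simpa [hD₂, hi₂] using ⟨N.tl_lt a hi, h₁, hi⟩
    · simpa [hi₂] using hi.le
    · simp only [setReg_reg, setReg_arr, Nat.reduceEqDiff, if_false, hi₂, hD₂, hR₂]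
      intro b hb h₄ h₅
      have h₆ := hI.done b hb h₄ h₅
      rw [Net.pushed_apply hi]
      split_ifs with h₇ h₈
      · omega
      · subst h₈; exact absurd h₄ h₃.ne'
      · exact h₆
  · simp only [wp_assign, ok_add, ok_reg, ok_lit, val_add, val_reg, val_lit, cost_add, cost_reg,
      cost_lit, setReg_reg, Nat.reduceEqDiff, if_false, true_and, ← hadef]
    refine ⟨⟨by omega, by omega⟩, ?_, ⟨hag₁.setReg _ (by simp), ?_, ?_, ?_, ?_⟩⟩
    · simp only [extPot, setReg_reg, setReg_arr, Nat.reduceEqDiff, if_true, if_false, htok,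
        ← hadef]
      omega
    · simpa [htok] using hext
    · simp [htok]
    · simpa using hi
    · simp only [setReg_reg, setReg_arr, if_true]
      intro b hb h₁ h₂
      by_cases hba : b = a
      · subst hba
        by_contra h'
        rw [if_pos h₁, if_pos (by omega), if_pos (by omega)] at h
        exact one_ne_zero h
      · exact hI.done b (by omega) h₁ h₂

theorem wp_cancelExternal {t : ℕ} {s : State} (hB : N.Fits B) (hS : Static N s)
    (hext : N.Ext (s.arr arrRes) (s.arr arrPtr) (s.arr arrSink) (s.arr arrDead) 0)
    (htok : s.reg regTok = 0) :
    Wp B cancelExternal (fun t' s' => t' ≤ t + 100 * (2 * N.M * N.c + 2 * N.M) + 10 ∧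
      Agree [regI, regA, regTok, regU, regW] [arrSink, arrRes, arrPtr] s s' ∧
      N.Ext (s'.arr arrRes) (s'.arr arrPtr) (s'.arr arrSink) (s'.arr arrDead) 0 ∧
      ∀ a < N.M, s'.arr arrDead (N.tl a) = 0 → s'.arr arrDead (N.dst a) ≠ 0 →
        s'.arr arrRes a = N.c) t s := by
  have hF := hB
  unfold Net.Fits at hF
  simp only [cancelExternal, wp_seq, wp_assign, ok_lit, val_lit, cost_lit]
  refine ⟨by omega, ?_⟩
  set s₁ := s.setReg regI 0 with hs₁
  have hpot : extPot N s₁ ≤ 2 * N.M * N.c + 2 * N.M := by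
    have h₁ := N.flowSum_le (R := s.arr arrRes)
    have h₂ : ∑ v ∈ range N.n, N.cnt v (s.arr arrPtr v) ≤ N.M := by
      rw [← N.vol_range, Net.vol_eq_sum]
      exact sum_le_sum fun v hv => N.cnt_mono v (hext.ptrLe v (by simpa using hv))
    simp only [extPot, hs₁, setReg_reg, setReg_arr, Nat.reduceEqDiff, if_true, if_false, htok]
    rw [mul_assoc]
    omega
  refine wp_while (t + 2 + 100 * extPot N s₁) (fun t' s' =>
    t' + 100 * extPot N s' ≤ t + 2 + 100 * extPot N s₁ ∧ ExtInv N s s') ?_ ?_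
    ⟨by omega, ⟨(Agree.refl _ _ s).setReg _ (by simp), ?_, ?_, ?_, ?_⟩⟩
  · rintro t' s' ⟨h, -⟩; omega
  · rintro t' s' ⟨ht, hI⟩
    have hS' := hS.of_agree hI.agree (by simp) (by simp)
    simp only [ok_lt, ok_reg, val_lt, val_reg, cost_lt, cost_reg, true_and, hS'.M,
      ite_one_zero_lt_iff (show 1 < B by omega)]
    refine ⟨fun h => ?_, fun h => ?_⟩
    · have hlt : s'.reg regI < N.M := by by_contra h'; simp [h'] at h
      rw [wp_ite]
      simp only [ok_reg, val_reg, cost_reg, true_and]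
      refine ⟨fun h' => ?_, fun h' => ?_⟩
      · refine (wp_stepDeficit hB hS hI h').mono ?_
        rintro t₁ s₁ ⟨h₁, h₂⟩
        exact ⟨by omega, h₂⟩
      · refine (wp_startDeficit hB hS hI h' hlt).mono ?_
        rintro t₁ s₁ ⟨h₁, h₂⟩
        exact ⟨by omega, h₂⟩
    · have hge : N.M ≤ s'.reg regI := by by_contra h'; simp [not_le.1 h'] at h
      have htok' : s'.reg regTok = 0 := by
        by_contra h'
        have := (hI.tok h').2.2
        omega
      have hext' := hI.ext
      rw [if_pos htok'] at hext'
      refine ⟨by omega, hI.agree, hext', fun a ha h₁ h₂ => ?_⟩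
      exact le_antisymm (hI.done a (by omega) h₁ h₂) (hext'.deadArcs a ha h₁ h₂)
  · simpa [hs₁, htok] using hext
  · simp [hs₁, htok]
  · simp [hs₁]
  · simp [hs₁]

end WordRAM

/-! ### Input and output -/

namespace WordRAM

open WordRAM.Expr (reg get)

variable {B : ℕ}

/-- Writes the flow between vertices that are not removed, and takes the ends of the edges between
such vertices out of the cut. -/
def writeOutput : Cmd :=
  .assign regI 0 ;;
  .while ((reg regI + reg regI).lt (reg regM))
    (.store arrCap (reg regI) (reg regC) ;; .assign regA (reg regI) ;; loadHead ;;
      .assign regU (get arrTl (reg regI)) ;;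
      .ite (isAlive * (get arrDead (reg regU)).lt 1)
        (.store arrCut (reg regU) 0 ;; .store arrCut (reg regW) 0)
        (.store arrRes (reg regI) (reg regC)) ;;
      .assign regI (reg regI + 1))

/-- The arc with index `e < m` is edge `e` in its own orientation. Writing `c` into `arrRes` makes
the output flow vanish on edges with a removed end. -/
theorem wp_writeOutput {N : Net} {t m : ℕ} {s : State} (hB : N.Fits B) (hS : Static N s)
    (hm : N.M = 2 * m) :
    Wp B writeOutput (fun t' s' => t' ≤ t + 60 * m + 10 ∧
      Agree [regI, regA, regU, regW] [arrCap, arrRes, arrCut] s s' ∧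
      (∀ e < m, s'.arr arrCap e = N.c ∧ s'.arr arrRes e =
        if s.arr arrDead (N.tl e) = 0 ∧ s.arr arrDead (N.dst e) = 0 then s.arr arrRes e else N.c) ∧
      ∀ v, s'.arr arrCut v = if ∃ e < m, (s.arr arrDead (N.tl e) = 0 ∧ s.arr arrDead (N.dst e) = 0) ∧
        (N.tl e = v ∨ N.dst e = v) then 0 else s.arr arrCut v) t s := by
  classical
  have hF := hB
  unfold Net.Fits at hF
  simp only [writeOutput, wp_seq, wp_assign, ok_lit, val_lit, cost_lit]
  refine ⟨by omega, ?_⟩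
  set D := s.arr arrDead with hD
  refine wp_while (t + 60 * m + 10) (fun t' s' => ∃ i, s'.reg regI = i ∧ i ≤ m ∧
    t' ≤ t + 60 * i + 2 ∧ Agree [regI, regA, regU, regW] [arrCap, arrRes, arrCut] s s' ∧
    (∀ e, s'.arr arrRes e = if e < i then
        if D (N.tl e) = 0 ∧ D (N.dst e) = 0 then s.arr arrRes e else N.c else s.arr arrRes e) ∧
    (∀ e < i, s'.arr arrCap e = N.c) ∧
      ∀ v, s'.arr arrCut v = if ∃ e < i, (D (N.tl e) = 0 ∧ D (N.dst e) = 0) ∧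
        (N.tl e = v ∨ N.dst e = v) then 0 else s.arr arrCut v) ?_ ?_ ?_
  · rintro t' s' ⟨i, -, hi, ht, -⟩; omega
  · rintro t' s' ⟨i, hi, him, ht, hag, hR, hcap, hcut⟩
    have hS' := hS.of_agree hag (by simp) (by simp)
    have hD' : s'.arr arrDead = D := hag.arr _ (by simp)
    have hda : N.tl (N.rv i) = N.dst i := rfl
    have hcB : 2 * N.c < B := by
      have : 200 * N.c * 2 ≤ 200 * N.c * (N.M + 2) := Nat.mul_le_mul_left _ (by omega)
      omega
    simp only [wp_seq, wp_assign, wp_store, wp_ite, loadHead, isAlive, ok_lit, ok_reg, ok_get,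
      ok_add, ok_lt, ok_mul, val_lit, val_reg, val_get, val_add, val_lt, val_mul, cost_lit, cost_reg,
      cost_get, cost_add, cost_lt, cost_mul, setArr_reg, setArr_arr, setReg_reg, setReg_arr,
      Nat.reduceEqDiff, if_true, if_false, true_and, hi, hS'.M, hS'.tl, hS'.rv, hS'.c, hD', hda,
      Nat.lt_one_iff, and_true, mul_ite, mul_one, mul_zero,
      ite_one_zero_lt_iff (show 1 < B by omega)]
    refine ⟨by omega, fun h' => ?_, fun h' => ?_⟩
    · have hlt : i + i < N.M := by by_contra h; simp [h] at h'
      have hag' := (((hag.setArr i N.c (a := arrCap) (by simp)).setReg i (r := regA)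
        (by simp)).setReg (N.dst i) (r := regW) (by simp)).setReg (N.tl i) (r := regU) (by simp)
      refine ⟨⟨by omega, by omega, by split_ifs <;> omega⟩, fun h => ?_, fun h => ?_⟩
      · have hlive : D (N.tl i) = 0 ∧ D (N.dst i) = 0 := by
          by_contra h''
          apply h
          split_ifs <;> tauto
        refine ⟨by omega, by omega, ⟨by omega, by omega⟩, i + 1, by simp, by omega, by omega,
          ((hag'.setArr _ _ (by simp)).setArr _ _ (by simp)).setReg _ (by simp), fun e => ?_,
          fun e he => ?_, fun v => ?_⟩
        · rw [hR]
          by_cases hei : e = i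
          · subst hei; simp [hlive]
          · have : e < i + 1 ↔ e < i := by omega
            rw [if_congr this rfl rfl]
        · by_cases hei : e = i
          · subst hei; simp
          · rw [update_of_ne hei]; exact hcap e (by omega)
        · by_cases hv : N.tl i = v ∨ N.dst i = v
          · rw [if_pos ⟨i, by omega, hlive, hv⟩]
            rcases hv with rfl | rfl
            · simp [update_apply]
            · simp
          · push Not at hv
            rw [update_of_ne hv.2.symm, update_of_ne hv.1.symm, hcut]
            refine if_congr ⟨?_, ?_⟩ rfl rfl
            · rintro ⟨e, he, h₁⟩; exact ⟨e, by omega, h₁⟩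
            · rintro ⟨e, he, h₁, h₂⟩
              refine ⟨e, ?_, h₁, h₂⟩
              by_contra h₃
              have : e = i := by omega
              subst this
              tauto
      · have hlive : ¬ (D (N.tl i) = 0 ∧ D (N.dst i) = 0) := by
          rintro ⟨h₁, h₂⟩
          simp [h₁, h₂] at h
        refine ⟨⟨by omega, by omega⟩, i + 1, by simp, by omega, by omega,
          (hag'.setArr _ _ (by simp)).setReg _ (by simp), fun e => ?_,
          fun e he => ?_, fun v => ?_⟩
        · by_cases hei : e = i
          · subst hei; simp [hlive]
          · rw [update_of_ne hei, hR]
            have : e < i + 1 ↔ e < i := by omega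
            rw [if_congr this rfl rfl]
        · by_cases hei : e = i
          · subst hei; simp
          · rw [update_of_ne hei]; exact hcap e (by omega)
        · rw [hcut]
          refine if_congr ⟨?_, ?_⟩ rfl rfl
          · rintro ⟨e, he, h₁⟩; exact ⟨e, by omega, h₁⟩
          · rintro ⟨e, he, h₁, h₂⟩
            refine ⟨e, ?_, h₁, h₂⟩
            by_contra h₃
            have : e = i := by omega
            subst this
            exact hlive h₁
    · have hge : i = m := by
        have : ¬ i + i < N.M := by intro h; simp [h] at h'
        omega
      subst hge
      exact ⟨by omega, hag, fun e he => ⟨hcap e he, by rw [hR, if_pos he]⟩, hcut⟩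
  · exact ⟨0, by simp, by omega, by omega, (Agree.refl _ _ s).setReg _ (by simp), by simp, by simp,
      by simp⟩

/-- Computes the number of arcs and the bound on the labels. -/
def setLabelBound : Cmd :=
  .assign regM (reg regE + reg regE) ;; .assign regK (200 * reg regC) ;; .assign regH 1 ;;
  .assign regP 1 ;;
  .while ((reg regP).lt (reg regM + 1))
    (.assign regP (reg regP + reg regP) ;; .assign regH (reg regH + reg regK))

/-- The loop doubles a power of two until it exceeds the number `2m` of arcs, so it overshoots by at
most a factor of two. Each doubling adds `200c` to `h`, the number of layers in which the volume of
a growing ball at least doubles. -/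
theorem wp_setLabelBound {m c t : ℕ} {s : State} (hB : 4 * m + 200 * c * (4 * m) + 300 ≤ B)
    (hm : 0 < m) (hE : s.reg regE = m) (hC : s.reg regC = c) :
    Wp B setLabelBound (fun t' s' => ∃ j, t' ≤ t + 30 * j + 30 ∧
      Agree [regM, regH, regK, regP] [] s s' ∧ s'.reg regM = 2 * m ∧ s'.reg regK = 200 * c ∧
      s'.reg regH = 1 + 200 * c * j ∧ 2 * m < 2 ^ j ∧ 2 ^ j ≤ 4 * m) t s := by
  have hcB : 200 * c ≤ 200 * c * (4 * m) := Nat.le_mul_of_pos_right _ (by omega)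
  simp only [setLabelBound, wp_seq, wp_assign, ok_lit, ok_reg, ok_add, ok_mul, val_lit, val_reg,
    val_add, val_mul, cost_lit, cost_reg, cost_add, cost_mul, setReg_reg, Nat.reduceEqDiff, if_false,
    hE, hC, true_and]
  refine ⟨by omega, ⟨by omega, by omega⟩, by omega, by omega, ?_⟩
  refine wp_while (t + 30 * (4 * m) + 30) (fun t' s' => ∃ j, t' ≤ t + 30 * j + 20 ∧
      Agree [regM, regH, regK, regP] [] s s' ∧ s'.reg regM = 2 * m ∧ s'.reg regK = 200 * c ∧
      s'.reg regH = 1 + 200 * c * j ∧ s'.reg regP = 2 ^ j ∧ 2 ^ j ≤ 4 * m) ?_ ?_ ?_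
  · rintro t' s' ⟨j, ht, -, -, -, -, -, hj⟩
    have := Nat.lt_two_pow_self (n := j)
    omega
  · rintro t' s' ⟨j, ht, hag, hM, hK, hH, hP, hj⟩
    simp only [wp_seq, wp_assign, ok_lit, ok_reg, ok_add, ok_lt, val_lit, val_reg, val_lt,
      val_add, cost_lit, cost_reg, cost_add, cost_lt, setReg_reg, Nat.reduceEqDiff, if_false,
      hP, hM, hH, hK, true_and, ite_one_zero_lt_iff (show 1 < B by omega), and_true]
    refine ⟨⟨by omega, by omega⟩, fun h => ?_, fun h => ?_⟩
    · have hlt : 2 ^ j < 2 * m + 1 := by by_contra h'; simp [h'] at h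
      have hj' : 2 ^ (j + 1) ≤ 4 * m := by rw [pow_succ]; omega
      have hjm := Nat.lt_two_pow_self (n := j + 1)
      have hmul : 200 * c * (j + 1) ≤ 200 * c * (4 * m) := Nat.mul_le_mul_left _ (by omega)
      rw [mul_add, mul_one] at hmul
      refine ⟨by omega, by omega, j + 1, by omega,
        (hag.setReg _ (by simp)).setReg _ (by simp), ?_, ?_, hj'⟩
      · rw [if_true]; ring
      · rw [if_true, pow_succ]; ring
    · have hge : 2 * m < 2 ^ j := by
        by_contra h'; rw [if_pos (by omega)] at h; omega
      exact ⟨j, by omega, hag, rfl, hge, hj⟩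
  · refine ⟨0, by omega, ((((Agree.refl _ _ s).setReg _ (by simp)).setReg _ (by simp)).setReg _
      (by simp)).setReg _ (by simp), ?_, ?_, ?_, ?_, by omega⟩
    · simp; ring
    · simp
    · simp
    · simp

/-- Computes the arcs and their residual capacities. -/
def setArcs : Cmd :=
  .assign regI 0 ;;
  .while ((reg regI).lt (reg regE))
    (.store arrTl (reg regI) (get arrFst (reg regI)) ;;
      .store arrTl (reg regI + reg regE) (get arrSnd (reg regI)) ;;
      .store arrRv (reg regI) (reg regI + reg regE) ;;
      .store arrRv (reg regI + reg regE) (reg regI) ;;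
      .store arrRes (reg regI) (reg regC) ;; .store arrRes (reg regI + reg regE) (reg regC) ;;
      .assign regI (reg regI + 1))

theorem wp_setArcs {m t : ℕ} {s : State} (hB : 4 * m + 300 ≤ B) (hE : s.reg regE = m) :
    Wp B setArcs (fun t' s' => t' ≤ t + 100 * m + 10 ∧
      Agree [regI] [arrTl, arrRv, arrRes] s s' ∧
      ∀ e < m, s'.arr arrTl e = s.arr arrFst e ∧ s'.arr arrTl (e + m) = s.arr arrSnd e ∧
        s'.arr arrRv e = e + m ∧ s'.arr arrRv (e + m) = e ∧ s'.arr arrRes e = s.reg regC ∧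
        s'.arr arrRes (e + m) = s.reg regC) t s := by
  simp only [setArcs, wp_seq, wp_assign, ok_lit, val_lit, cost_lit]
  refine ⟨by omega, ?_⟩
  refine wp_while (t + 100 * m + 10) (fun t' s' => ∃ i, s'.reg regI = i ∧ i ≤ m ∧
    t' ≤ t + 100 * i + 3 ∧ Agree [regI] [arrTl, arrRv, arrRes] s s' ∧
    ∀ e < i, s'.arr arrTl e = s.arr arrFst e ∧ s'.arr arrTl (e + m) = s.arr arrSnd e ∧
        s'.arr arrRv e = e + m ∧ s'.arr arrRv (e + m) = e ∧ s'.arr arrRes e = s.reg regC ∧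
        s'.arr arrRes (e + m) = s.reg regC) ?_ ?_ ?_
  · rintro t' s' ⟨i, -, hi, ht, -⟩; omega
  · rintro t' s' ⟨i, hi, him, ht, hag, h⟩
    have hE' : s'.reg regE = m := by rw [hag.reg _ (by simp), hE]
    have hC' : s'.reg regC = s.reg regC := hag.reg _ (by simp)
    have hf' : s'.arr arrFst = s.arr arrFst := hag.arr _ (by simp)
    have hs' : s'.arr arrSnd = s.arr arrSnd := hag.arr _ (by simp)
    simp only [wp_seq, wp_assign, wp_store, ok_lit, ok_reg, ok_get, ok_add, ok_lt, val_lit, val_reg,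
      val_get, val_add, val_lt, cost_lit, cost_reg, cost_get, cost_add, cost_lt, setArr_reg,
      setArr_arr, Nat.reduceEqDiff, if_false, true_and, hi, hE', hC', hf', hs',
      ite_one_zero_lt_iff (show 1 < B by omega)]
    refine ⟨fun h' => ?_, fun h' => ?_⟩
    · have hlt : i < m := by by_contra h; simp [h] at h'
      refine ⟨by omega, by omega, by omega, by omega, ⟨by omega, by omega⟩, i + 1, by simp, hlt,
        by omega, ((((((hag.setArr _ _ (by simp)).setArr _ _ (by simp)).setArr _ _
          (by simp)).setArr _ _ (by simp)).setArr _ _ (by simp)).setArr _ _ (by simp)).setReg _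
          (by simp), fun e he => ?_⟩
      simp only [setReg_arr, setArr_arr, Nat.reduceEqDiff, if_true, if_false]
      by_cases hei : e = i
      · subst hei
        have h₁ : e ≠ e + m := by omega
        simp [update_of_ne h₁]
      · have h₁ : e ≠ i + m := by omega
        have h₂ : e + m ≠ i := by omega
        have h₃ : e + m ≠ i + m := by omega
        simp only [update_of_ne hei, update_of_ne h₁, update_of_ne h₂, update_of_ne h₃]
        exact h e (by omega)
    · have hge : i = m := by
        by_contra h; rw [if_pos (by omega)] at h'; omega
      subst hge
      exact ⟨by omega, hag, h⟩
  · exact ⟨0, by simp, by omega, by omega, (Agree.refl _ _ s).setReg _ (by simp), by simp⟩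

/-- Computes the linked lists of the arcs with a given tail. -/
def linkArcs : Cmd :=
  .assign regI 0 ;;
  .while ((reg regI).lt (reg regM))
    (.store arrNx (reg regI) (get arrHd (get arrTl (reg regI))) ;;
      .store arrHd (get arrTl (reg regI)) (reg regI + 1) ;; .assign regI (reg regI + 1))

/-- Arcs are prepended in increasing order, so a list starts with its last arc. Entries are shifted
by one; memory that is initially zero therefore represents empty lists. -/
theorem wp_linkArcs {M t : ℕ} {s : State} (hB : M + 300 ≤ B) (hM : s.reg regM = M)
    (hhd : ∀ v, s.arr arrHd v = 0) :
    Wp B linkArcs (fun t' s' => t' ≤ t + 50 * M + 10 ∧ Agree [regI] [arrHd, arrNx] s s' ∧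
      (∀ v, IsArcPtr (s.arr arrTl) v M (s'.arr arrHd v)) ∧
      ∀ a < M, IsArcPtr (s.arr arrTl) (s.arr arrTl a) a (s'.arr arrNx a)) t s := by
  simp only [linkArcs, wp_seq, wp_assign, ok_lit, val_lit, cost_lit]
  refine ⟨by omega, ?_⟩
  set tl := s.arr arrTl with htl
  refine wp_while (t + 50 * M + 10) (fun t' s' => ∃ i, s'.reg regI = i ∧ i ≤ M ∧
    t' ≤ t + 50 * i + 3 ∧ Agree [regI] [arrHd, arrNx] s s' ∧
    (∀ v, IsArcPtr tl v i (s'.arr arrHd v)) ∧ ∀ a < i, IsArcPtr tl (tl a) a (s'.arr arrNx a))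
    ?_ ?_ ?_
  · rintro t' s' ⟨i, -, hi, ht, -⟩; omega
  · rintro t' s' ⟨i, hi, him, ht, hag, h₁, h₂⟩
    have hM' : s'.reg regM = M := by rw [hag.reg _ (by simp), hM]
    have htl' : s'.arr arrTl = tl := hag.arr _ (by simp)
    simp only [wp_seq, wp_assign, wp_store, ok_lit, ok_reg, ok_get, ok_add, ok_lt, val_lit, val_reg,
      val_get, val_add, val_lt, cost_lit, cost_reg, cost_get, cost_add, cost_lt, setArr_reg,
      setArr_arr, Nat.reduceEqDiff, if_false, true_and, hi, hM', htl',
      ite_one_zero_lt_iff (show 1 < B by omega)]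
    refine ⟨fun h' => ?_, fun h' => ?_⟩
    · have hlt : i < M := by by_contra h; simp [h] at h'
      refine ⟨⟨by omega, by omega⟩, ⟨by omega, by omega⟩, i + 1, by simp, hlt, by omega,
        ((hag.setArr _ _ (by simp)).setArr _ _ (by simp)).setReg _ (by simp), fun v => ?_,
        fun a ha => ?_⟩
      · simp only [setReg_arr, setArr_arr, Nat.reduceEqDiff, if_true, if_false]
        by_cases hv : v = tl i
        · subst hv
          rw [update_self]
          exact ⟨le_rfl, Or.inr (by simp), fun a h₃ h₄ => by omega⟩
        · rw [update_of_ne hv]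
          have h := h₁ v
          refine ⟨h.le.trans (by omega), h.tail, fun a h₃ h₄ => ?_⟩
          by_cases hai : a = i
          · subst hai; exact Ne.symm hv
          · exact h.skip a h₃ (by omega)
      · simp only [setReg_arr, setArr_arr, Nat.reduceEqDiff, if_true, if_false]
        by_cases hai : a = i
        · subst hai; rw [update_self]; exact h₁ _
        · rw [update_of_ne hai]; exact h₂ a (by omega)
    · have hge : i = M := by
        by_contra h; rw [if_pos (by omega)] at h'; omega
      subst hge
      exact ⟨by omega, hag, h₁, h₂⟩
  · refine ⟨0, by simp, by omega, by omega, (Agree.refl _ _ s).setReg _ (by simp), fun v => ?_,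
      by simp⟩
    rw [setReg_arr, hhd]
    exact ⟨le_rfl, Or.inl rfl, fun a _ h => by omega⟩

end WordRAM

/-! ### The program -/

namespace WordRAM

open WordRAM.Expr (reg get)

variable {N : Net} {B : ℕ}

/-- What the final state says about the network, where `R` are the residual capacities, `W` the
states of the sinks and `D` the marks of the removed vertices. -/
structure Final (N : Net) (R W D : ℕ → ℕ) (s : State) : Prop where
  res : ∀ a < N.M, R a + R (N.rv a) = 2 * N.c
  cons : ∀ v < N.n, D v = 0 → (N.src v : ℤ) = Net.sunk (W v) + N.out R v
  notSink : ∀ v < N.n, N.snk v = 0 → W v = 0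
  deadInv : N.DeadInv D
  boundary : ∀ a < N.M, D (N.tl a) = 0 → D (N.dst a) ≠ 0 → R a = N.c
  flag : (s.reg regFlag = 0 ∧ N.dead D = ∅) ∨ (s.reg regFlag = 1 ∧ (N.dead D).Nonempty)
  cap : ∀ e, 2 * e < N.M → s.arr arrCap e = N.c
  flow : ∀ e, 2 * e < N.M → s.arr arrRes e =
    if D (N.tl e) = 0 ∧ D (N.dst e) = 0 then R e else N.c
  cut : ∀ v < N.n, s.arr arrCut v = 0 ↔ ∃ e, 2 * e < N.M ∧
    (D (N.tl e) = 0 ∧ D (N.dst e) = 0) ∧ (N.tl e = v ∨ N.dst e = v)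

/-- Finds a flow and a cut, once the network is set up. -/
def solve : Cmd := mainLoop ;; resetPtrs ;; cancelExternal ;; writeOutput

theorem wp_solve {t m : ℕ} {s : State} (hB : N.Fits B) (hm : N.M = 2 * m) (hI : Inv N s)
    (hL : LabLt N s) :
    Wp B solve (fun t' s' => t' ≤ t + 100 * pot N s + 30 * N.n + 200 * (N.M * N.c) + 300 * N.M + 50 ∧
      ∃ R W D, Final N R W D s') t s := by
  have hF := hB
  unfold Net.Fits at hF
  rw [solve, wp_seq]
  refine (wp_mainLoop hB hI hL).mono ?_
  rintro t₁ s₁ ⟨ht₁, hI₁, hsp⟩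
  rw [wp_seq]
  refine (wp_resetPtrs (B := B) (n := N.n) (by omega) hI₁.static.n).mono ?_
  rintro t₂ s₂ ⟨ht₂, hag₂, h₂⟩
  have hS₂ := hI₁.static.of_agree hag₂ (by simp) (by simp)
  have hR₂ : s₂.arr arrRes = s₁.arr arrRes := hag₂.arr _ (by simp)
  have hW₂ : s₂.arr arrSink = s₁.arr arrSink := hag₂.arr _ (by simp)
  have hD₂ : s₂.arr arrDead = s₁.arr arrDead := hag₂.arr _ (by simp)
  have htok₁ : s₁.reg regTok = 0 := by
    by_contra h
    have := (hI₁.tok h).2.2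
    omega
  have htok₂ : s₂.reg regTok = 0 := by rw [hag₂.reg _ (by simp), htok₁]
  have hC := hI₁.core
  rw [if_pos htok₁] at hC
  have hptr : ∀ v < N.n, s₂.arr arrPtr v = N.hd v := fun v hv => by
    rw [(h₂ v hv).1, hI₁.static.hd]
  have hext : N.Ext (s₂.arr arrRes) (s₂.arr arrPtr) (s₂.arr arrSink) (s₂.arr arrDead) 0 := by
    rw [hR₂, hW₂, hD₂]
    refine ⟨hC.res, fun v hv hD => ?_, hI₁.deadArcs, hC.notSink, fun v hv => ?_, fun v hv => ?_,
      fun a ha h => ?_⟩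
    -- The stack is empty, so no mass is pending on unremoved vertices.
    · have hpe : s₁.arr arrPend v = 0 := by
        by_contra h
        obtain ⟨i, hi, -⟩ := hI₁.stackMem v hv hD (by omega)
        omega
      have := hC.cons v hv hD
      rw [hpe] at this
      simpa using this
    · rw [hptr v hv]; exact (N.hd_ptr v hv).le
    · rw [hptr v hv]; exact (N.hd_ptr v hv).tail
    · rw [hptr _ (N.tl_lt a ha)] at h
      exact absurd rfl ((N.hd_ptr _ (N.tl_lt a ha)).skip a h ha)
  rw [wp_seq]
  refine (wp_cancelExternal hB hS₂ hext htok₂).mono ?_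
  rintro t₃ s₃ ⟨ht₃, hag₃, hext₃, hbd⟩
  refine (wp_writeOutput hB (hS₂.of_agree hag₃ (by simp) (by simp)) hm).mono ?_
  rintro t₄ s₄ ⟨ht₄, hag₄, hout, hcut⟩
  have hD₃ : s₃.arr arrDead = s₁.arr arrDead := by rw [hag₃.arr _ (by simp), hD₂]
  refine ⟨?_, s₃.arr arrRes, s₃.arr arrSink, s₃.arr arrDead, hext₃.res, fun v hv hD => ?_,
    hext₃.notSink, hD₃ ▸ hI₁.deadInv, hbd, ?_, fun e he => (hout e (by omega)).1,
    fun e he => (hout e (by omega)).2, fun v hv => ?_⟩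
  · have : 2 * N.M * N.c = 2 * (N.M * N.c) := by ring
    omega
  · simpa using hext₃.cons v hv hD
  · rw [hD₃, hag₄.reg _ (by simp), hag₃.reg _ (by simp), hag₂.reg _ (by simp)]
    exact hI₁.flag
  · rw [hcut, hag₃.arr arrCut (by simp), (h₂ v hv).2.2]
    have : ∀ e, 2 * e < N.M ↔ e < m := fun e => by omega
    simp only [this, ite_eq_left_iff, one_ne_zero, imp_false, not_not]

end WordRAM

/-! ### Setting up the network -/

/-- Bernoulli's inequality `(1 + 1/k)^d ≥ 1 + d/k` with the denominators cleared. -/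
theorem pow_mul_add_le (k d : ℕ) : k ^ d * (k + d) ≤ (k + 1) ^ d * k := by
  induction d with
  | zero => simp
  | succ d ih =>
    calc k ^ (d + 1) * (k + (d + 1)) = k ^ d * (k * (k + (d + 1))) := by ring
      _ ≤ k ^ d * ((k + d) * (k + 1)) := Nat.mul_le_mul_left _ (by nlinarith)
      _ = k ^ d * (k + d) * (k + 1) := by ring
      _ ≤ (k + 1) ^ d * k * (k + 1) := Nat.mul_le_mul_right _ ih
      _ = (k + 1) ^ (d + 1) * k := by ring

/-- Since `(1 + 1/k)^k ≥ 2`, growth over `k * j` layers reaches `2^j > M`. This is why `h = 1 +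
200c·j` exceeds the number of layers of any ball. -/
theorem lt_of_succ_pow_le {k j M d : ℕ} (hk : 0 < k) (hM : M < 2 ^ j)
    (h : (k + 1) ^ d ≤ M * k ^ d) : d < 1 + k * j := by
  by_contra hd
  have h₂ : 2 * k ^ k ≤ (k + 1) ^ k := by
    refine Nat.le_of_mul_le_mul_right ?_ hk
    calc 2 * k ^ k * k = k ^ k * (k + k) := by ring
      _ ≤ _ := pow_mul_add_le k k
  obtain ⟨i, rfl⟩ := Nat.exists_eq_add_of_le (show k * j ≤ d by omega)
  have h₃ : 2 ^ j * k ^ (k * j + i) ≤ (k + 1) ^ (k * j + i) := by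
    calc 2 ^ j * k ^ (k * j + i) = (2 * k ^ k) ^ j * k ^ i := by rw [pow_add, pow_mul, mul_pow]; ring
      _ ≤ ((k + 1) ^ k) ^ j * (k + 1) ^ i := by gcongr; omega
      _ = _ := by rw [pow_add, pow_mul]
  have h₄ := Nat.mul_lt_mul_of_pos_right hM (pow_pos hk (k * j + i))
  omega

namespace EdgeListGraph

variable {n m : ℕ} {G : EdgeListGraph n m}

/-- Provides every vertex with an arc. If there is only one vertex, all edges are loops at it. -/
theorem Connected.exists_edge (hG : G.Connected) (hm : 0 < m) (v : Fin n) :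
    ∃ e, G.fst e = v ∨ G.snd e = v := by
  by_cases h : ∃ w, w ≠ v
  · obtain ⟨w, hw⟩ := h
    obtain ⟨p⟩ := hG.preconnected v w
    cases p with
    | nil => exact absurd rfl hw
    | cons h _ =>
      rw [SimpleGraph.fromRel_adj] at h
      rcases h.2 with ⟨e, h⟩ | ⟨e, h⟩ <;> exact ⟨e, by tauto⟩
  · push Not at h
    exact ⟨⟨0, hm⟩, Or.inl (h _)⟩

end EdgeListGraph

/-- The network of a unit flow problem. -/
structure Net.Represents (N : Net) {n m : ℕ} (G : EdgeListGraph n m) (Al Ar : Finset (Fin n))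
    (c : ℕ) : Prop where
  n_eq : N.n = n
  M_eq : N.M = 2 * m
  c_eq : N.c = c
  tl_fst : ∀ e : Fin m, N.tl e = G.fst e
  tl_snd : ∀ e : Fin m, N.tl (e + m) = G.snd e
  rv_fst : ∀ e < m, N.rv e = e + m
  rv_snd : ∀ e < m, N.rv (e + m) = e
  src_eq : ∀ v : Fin n, N.src v = if v ∈ Al then 1 else 0
  snk_eq : ∀ v : Fin n, N.snk v = if v ∈ Ar then 1 else 0

namespace WordRAM

open WordRAM.Expr (reg get)

variable {B : ℕ}

theorem pot_init {N : Net} {s : State} (hL : ∀ v, s.arr arrLab v = 0)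
    (hP : ∀ v < N.n, s.arr arrPtr v = N.hd v) (hpe : ∀ v, s.arr arrPend v ≤ 1)
    (hsp : s.reg regSp = N.n) (htok : s.reg regTok = 0) (hh : 200 * N.c + 200 ≤ N.h) :
    pot N s ≤ 8 * (N.h * N.M) := by
  have hn := N.n_le
  have hvol : ∑ v ∈ range N.n, N.cnt v N.M = N.M := by rw [← Net.vol_eq_sum, Net.vol_range]
  have h₁ : ∑ v ∈ range N.n, (N.h - s.arr arrLab v) * (N.cnt v N.M + 2) = N.h * (N.M + N.n * 2) := by
    simp only [hL, Nat.sub_zero]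
    rw [← mul_sum, sum_add_distrib, hvol]
    simp
  have h₂ : ∑ v ∈ range N.n, N.cnt v (s.arr arrPtr v) = N.M := by
    rw [← hvol]
    refine sum_congr rfl fun v hv => ?_
    have hv := mem_range.1 hv
    rw [hP v hv, Net.cnt_eq_of_ptr (N.hd_ptr v hv)]
  have h₃ : N.pendSum (s.arr arrPend) (s.arr arrDead) ≤ N.M := by
    refine le_trans (sum_le_sum (g := fun _ => 1) fun v _ => ?_) (by simpa using hn)
    split_ifs
    exacts [hpe v, zero_le_one]
  have h₄ : N.aliveVol (s.arr arrDead) ≤ N.M := Net.vol_le _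
  unfold pot Net.pot
  rw [h₁, h₂, if_pos htok, hsp]
  calc _ ≤ N.h * (N.M + N.M * 2) + N.M + N.M * (N.h + 2) + 0 + N.M + N.M * (N.h + 400 * N.c + 10) := by
        gcongr
    _ = N.M * (5 * N.h + (400 * N.c + 14)) := by ring
    _ ≤ N.M * (8 * N.h) := Nat.mul_le_mul_left _ (by omega)
    _ = _ := by ring

/-- Computes the network, current arcs and a stack of all vertices. -/
def setup : Cmd :=
  setLabelBound ;; setArcs ;; linkArcs ;; resetPtrs ;; .assign regSp (reg regN)

theorem wp_setup {n m c t : ℕ} {G : EdgeListGraph n m} {Al Ar : Finset (Fin n)}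
    (hB : 4 * m + 200 * c * (4 * m) + 300 ≤ B) (hnB : n + 2 ≤ B) (hm : 0 < m) (hc : 1 < c)
    (hG : G.Connected) :
    Wp B setup (fun t' s => ∃ (N : Net) (j : ℕ), t' ≤ t + 30 * j + 200 * m + 30 * n + 100 ∧
      N.Represents G Al Ar c ∧ N.h = 1 + 200 * c * j ∧ 2 ^ j ≤ 4 * m ∧ Inv N s ∧ LabLt N s ∧
      pot N s ≤ 8 * (N.h * N.M)) t (unitFlowInput G Al Ar c) := by
  set s₀ := unitFlowInput G Al Ar c with hs₀
  rw [setup, wp_seq]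
  refine (wp_setLabelBound hB hm (by simp [hs₀, unitFlowInput]) (by simp [hs₀, unitFlowInput])).mono ?_
  rintro t₁ s₁ ⟨j, ht₁, hag₁, hM₁, hK₁, hH₁, hj, hj'⟩
  rw [wp_seq]
  refine (wp_setArcs (m := m) (by omega)
    ((hag₁.reg _ (by simp)).trans (by simp [hs₀, unitFlowInput]))).mono ?_
  rintro t₂ s₂ ⟨ht₂, hag₂, h₂⟩
  rw [wp_seq]
  refine (wp_linkArcs (M := 2 * m) (by omega) ((hag₂.reg _ (by simp)).trans hM₁) fun v => ?_).mono ?_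
  · rw [hag₂.arr _ (by simp), hag₁.arr _ (by simp)]
    simp [hs₀, unitFlowInput]
  rintro t₃ s₃ ⟨ht₃, hag₃, hhd, hnx⟩
  have hn₃ : s₃.reg regN = n := by
    rw [hag₃.reg _ (by simp), hag₂.reg _ (by simp), hag₁.reg _ (by simp)]
    simp [hs₀, unitFlowInput]
  rw [wp_seq]
  refine (wp_resetPtrs hnB hn₃).mono ?_
  rintro t₄ s₄ ⟨ht₄, hag₄, h₄⟩
  have hn₄ : s₄.reg regN = n := by rw [hag₄.reg _ (by simp), hn₃]
  rw [wp_assign]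
  refine ⟨trivial, ?_⟩
  rw [val_reg, hn₄, cost_reg]
  set s := s₄.setReg regSp n with hs
  have hag : Agree [regM, regH, regK, regP, regI, regSp]
      [arrTl, arrRv, arrRes, arrHd, arrNx, arrPtr, arrStack, arrCut] s₀ s :=
    ((((hag₁.mono (by simp) (by simp)).trans hag₂ (by simp) (by simp)).trans hag₃
      (by simp) (by simp)).trans hag₄ (by simp) (by simp)).setReg _ (by simp)
  have hag' : Agree [regI, regSp] [arrHd, arrNx, arrPtr, arrStack, arrCut] s₂ s :=
    ((hag₃.mono (by simp) (by simp)).trans hag₄ (by simp) (by simp)).setReg _ (by simp)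
  have htl : ∀ e : Fin m, s₂.arr arrTl e = G.fst e ∧ s₂.arr arrTl (e + m) = G.snd e := fun e => by
    rw [(h₂ e e.2).1, (h₂ e e.2).2.1, hag₁.arr _ (by simp), hag₁.arr _ (by simp)]
    simp [hs₀, unitFlowInput]
  have harc : ∀ {p : ℕ → Prop}, (∀ e < m, p e) → (∀ e < m, p (e + m)) → ∀ a < 2 * m, p a := by
    intro p h h' a ha
    by_cases ham : a < m
    · exact h a ham
    · have := h' (a - m) (by omega)
      rwa [Nat.sub_add_cancel (by omega)] at this
  have hres : ∀ a < 2 * m, s₂.arr arrRes a = c := by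
    have hc₁ : s₁.reg regC = c := by
      rw [hag₁.reg _ (by simp)]
      simp [hs₀, unitFlowInput]
    exact harc (fun e he => by rw [(h₂ e he).2.2.2.2.1, hc₁])
      fun e he => by rw [(h₂ e he).2.2.2.2.2, hc₁]
  have hpe : ∀ v, s₀.arr arrPend v ≤ 1 := fun v => by
    simp only [hs₀, unitFlowInput, OfNat.ofNat_ne_zero, OfNat.ofNat_ne_one, if_false, if_true,
      Nat.reduceEqDiff]
    split_ifs <;> omega
  have hsk : ∀ v, s₀.arr arrSink v ≤ 1 := fun v => by
    simp only [hs₀, unitFlowInput, OfNat.ofNat_ne_zero, OfNat.ofNat_ne_one, if_false, if_true,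
      Nat.reduceEqDiff]
    split_ifs <;> omega
  let N : Net :=
    { n := n
      M := 2 * m
      c := c
      h := 1 + 200 * c * j
      tl := s₂.arr arrTl
      rv := s₂.arr arrRv
      hd := s₃.arr arrHd
      nx := s₃.arr arrNx
      src := s₀.arr arrPend
      snk := s₀.arr arrSink
      one_lt_c := hc
      tl_lt := harc (fun e he => by rw [(htl ⟨e, he⟩).1]; exact (G.fst _).2)
        fun e he => by rw [(htl ⟨e, he⟩).2]; exact (G.snd _).2
      rv_lt := harc (fun e he => by rw [(h₂ e he).2.2.1]; omega)
        fun e he => by rw [(h₂ e he).2.2.2.1]; omega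
      rv_rv := harc (fun e he => by rw [(h₂ e he).2.2.1, (h₂ e he).2.2.2.1])
        fun e he => by rw [(h₂ e he).2.2.2.1, (h₂ e he).2.2.1]
      rv_ne := harc (fun e he => by rw [(h₂ e he).2.2.1]; omega)
        fun e he => by rw [(h₂ e he).2.2.2.1]; omega
      exists_tl := fun v hv => by
        obtain ⟨e, he | he⟩ := hG.exists_edge hm ⟨v, hv⟩
        · exact ⟨e, by have := e.2; omega, by rw [(htl e).1, he]⟩
        · exact ⟨e + m, by have := e.2; omega, by rw [(htl e).2, he]⟩
      hd_ptr := fun v _ => hhd v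
      nx_ptr := hnx
      src_le := hpe
      snk_le := hsk
      lt_h := fun d => lt_of_succ_pow_le (by omega) hj }
  -- From `2 ≤ 2m < 2^j`. It makes `h` large enough to absorb the terms with `400c` of the potential
  -- in `pot_init`.
  have hj₂ : 2 ≤ j := by
    by_contra h
    have : 2 ^ j ≤ 2 ^ 1 := Nat.pow_le_pow_right (by omega) (by omega)
    omega
  have hLab : ∀ v, s.arr arrLab v = 0 := fun v => by
    rw [hag.arr _ (by simp)]
    simp [hs₀, unitFlowInput]
  have hDead : s.arr arrDead = fun _ => 0 := by
    rw [hag.arr _ (by simp)]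
    simp [hs₀, unitFlowInput]
  have htok : s.reg regTok = 0 := by
    rw [hag.reg _ (by simp)]
    simp [hs₀, unitFlowInput]
  have hflag : s.reg regFlag = 0 := by
    rw [hag.reg _ (by simp)]
    simp [hs₀, unitFlowInput]
  have hPend : s.arr arrPend = s₀.arr arrPend := hag.arr _ (by simp)
  have hSink : s.arr arrSink = s₀.arr arrSink := hag.arr _ (by simp)
  have hRes : ∀ a < N.M, s.arr arrRes a = c := fun a ha => by
    rw [hag'.arr _ (by simp)]
    exact hres a ha
  have hPtr : ∀ v < N.n, s.arr arrPtr v = N.hd v := fun v hv => (h₄ v hv).1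
  have hdead : N.dead (s.arr arrDead) = ∅ := by simp [Net.dead, hDead]
  refine ⟨N, j, ?_, ?_, rfl, hj', ?_, fun v _ _ => ?_, ?_⟩
  · omega
  · refine ⟨rfl, rfl, rfl, fun e => (htl e).1, fun e => (htl e).2, fun e he => (h₂ e he).2.2.1,
      fun e he => (h₂ e he).2.2.2.1, fun v => ?_, fun v => ?_⟩
    · simp [N, hs₀, unitFlowInput, Fin.val_inj]
    · simp [N, hs₀, unitFlowInput, Fin.val_inj]
  · have hsunk : ∀ v, Net.sunk (s.arr arrSink v) = 0 := fun v => by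
      have := hsk v
      rw [hSink, Net.sunk, if_neg (by omega)]
    have hout : ∀ v, N.out (s.arr arrRes) v = 0 := fun v => sum_eq_zero fun a ha => by
      rw [hRes a (mem_range.1 ha)]
      simp [N]
    refine ⟨?_, ?_, ?_, ?_, ?_, ?_, ?_, ?_, Or.inl ⟨hflag, hdead⟩⟩
    · have hN : ∀ r, r = regM ∨ r = regH ∨ r = regK → s.reg r = s₁.reg r := fun r hr => by
        rw [hag'.reg _ (by simp; omega), hag₂.reg _ (by simp; omega)]
      refine ⟨?_, ?_, ?_, ?_, ?_, ?_, ?_, ?_, ?_⟩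
      · simp [hs, hn₄, N]
      · rw [hag.reg _ (by simp)]
        simp [hs₀, unitFlowInput, N]
      · rw [hN _ (by simp)]; exact hM₁
      · rw [hN _ (by simp)]; exact hH₁
      · rw [hN _ (by simp)]; exact hK₁
      · exact hag'.arr _ (by simp)
      · exact hag'.arr _ (by simp)
      · exact hag₄.arr _ (by simp)
      · exact hag₄.arr _ (by simp)
    · rw [if_pos htok]
      refine ⟨fun a ha => ?_, fun v hv _ => ?_, fun a _ _ _ _ => ?_, fun v _ h => ?_, fun v _ h => ?_,
        fun v _ _ => hLab v, fun v hv => ?_, fun v hv => ?_, fun a _ _ _ _ _ => ?_⟩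
      · rw [hRes a ha, hRes _ (N.rv_lt a ha)]
        exact (two_mul c).symm
      · rw [hsunk, hout, hPend]
        simp [N]
      · rw [hLab, hLab]; omega
      · rw [hSink]; exact h
      · rw [hSink]
        have := hsk v
        have : s₀.arr arrSink v ≠ 0 := h
        omega
      · rw [hPtr v hv]; exact (N.hd_ptr v hv).le
      · rw [hPtr v hv]; exact (N.hd_ptr v hv).tail
      · rw [hLab, hLab]
    · refine ⟨?_, fun v _ h => absurd (by rw [hDead]) h⟩
      rw [hdead]
      simp [Net.cut, Net.arcs]
    · exact fun a _ _ h => absurd (by rw [hDead]) h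
    · refine fun v hv _ _ => ⟨v, by simpa [hs] using hv, (h₄ v hv).2.1⟩
    · intro i hi
      have hi : i < n := by simpa [hs] using hi
      rw [show s.arr arrStack i = i from (h₄ i hi).2.1]
      exact hi
    · have : N.aliveVol (s.arr arrDead) ≤ N.M := Net.vol_le _
      have : s.reg regSp = N.n := by simp [hs, N]
      omega
    · exact fun h => absurd htok h
  · rw [hLab]
    exact Nat.lt_of_lt_of_le Nat.zero_lt_one (Nat.le_add_right _ _)
  · refine pot_init hLab hPtr (fun v => hPend ▸ hpe v) (by simp [hs, N]) htok ?_
    have : 200 * c * 2 ≤ 200 * c * j := Nat.mul_le_mul_left _ hj₂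
    change 200 * c + 200 ≤ 1 + 200 * c * j
    omega

end WordRAM

/-! ### The flow and the cut in the final state -/

namespace Net.Represents

variable {N : Net} {n m c : ℕ} {G : EdgeListGraph n m} {Al Ar : Finset (Fin n)}

theorem arc (h : N.Represents G Al Ar c) {a : ℕ} (ha : a < N.M) :
    ∃ e : Fin m, (a = e ∧ N.tl a = G.fst e ∧ N.dst a = G.snd e) ∨
      (a = e + m ∧ N.tl a = G.snd e ∧ N.dst a = G.fst e) := by
  have hM := h.M_eq
  by_cases ham : a < m
  · refine ⟨⟨a, ham⟩, Or.inl ⟨rfl, h.tl_fst ⟨a, ham⟩, ?_⟩⟩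
    rw [Net.dst, h.rv_fst a ham]
    exact h.tl_snd ⟨a, ham⟩
  · obtain ⟨b, rfl⟩ := Nat.exists_eq_add_of_le' (not_lt.1 ham)
    have hb : b < m := by omega
    refine ⟨⟨b, hb⟩, Or.inr ⟨rfl, h.tl_snd ⟨b, hb⟩, ?_⟩⟩
    rw [Net.dst, h.rv_snd b hb]
    exact h.tl_fst ⟨b, hb⟩

theorem dst_fst (h : N.Represents G Al Ar c) (e : Fin m) : N.dst e = G.snd e := by
  rw [Net.dst, h.rv_fst e e.2, h.tl_snd]

theorem dst_snd (h : N.Represents G Al Ar c) (e : Fin m) : N.dst (e + m) = G.fst e := by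
  rw [Net.dst, h.rv_snd e e.2, h.tl_fst]

theorem fst_lt (h : N.Represents G Al Ar c) (e : Fin m) : (e : ℕ) < N.M := by
  have := h.M_eq; have := e.2; omega

theorem snd_lt (h : N.Represents G Al Ar c) (e : Fin m) : (e : ℕ) + m < N.M := by
  have := h.M_eq; have := e.2; omega

theorem adj (h : N.Represents G Al Ar c) {a : ℕ} (ha : a < N.M) {u v : Fin n} (hu : N.tl a = u)
    (hv : N.dst a = v) : G.Adj u v := by
  obtain ⟨e, ⟨-, h₁, h₂⟩ | ⟨-, h₁, h₂⟩⟩ := h.arc ha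
  · exact ⟨e, Or.inl ⟨Fin.ext (h₁.symm.trans hu), Fin.ext (h₂.symm.trans hv)⟩⟩
  · exact ⟨e, Or.inr ⟨Fin.ext (h₂.symm.trans hv), Fin.ext (h₁.symm.trans hu)⟩⟩

theorem sum_arcs (h : N.Represents G Al Ar c) {M : Type*} [AddCommMonoid M] (f : ℕ → M) :
    ∑ a ∈ range N.M, f a = ∑ e : Fin m, (f e + f (e + m)) := by
  rw [h.M_eq, two_mul, sum_range_add, sum_range, sum_range, ← sum_add_distrib]
  simp only [add_comm]

theorem cnt_eq_degree (h : N.Represents G Al Ar c) (v : Fin n) : N.cnt v N.M = G.degree v := by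
  unfold Net.cnt EdgeListGraph.degree
  rw [card_filter, h.sum_arcs, card_filter, card_filter, ← sum_add_distrib]
  simp only [h.tl_fst, h.tl_snd, Fin.val_inj]

theorem vol_eq (h : N.Represents G Al Ar c) (S : Finset (Fin n)) :
    N.vol (S.map Fin.valEmbedding) = G.vol S := by
  rw [Net.vol_eq_sum, sum_map]
  exact sum_congr rfl fun v _ => h.cnt_eq_degree v

theorem card_le_vol (h : N.Represents G Al Ar c) (S : Finset (Fin n)) : S.card ≤ G.vol S := by
  rw [← h.vol_eq, ← card_map Fin.valEmbedding]
  refine Net.card_le_vol fun v hv => ?_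
  obtain ⟨u, -, rfl⟩ := mem_map.1 hv
  rw [h.n_eq]
  exact u.2

theorem vol_le (h : N.Represents G Al Ar c) (S : Finset (Fin n)) : G.vol S ≤ 2 * m := by
  rw [← h.vol_eq, ← h.M_eq]; exact Net.vol_le _

end Net.Represents

namespace WordRAM.Final

variable {N : Net} {n m c : ℕ} {G : EdgeListGraph n m} {Al Ar : Finset (Fin n)} {R W D : ℕ → ℕ}
  {s : State}

theorem outputFlow_eq (F : Final N R W D s) (hN : N.Represents G Al Ar c) (e : Fin m) :
    outputFlow m s e = if D (G.fst e) = 0 ∧ D (G.snd e) = 0 then (c : ℝ) - R e else 0 := by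
  have he : 2 * (e : ℕ) < N.M := by have := hN.M_eq; have := e.2; omega
  have h₁ := F.flow e he
  rw [hN.tl_fst, hN.dst_fst, hN.c_eq] at h₁
  unfold outputFlow
  rw [F.cap e he, h₁, hN.c_eq]
  split_ifs <;> simp

/-- Edges with a removed end are output as 0. This agrees with the network at an unremoved `v`,
because the arcs from `v` to removed vertices have residual capacity exactly `c`. -/
theorem netOut_eq (F : Final N R W D s) (hN : N.Represents G Al Ar c) {v : Fin n} (hv : D v = 0) :
    G.netOut (outputFlow m s) v = (N.out R v : ℤ) := by
  unfold EdgeListGraph.netOut Net.out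
  rw [hN.sum_arcs, Int.cast_sum]
  refine sum_congr rfl fun e _ => ?_
  have h₁ := F.boundary e (hN.fst_lt e)
  have h₂ := F.boundary (e + m) (hN.snd_lt e)
  have h₃ := F.res e (hN.fst_lt e)
  rw [hN.rv_fst e e.2] at h₃
  rw [hN.dst_fst] at h₁
  rw [hN.dst_snd] at h₂
  rw [hN.tl_fst] at h₁ ⊢
  rw [hN.tl_snd] at h₂ ⊢
  rw [hN.c_eq] at h₁ h₂ h₃ ⊢
  have h₄ : (R e : ℝ) + R (e + m) = 2 * c := by exact_mod_cast h₃
  rw [F.outputFlow_eq hN]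
  simp only [Fin.val_inj]
  by_cases ha : D (G.fst e) = 0 ∧ D (G.snd e) = 0
  · rw [if_pos ha]
    split_ifs <;> push_cast <;> linarith
  · rw [if_neg ha]
    have h₅ : G.fst e = v → R e = c := by
      rintro rfl; exact h₁ hv fun h => ha ⟨hv, h⟩
    have h₆ : G.snd e = v → R (e + m) = c := by
      rintro rfl; exact h₂ hv fun h => ha ⟨h, hv⟩
    split_ifs with h₇ h₈ h₈ <;> simp [*]

/-- Conservation leaves `sunk (W v)`, that is 0 or 1, at each vertex, and 0 where there is no sink.
Both the whole vertex set (if nothing is removed) and the complement of the cut contain the ends of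
all edges between unremoved vertices. -/
theorem isFeasibleFlowOn (F : Final N R W D s) (hN : N.Represents G Al Ar c)
    {A Al' Ar' : Finset (Fin n)} (hA : ∀ v ∈ A, D v = 0)
    (hE : ∀ e, D (G.fst e) = 0 → D (G.snd e) = 0 → G.fst e ∈ A ∧ G.snd e ∈ A)
    (hAl : ∀ v ∈ A, v ∈ Al' ↔ v ∈ Al) (hAr : ∀ v ∈ A, v ∈ Ar' ↔ v ∈ Ar) :
    G.IsFeasibleFlowOn A (unitFlowProblem c Al' Ar') (outputFlow m s) := by
  have hcons : ∀ v ∈ A, (if v ∈ Al then (1 : ℝ) else 0) =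
      (Net.sunk (W v) : ℤ) + G.netOut (outputFlow m s) v := fun v hv => by
    have h := F.cons v (hN.n_eq ▸ v.2) (hA v hv)
    rw [hN.src_eq] at h
    rw [F.netOut_eq hN (hA v hv)]
    exact_mod_cast h
  refine ⟨fun e he => ?_, fun e _ _ => ?_, fun v hv => ?_, fun v hv => ?_⟩
  · rw [F.outputFlow_eq hN, if_neg fun h => he (hE e h.1 h.2)]
  · rw [F.outputFlow_eq hN, unitFlowProblem]
    have h := F.res e (hN.fst_lt e)
    rw [hN.c_eq] at h
    have h' : (R e : ℝ) ≤ 2 * c := by exact_mod_cast (by omega : R e ≤ 2 * c)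
    split_ifs
    · rw [abs_le]
      have : (0 : ℝ) ≤ R e := Nat.cast_nonneg _
      constructor <;> simp only [] <;> linarith
    · simp
  · simp only [unitFlowProblem, hAl v hv, hcons v hv]
    have : 0 ≤ Net.sunk (W v) := by unfold Net.sunk; split_ifs <;> simp
    have : (0 : ℝ) ≤ (Net.sunk (W v) : ℤ) := by exact_mod_cast this
    linarith
  · simp only [unitFlowProblem, hAl v hv, hAr v hv, hcons v hv, add_sub_cancel_right]
    have h := F.notSink v (hN.n_eq ▸ v.2)
    rw [hN.snk_eq] at h
    unfold Net.sunk
    by_cases hv' : v ∈ Ar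
    · rw [if_pos hv']; split_ifs <;> simp
    · rw [if_neg hv', h (if_neg hv')]; simp

theorem notMem_cut (F : Final N R W D s) (hN : N.Represents G Al Ar c) {v : Fin n} :
    v ∉ outputCut n s ↔ ∃ a < N.M, N.tl a = v ∧ D v = 0 ∧ D (N.dst a) = 0 := by
  rw [outputCut, mem_filter, not_and_not_right]
  simp only [mem_univ, true_imp_iff]
  rw [F.cut v (hN.n_eq ▸ v.2)]
  have hM := hN.M_eq
  constructor
  · rintro ⟨e, he, ⟨h₁, h₂⟩, h | h⟩
    · exact ⟨e, by omega, h, h ▸ h₁, h₂⟩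
    · have he' : e < N.M := by omega
      exact ⟨N.rv e, N.rv_lt e he', h, h ▸ h₂, by rwa [Net.dst_rv he']⟩
  · rintro ⟨a, ha, h₁, h₂, h₃⟩
    obtain ⟨e, ⟨h₄, h₅, h₆⟩ | ⟨h₄, h₅, h₆⟩⟩ := hN.arc ha
    · exact ⟨a, by have := e.2; omega, ⟨h₁ ▸ h₂, h₃⟩, Or.inl h₁⟩
    · refine ⟨e, by have := e.2; omega, ?_, Or.inr ?_⟩
      · rw [hN.tl_fst, hN.dst_fst, ← h₅, ← h₆, h₁]; exact ⟨h₃, h₂⟩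
      · rw [hN.dst_fst, ← h₅, h₁]

theorem mem_cut_of_dead (F : Final N R W D s) (hN : N.Represents G Al Ar c) {v : Fin n}
    (hv : D v ≠ 0) : v ∈ outputCut n s := by
  by_contra h
  obtain ⟨a, -, -, h, -⟩ := (F.notMem_cut hN).1 h
  exact hv h

theorem alive_of_notMem_cut (F : Final N R W D s) (hN : N.Represents G Al Ar c) {v : Fin n}
    (hv : v ∉ outputCut n s) : D v = 0 := by
  obtain ⟨a, -, -, h, -⟩ := (F.notMem_cut hN).1 hv
  exact h

theorem notMem_cut_of_edge (F : Final N R W D s) (hN : N.Represents G Al Ar c) {e : Fin m}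
    (h₁ : D (G.fst e) = 0) (h₂ : D (G.snd e) = 0) :
    G.fst e ∉ outputCut n s ∧ G.snd e ∉ outputCut n s := by
  rw [F.notMem_cut hN, F.notMem_cut hN]
  exact ⟨⟨e, hN.fst_lt e, hN.tl_fst e, h₁, by rwa [hN.dst_fst]⟩,
    ⟨e + m, hN.snd_lt e, hN.tl_snd e, h₂, by rwa [hN.dst_snd]⟩⟩

/-- A vertex outside the cut shares an edge with another unremoved end, which is then outside as
well. A vertex in the cut has a removed neighbour: by `DeadInv.nbr` if it is removed itself, and
otherwise because all its neighbours are removed. -/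
theorem cutRespectsNeighbours (F : Final N R W D s) (hN : N.Represents G Al Ar c) :
    G.CutRespectsNeighbours (outputCut n s) := by
  have hdst : ∀ {a}, a < N.M → ∃ u : Fin n, N.dst a = u := fun ha =>
    ⟨⟨_, hN.n_eq ▸ Net.dst_lt ha⟩, rfl⟩
  constructor
  · intro v h
    by_contra hv
    obtain ⟨a, ha, h₁, h₂, h₃⟩ := (F.notMem_cut hN).1 hv
    obtain ⟨u, hu⟩ := hdst ha
    refine (F.notMem_cut hN).2 ⟨N.rv a, N.rv_lt a ha, hu, hu ▸ h₃, ?_⟩ (h u (hN.adj ha h₁ hu))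
    rwa [Net.dst_rv ha, h₁]
  · intro v h hv
    have hvn : (v : ℕ) < N.n := hN.n_eq ▸ v.2
    obtain ⟨a, ha, h₁, h₂⟩ : ∃ a < N.M, N.tl a = v ∧ D (N.dst a) ≠ 0 := by
      by_cases hD : D v = 0
      · obtain ⟨a, ha, h₁⟩ := N.exists_tl v hvn
        refine ⟨a, ha, h₁, fun h₂ => (F.notMem_cut hN).2 ⟨a, ha, h₁, hD, h₂⟩ hv⟩
      · exact F.deadInv.nbr v hvn hD
    obtain ⟨u, hu⟩ := hdst ha
    exact h u (hN.adj ha h₁ hu) (F.mem_cut_of_dead hN (hu ▸ h₂))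

/-- An edge with two unremoved ends has both ends outside the cut. So a cut edge joins a removed
vertex to an unremoved one, and is matched with its arc leaving the removed set. -/
theorem cutSize_le (F : Final N R W D s) (hN : N.Represents G Al Ar c) :
    G.cutSize (outputCut n s) ≤ N.cut (N.dead D) := by
  have hdead : ∀ v : Fin n, (v : ℕ) ∈ N.dead D ↔ D v ≠ 0 := fun v => by
    rw [Net.mem_dead, hN.n_eq]; exact and_iff_right v.2
  refine card_le_card_of_injOn (fun e => if G.fst e ∈ outputCut n s then (e : ℕ) else e + m) ?_ ?_
  · intro e he
    have he := (mem_filter.1 (mem_coe.1 he)).2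
    have hnot : ¬ (D (G.fst e) = 0 ∧ D (G.snd e) = 0) := fun h => by
      have := F.notMem_cut_of_edge hN h.1 h.2
      tauto
    simp only [mem_coe, mem_filter, Net.mem_arcs]
    split_ifs with h
    · rw [hN.tl_fst, hN.dst_fst, hdead, hdead]
      have h₁ := F.alive_of_notMem_cut hN (v := G.snd e) (by tauto)
      exact ⟨⟨hN.fst_lt e, by tauto⟩, by tauto⟩
    · rw [hN.tl_snd, hN.dst_snd, hdead, hdead]
      have h₁ := F.alive_of_notMem_cut hN h
      exact ⟨⟨hN.snd_lt e, by tauto⟩, by tauto⟩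
  · intro e _ e' _ h
    have := e.2
    have := e'.2
    simp only at h
    apply Fin.ext
    split_ifs at h <;> omega

/-- An unremoved vertex in the cut has only removed neighbours, so it is the head of an arc that
leaves the removed set. -/
theorem card_cut_le (F : Final N R W D s) (hN : N.Represents G Al Ar c) :
    ((outputCut n s).filter fun v : Fin n => D v = 0).card ≤ N.cut (N.dead D) := by
  rw [← card_map Fin.valEmbedding]
  refine le_trans (card_le_card fun v hv => ?_) (card_image_le (f := N.dst))
  obtain ⟨u, hu, rfl⟩ := mem_map.1 hv
  obtain ⟨h₁, h₂⟩ := mem_filter.1 hu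
  have hun : (u : ℕ) < N.n := hN.n_eq ▸ u.2
  obtain ⟨a, ha, h₃⟩ := N.exists_tl u hun
  have h₄ : D (N.dst a) ≠ 0 := fun h => (F.notMem_cut hN).2 ⟨a, ha, h₃, h₂, h⟩ h₁
  refine mem_image.2 ⟨N.rv a, mem_filter.2 ⟨Net.mem_arcs.2 ⟨N.rv_lt a ha, Net.mem_dead.2
    ⟨Net.dst_lt ha, h₄⟩⟩, ?_⟩, ?_⟩
  · rw [Net.dst_rv ha, h₃, Net.mem_dead]; tauto
  · rw [Net.dst_rv ha, h₃]; rfl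

theorem dead_eq (hN : N.Represents G Al Ar c) :
    N.dead D = (univ.filter fun v : Fin n => D v ≠ 0).map Fin.valEmbedding := by
  ext v
  simp only [Net.mem_dead, hN.n_eq, mem_map, mem_filter, mem_univ, true_and]
  constructor
  · rintro ⟨h₁, h₂⟩; exact ⟨⟨v, h₁⟩, h₂, rfl⟩
  · rintro ⟨u, h, rfl⟩; exact ⟨u.2, h⟩

/-- The cut is sparse and leaves a part of the sinks. -/
theorem cut_bounds (F : Final N R W D s) (hN : N.Represents G Al Ar c) (hc : 1000 < c)
    (hAr : 5 * m ≤ 24 * Ar.card) (hAl : 8 * Al.card ≤ m) :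
    c * G.cutSize (outputCut n s) ≤ 50 * G.vol (outputCut n s) ∧
      c * G.cutSize (outputCut n s) ≤ 50 * G.vol (outputCut n s)ᶜ ∧
      m ≤ 26 * G.vol (outputCut n s)ᶜ := by
  classical
  set S := outputCut n s with hS
  set T : Finset (Fin n) := univ.filter fun v => D v ≠ 0 with hT
  have hTS : T ⊆ S := fun v hv => F.mem_cut_of_dead hN (mem_filter.1 hv).2
  have hcut := F.deadInv.cut_le
  set z := N.cut (N.dead D) with hz
  rw [dead_eq hN, hN.c_eq, hN.vol_eq, sum_map, sum_map] at hcut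
  simp only [Fin.valEmbedding_apply, hN.src_eq, hN.snk_eq, sum_ite_mem, sum_const, smul_eq_mul,
    mul_one] at hcut
  have h₁ := F.cutSize_le hN
  have h₂ := F.card_cut_le hN
  have h₃ : G.vol T ≤ G.vol S := sum_le_sum_of_subset hTS
  have h₄ := hN.vol_le T
  have h₅ := hN.card_le_vol T
  have h₆ : (T ∩ Al).card ≤ T.card := card_le_card inter_subset_left
  have h₇ : (T ∩ Al).card ≤ Al.card := card_le_card inter_subset_right
  have h₈ := hN.card_le_vol Sᶜ
  have h₉ : Ar.card ≤ (T ∩ Ar).card + (S.filter fun v : Fin n => D v = 0).card + Sᶜ.card := by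
    refine le_trans (card_le_card (t := (T ∩ Ar) ∪ (S.filter fun v : Fin n => D v = 0) ∪ Sᶜ) fun v hv => ?_)
      ((card_union_le _ _).trans (Nat.add_le_add_right (card_union_le _ _) _))
    simp only [mem_union, mem_inter, mem_filter, mem_compl, hT, mem_univ, true_and]
    tauto
  have h₁₀ : 1000 * z ≤ c * z := Nat.mul_le_mul_right _ hc.le
  have h₁₁ : c * G.cutSize S ≤ c * z := Nat.mul_le_mul_left _ h₁
  have h₁₂ : 200 * c * z = 200 * (c * z) := by ring
  rw [h₁₂, ← hT] at hcut
  rw [← hS] at h₁ h₂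
  -- The invariant gives `cz ≤ |T ∩ Al| + vol T / 100 ≤ 1.01·vol T`, which settles the first bound,
  -- and also `cz ≤ m/8 + m/50`. For the sinks it gives `|T ∩ Ar| ≤ m/8 + m/50 - cz`. The at most
  -- `z` sinks in `S \ T` are absorbed by `cz`, hence `|Sᶜ| ≥ 5m/24 - m/8 - m/50 > m/26`, and `vol
  -- Sᶜ ≥ |Sᶜ|`.
  refine ⟨?_, ?_, ?_⟩ <;> omega

theorem conductance_le (F : Final N R W D s) (hN : N.Represents G Al Ar c) (hc : 1000 < c)
    (hAr : 5 * m ≤ 24 * Ar.card) (hAl : 8 * Al.card ≤ m) :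
    G.conductance (outputCut n s) ≤ 50 / (c : ℝ) := by
  obtain ⟨h₁, h₂, -⟩ := F.cut_bounds hN hc hAr hAl
  have hc' : (0 : ℝ) < c := by exact_mod_cast (by omega : 0 < c)
  have h : c * G.cutSize (outputCut n s) ≤
      50 * min (G.vol (outputCut n s)) (G.vol (outputCut n s)ᶜ) := by
    rcases min_choice (G.vol (outputCut n s)) (G.vol (outputCut n s)ᶜ) with h | h <;> rw [h] <;>
      assumption
  unfold EdgeListGraph.conductance
  refine div_le_of_le_mul₀ (Nat.cast_nonneg _) (by positivity) ?_
  rw [div_mul_eq_mul_div, le_div_iff₀ hc', mul_comm]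
  exact_mod_cast h

end WordRAM.Final

end

/-! ### The main theorem -/

theorem EdgeListGraph.Connected.le_two_mul {n m : ℕ} {G : EdgeListGraph n m} (hG : G.Connected)
    (hm : 0 < m) : n ≤ 2 * m := by
  have h := Fintype.card_le_of_surjective (Sum.elim G.fst G.snd) fun v => by
    obtain ⟨e, h | h⟩ := hG.exists_edge hm v
    exacts [⟨Sum.inl e, h⟩, ⟨Sum.inr e, h⟩]
  simp only [Fintype.card_fin, Fintype.card_sum] at h
  omega

namespace WordRAM

open WordRAM.Expr (reg get)

/-- Solves a unit flow problem. -/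
def unitFlow : Cmd := setup ;; solve

theorem exec_unitFlow {n m c : ℕ} {G : EdgeListGraph n m} {Al Ar : Finset (Fin n)} (hm : 2 ≤ m)
    (hc : 1000 < c) (hG : G.Connected) :
    ∃ t s N R W D j, Exec ((m + c) ^ 4) unitFlow (unitFlowInput G Al Ar c) t s ∧
      t ≤ 402000 * (m * (c * j)) ∧ 2 ^ j ≤ 4 * m ∧ N.Represents G Al Ar c ∧ Final N R W D s := by
  have hn := hG.le_two_mul (by omega)
  set B := (m + c) ^ 4 with hB
  have hmc : m ≤ m * c := Nat.le_mul_of_pos_right _ (by omega)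
  have hcm : c ≤ m * c := Nat.le_mul_of_pos_left _ (by omega)
  have hword : 10000 * (m * c) ≤ B := by
    have h₁ : m * c ≤ (m + c) ^ 2 := by nlinarith
    have h₂ : 100 ^ 2 ≤ (m + c) ^ 2 := Nat.pow_le_pow_left (by omega) _
    calc 10000 * (m * c) ≤ (m + c) ^ 2 * (m + c) ^ 2 := Nat.mul_le_mul (by omega) h₁
      _ = B := by rw [hB]; ring
  have hlab : 200 * c * (4 * m) = 800 * (m * c) := by ring
  have hrun : Wp B unitFlow (fun t s => ∃ N R W D j, t ≤ 402000 * (m * (c * j)) ∧ 2 ^ j ≤ 4 * m ∧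
      N.Represents G Al Ar c ∧ Final N R W D s) 0 (unitFlowInput G Al Ar c) := by
    rw [unitFlow, wp_seq]
    refine (wp_setup (B := B) (by omega) (by omega) (by omega) (by omega) hG).mono ?_
    rintro t₁ s₁ ⟨N, j, ht₁, hN, hh, hj, hI, hL, hpot⟩
    have hjm : j ≤ 4 * m := Nat.lt_two_pow_self.le.trans hj
    have hcj : 200 * c * j ≤ 200 * c * (4 * m) := Nat.mul_le_mul_left _ hjm
    have hfits : N.Fits B := by
      unfold Net.Fits
      rw [hN.n_eq, hN.M_eq, hN.c_eq, hh]
      have : 200 * c * (2 * m + 2) = 400 * (m * c) + 400 * c := by ring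
      omega
    refine (wp_solve hfits hN.M_eq hI hL).mono ?_
    rintro t₂ s₂ ⟨ht₂, R, W, D, hF⟩
    refine ⟨N, R, W, D, j, ?_, hj, hN, hF⟩
    rw [hN.n_eq, hN.M_eq, hN.c_eq] at ht₂
    rw [hN.M_eq, hh] at hpot
    -- If `j = 0` then `h = 1`, but the bound on the number of layers at `d = 1` forces `h > 1`.
    have hj₀ : 0 < j := by
      by_contra h
      have h₁ := N.lt_h 0
      have h₂ : j = 0 := by omega
      rw [hh, h₂, hN.M_eq] at h₁
      have h₃ := N.lt_h 1
      rw [hh, h₂, hN.M_eq, hN.c_eq] at h₃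
      have : 200 * c * 4 ≤ 2 * m * (200 * c) := by nlinarith
      simp only [pow_one] at h₃
      have := h₃ (by omega)
      omega
    have e₁ : 8 * ((1 + 200 * c * j) * (2 * m)) = 16 * m + 3200 * (m * (c * j)) := by ring
    have e₂ : m * c ≤ m * (c * j) := Nat.mul_le_mul_left _ (Nat.le_mul_of_pos_right _ hj₀)
    have e₃ : 2 * m * c = 2 * (m * c) := by ring
    have e₄ : m * 1000 ≤ m * c := Nat.mul_le_mul_left _ hc.le
    rw [e₁] at hpot
    rw [e₃] at ht₂
    omega
  obtain ⟨t, s, hexec, N, R, W, D, j, ht, hj, hN, hF⟩ := hrun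
  exact ⟨t, s, N, R, W, D, j, hexec, by omega, hj, hN, hF⟩

end WordRAM

/-- `4m ≤ m³` for `m ≥ 2`, and `3 / log 2 < 5`. -/
theorem le_five_mul_log {m j : ℕ} (hm : 2 ≤ m) (hj : 2 ^ j ≤ 4 * m) : (j : ℝ) ≤ 5 * Real.log m := by
  have h₁ : 2 ^ j ≤ m ^ 3 := hj.trans (by nlinarith [Nat.mul_le_mul hm hm])
  have h₂ : Real.log ((2 : ℝ) ^ j) ≤ Real.log ((m : ℝ) ^ 3) :=
    Real.log_le_log (by positivity) (by exact_mod_cast h₁)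
  rw [Real.log_pow, Real.log_pow] at h₂
  push_cast at h₂
  have h₃ := Real.log_two_gt_d9
  have h₄ : (0 : ℝ) ≤ j := Nat.cast_nonneg _
  nlinarith

theorem mainTheorem8 :
    -- one program and one word-length constant for all instances
    ∃ (P : WordRAM.Cmd) (k : ℕ),
    -- constants of `c = Θ(1 / (φ log m))`
    ∀ a b : ℝ, 0 < a → 0 < b →
    ∃ K : ℝ, 0 < K ∧
    ∀ (n m : ℕ) (G : EdgeListGraph n m) (Al Ar : Finset (Fin n)) (φ : ℝ) (c : ℕ),
      2 ≤ m → G.Connected → Disjoint Al Ar →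
      (5 / 24 : ℝ) * m ≤ (Ar.card : ℝ) → (Al.card : ℝ) ≤ (1 / 8 : ℝ) * m →
      0 < φ → φ < 1 / Real.log m →
      1000 < c → a * (1 / (φ * Real.log m)) ≤ (c : ℝ) → (c : ℝ) ≤ b * (1 / (φ * Real.log m)) →
      ∃ (t : ℕ) (s : WordRAM.State),
        WordRAM.Exec ((m + c) ^ k) P (unitFlowInput G Al Ar c) t s ∧
        (t : ℝ) ≤ K * (m / φ) ∧
        ((s.reg 3 = 0 ∧
            G.IsFeasibleFlowOn Finset.univ (unitFlowProblem c Al Ar) (outputFlow m s)) ∨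
          (s.reg 3 = 1 ∧
            (outputCut n s).Nonempty ∧
            G.conductance (outputCut n s) ≤ 50 / (c : ℝ) ∧
            G.conductance (outputCut n s) ≤ K * (φ * Real.log m) ∧
            (1 / 26 : ℝ) * m ≤ (G.vol (outputCut n s)ᶜ : ℝ) ∧
            G.IsFeasibleFlowOn (outputCut n s)ᶜ
              (unitFlowProblem c (Al \ outputCut n s) (Ar \ outputCut n s)) (outputFlow m s) ∧
            G.CutRespectsNeighbours (outputCut n s))) := by
  -- The first summand of `K` bounds the time: `2010000 = 402000·5`, with `c·log m ≤ b/φ`. The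
  -- second bounds the conductance, as `50/c ≤ (50/a)·φ·log m`.
  refine ⟨WordRAM.unitFlow, 4, fun a b ha hb => ⟨2010000 * b + 50 / a, by positivity, ?_⟩⟩
  intro n m G Al Ar φ c hm hG _ hAr hAl hφ _ hc hac hcb
  obtain ⟨t, s, N, R, W, D, j, hexec, ht, hj, hN, hF⟩ :=
    WordRAM.exec_unitFlow (Al := Al) (Ar := Ar) hm hc hG
  have hlog : 0 < Real.log m := Real.log_pos (by exact_mod_cast hm)
  have hc₀ : (0 : ℝ) < c := by exact_mod_cast (by omega : 0 < c)
  have hm₀ : (0 : ℝ) < m := by exact_mod_cast (by omega : 0 < m)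
  have hAr' : 5 * m ≤ 24 * Ar.card := by
    have : (5 : ℝ) * m ≤ 24 * Ar.card := by linarith
    exact_mod_cast this
  have hAl' : 8 * Al.card ≤ m := by
    have : (8 : ℝ) * Al.card ≤ m := by linarith
    exact_mod_cast this
  refine ⟨t, s, hexec, ?_, ?_⟩
  · have h₁ : (t : ℝ) ≤ 402000 * (m * (c * j)) := by exact_mod_cast ht
    have h₂ := le_five_mul_log hm hj
    have h₃ : (c : ℝ) * Real.log m ≤ b / φ := by
      calc (c : ℝ) * Real.log m ≤ b * (1 / (φ * Real.log m)) * Real.log m := by gcongr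
        _ = b / φ := by field_simp
    have h₄ : (c : ℝ) * j ≤ 5 * (b / φ) := by nlinarith
    calc (t : ℝ) ≤ 402000 * (m * (5 * (b / φ))) := h₁.trans (by gcongr)
      _ = 2010000 * b * (m / φ) := by ring
      _ ≤ _ := by gcongr; linarith [div_pos (show (0 : ℝ) < 50 by norm_num) ha]
  · rcases hF.flag with ⟨h₁, h₂⟩ | ⟨h₁, v, hv⟩
    · refine Or.inl ⟨h₁, hF.isFeasibleFlowOn hN (fun v _ => ?_) (by simp) (by simp) (by simp)⟩
      by_contra h
      have : (v : ℕ) ∈ N.dead D := Net.mem_dead.2 ⟨hN.n_eq ▸ v.2, h⟩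
      simp [h₂] at this
    · have hcond := hF.conductance_le hN hc hAr' hAl'
      obtain ⟨h₃, h₄⟩ := Net.mem_dead.1 hv
      refine Or.inr ⟨h₁, ⟨⟨v, hN.n_eq ▸ h₃⟩, hF.mem_cut_of_dead hN h₄⟩, hcond, hcond.trans ?_, ?_,
        hF.isFeasibleFlowOn hN ?_ ?_ ?_ ?_, hF.cutRespectsNeighbours hN⟩
      · have h₅ : a ≤ c * (φ * Real.log m) := by
          rwa [mul_one_div, div_le_iff₀ (by positivity)] at hac
        calc 50 / (c : ℝ) ≤ 50 / a * (φ * Real.log m) := by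
              rw [div_mul_eq_mul_div, div_le_div_iff₀ hc₀ ha]
              nlinarith
          _ ≤ _ := by gcongr; linarith [mul_pos (show (0 : ℝ) < 2010000 by norm_num) hb]
      · have h₅ : (m : ℝ) ≤ 26 * G.vol (outputCut n s)ᶜ := by
          exact_mod_cast (hF.cut_bounds hN hc hAr' hAl').2.2
        linarith
      · exact fun v hv => hF.alive_of_notMem_cut hN (Finset.mem_compl.1 hv)
      · exact fun e h₅ h₆ => by simpa using hF.notMem_cut_of_edge hN h₅ h₆
      · exact fun v hv => by simp [Finset.mem_compl.1 hv]
      · exact fun v hv => by simp [Finset.mem_compl.1 hv]
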